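/- **Theorem (A priori bound on the remainder).** Let $\mathbb{T}=\mathbb{R}/\mathbb{Z}$ and, for $a\in\mathbb{R}$, let $\mathcal{C}^{a}=\mathcal{C}^a(\mathbb{T})$ be the completion of $C^\infty(\mathbb{T})$ under the Besov norm $\|f\|_{\mathcal{C}^a}=\sup_{k\ge -1}2^{ak}\|\Delta_k f\|_{L^\infty}$, where $(\Delta_k)_{k\geq -1}$ are Littlewood--Paley projections; its elements are real distributions on $\mathbb{T}$ (continuous functions if $a>0$). For a distribution $f$ write $\bar f=\langle f,1\rangle$ for its spatial mean. Fix $T>0$ and exponents $$\alpha_0\in(-\tfrac12,0),\qquad \alpha\in(0,\alpha_0+\tfrac12),\qquad \tfrac{\alpha-\alpha_0}{2}<\eta<\tfrac14 .$$ For a continuous function $f$ on $\mathbb{T}$ let $\rho_f$ be the solution of $-\partial_{xx}\rho_f=f-\bar f$ with $\overline{\rho_f}=0$. Let $C_T\mathcal{C}^\alpha$ be the space of continuous maps $[0,T]\to\mathcal{C}^\alpha$, write $\|Z\|_{C_t\mathcal{C}^\alpha}=\sup_{s\in[0,t]}\|Z_s\|_{\mathcal{C}^\alpha}$, and let $C_{\eta;T}\mathcal{C}^\alpha$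 be the space of continuous maps $w:(0,T]\to\mathcal{C}^\alpha$ with $\sup_{t\in(0,T]}(t^\eta\wedge 1)\|w_t\|_{\mathcal{C}^\alpha}<\infty$. Given $\chi>0$, $\zeta\in\mathcal{C}^{\alpha_0}$ and $Z\in C_T\mathcal{C}^\alpha$ with $\bar Z_t=0$ for all $t\in[0,T]$, a *mild solution on $[0,T]$ of the remainder equation* started from $\zeta$ and driven by $Z$ is a $w\in C_{\eta;T}\mathcal{C}^\alpha$ such that for all $t\in(0,T]$ $$w_t=e^{t\Delta}\zeta+\int_0^t e^{(t-s)\Delta}\,\chi\,\partial_x\big((w_s+Z_s)^2\,\partial_x\rho_{w_s+Z_s}\big)\,ds .$$ Then there exists a constant $C>0$, depending only on $\alpha_0,\alpha,\eta,T$ (in particular independent of $\zeta$, $Z$, $p$ and $\chi$), such that for every even integer $p\ge 2$, every $\chi>0$, every $\mathfrak{m}\in\{0,1\}$, every $\zeta\in\mathcal{C}^{\alpha_0}$ with $\bar\zeta=\mathfrak{m}$, every $Z\in C_T\mathcal{C}^\alpha$ with $\bar Z_t=0$ for all $t\in[0,T]$, every mild solution $w$ on $[0,T]$ of the remainder equation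 started from $\zeta$ and driven by $Z$, and every $t\in(0,T]$, $$\|w_t\|_{L^p(\mathbb{T})}\le\max\Big\{\Big(\frac{\chi t}{4}\Big)^{-\frac12},\ C\,(p\vee\chi)^{\gamma}\,\|Z\|_{C_t\mathcal{C}^\alpha}^{\frac1\alpha},\ C\,(p\vee\chi)^{\frac{p+1}{p+2}}\,\mathfrak{m}\Big\},\qquad \gamma=\frac{p(1+\alpha)+2+\alpha}{\alpha(p+2)} .$$ -/

import Mathlib

open Set Filter Topology MeasureTheory
open scoped ENNReal ContDiff

noncomputable section

namespace Chemo

/-- The torus `ℝ / ℤ`, with its Haar probability measure. -/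
abbrev Torus : Type := UnitAddCircle

/-- The real vector space of smooth real functions on the torus, i.e. of functions whose
`1`-periodic lift to `ℝ` is smooth. -/
def SmoothFun : Submodule ℝ (Torus → ℝ) where
  carrier := {f | ContDiff ℝ ∞ (fun x : ℝ => f (x : Torus))}
  add_mem' {f g} (hf : ContDiff ℝ ∞ (fun x : ℝ => f (x : Torus)))
      (hg : ContDiff ℝ ∞ (fun x : ℝ => g (x : Torus))) := hf.add hg
  zero_mem' := (contDiff_const : ContDiff ℝ ∞ (fun _ : ℝ => (0 : ℝ)))
  smul_mem' c f (hf : ContDiff ℝ ∞ (fun x : ℝ => f (x : Torus))) :=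
    (contDiff_const (c := c)).smul hf

theorem fourier_coe_eq (m : ℤ) (x : ℝ) :
    (fourier m (x : Torus) : ℂ) = Complex.exp (((2 * Real.pi * m * x : ℝ) : ℂ) * Complex.I) := by
  rw [fourier_coe_apply]
  congr 1
  push_cast
  ring

theorem fourier_re_mem (m : ℤ) : (fun x : Torus => (fourier m x : ℂ).re) ∈ SmoothFun := by
  change ContDiff ℝ ∞ (fun x : ℝ => (fourier m (x : Torus) : ℂ).re)
  simp only [fourier_coe_eq, Complex.exp_ofReal_mul_I_re]
  fun_prop

theorem fourier_im_mem (m : ℤ) : (fun x : Torus => (fourier m x : ℂ).im) ∈ SmoothFun := by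
  change ContDiff ℝ ∞ (fun x : ℝ => (fourier m (x : Torus) : ℂ).im)
  simp only [fourier_coe_eq, Complex.exp_ofReal_mul_I_im]
  fun_prop

/-- The smooth function `x ↦ cos (2 π m x)`. -/
def cosMode (m : ℤ) : SmoothFun := ⟨fun x => (fourier m x : ℂ).re, fourier_re_mem m⟩

/-- The smooth function `x ↦ sin (2 π m x)`. -/
def sinMode (m : ℤ) : SmoothFun := ⟨fun x => (fourier m x : ℂ).im, fourier_im_mem m⟩

/-- The constant function `1`. -/
def oneFun : SmoothFun := ⟨fun _ => 1, (contDiff_const : ContDiff ℝ ∞ (fun _ : ℝ => (1 : ℝ)))⟩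

/-- Real distributions on the torus: linear functionals on the smooth functions that are
continuous for the topology given by the suprema of the derivatives. -/
structure TorusDistribution where
  toLin : SmoothFun →ₗ[ℝ] ℝ
  continuous' : ∃ (N : ℕ) (K : ℝ), ∀ (φ : SmoothFun) (M : ℝ),
    (∀ k ≤ N, ∀ x : ℝ, |iteratedDeriv k (fun y : ℝ => φ.1 (y : Torus)) x| ≤ M) →
      |toLin φ| ≤ K * M

/-- Fourier coefficients `⟨u, e_{-m}⟩`, `e_m (x) = exp (2 π i m x)`, of a distribution `u`. -/
def TorusDistribution.coeff (u : TorusDistribution) (m : ℤ) : ℂ :=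
  (u.toLin (cosMode m) : ℂ) - Complex.I * (u.toLin (sinMode m) : ℂ)

/-- The spatial mean `⟨u, 1⟩` of a distribution. -/
def TorusDistribution.mean (u : TorusDistribution) : ℝ := u.toLin oneFun

/-- Fourier coefficients `∫ e_{-m} f` of a real function `f`. -/
def funCoeff (f : Torus → ℝ) (m : ℤ) : ℂ := fourierCoeff (fun x => (f x : ℂ)) m

/-! ### Littlewood-Paley blocks and Hölder-Besov spaces

Distributions enter the following definitions through their Fourier coefficients `c : ℤ → ℂ`. -/

/-- A smooth even cut-off with values in `[0, 1]`, equal to `1` on `[-1, 1]` and to `0`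
outside `(-2, 2)`. -/
def lpCutoff (ξ : ℝ) : ℝ := Real.smoothTransition (2 - |ξ|)

/-- A dyadic partition of unity. The index `j : ℕ` stands for the Littlewood-Paley index
`k = j - 1 ≥ -1`. The symbol is supported in `|ξ| ≤ 2` if `j = 0` and in
`2 ^ k ≤ |ξ| ≤ 2 ^ (k + 2)` otherwise. -/
def lpSymbol : ℕ → ℝ → ℝ
  | 0, ξ => lpCutoff ξ
  | k + 1, ξ => lpCutoff (ξ / 2 ^ (k + 1)) - lpCutoff (ξ / 2 ^ k)

theorem lpCutoff_eq_zero {ξ : ℝ} (h : 2 ≤ |ξ|) : lpCutoff ξ = 0 :=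
  Real.smoothTransition.zero_of_nonpos (by linarith)

theorem lpCutoff_eq_one {ξ : ℝ} (h : |ξ| ≤ 1) : lpCutoff ξ = 1 :=
  Real.smoothTransition.one_of_one_le (by linarith)

theorem sum_lpSymbol (n : ℕ) (ξ : ℝ) :
    ∑ j ∈ Finset.range (n + 1), lpSymbol j ξ = lpCutoff (ξ / 2 ^ n) := by
  induction n with
  | zero => simp [lpSymbol]
  | succ n ih => rw [Finset.sum_range_succ, ih, lpSymbol]; ring

theorem lpSymbol_eq_zero (j : ℕ) {ξ : ℝ} (h : 2 ^ (j + 1) ≤ |ξ|) : lpSymbol j ξ = 0 := by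
  cases j with
  | zero => exact lpCutoff_eq_zero (by simpa using h)
  | succ k =>
    have h1 : (2 : ℝ) ≤ |ξ / 2 ^ (k + 1)| := by
      rw [abs_div, abs_of_pos (by positivity : (0 : ℝ) < 2 ^ (k + 1)), le_div_iff₀ (by positivity)]
      calc (2 : ℝ) * 2 ^ (k + 1) = 2 ^ (k + 1 + 1) := by ring
        _ ≤ |ξ| := h
    have h2 : (2 : ℝ) ≤ |ξ / 2 ^ k| := by
      rw [abs_div, abs_of_pos (by positivity : (0 : ℝ) < 2 ^ k), le_div_iff₀ (by positivity)]
      calc (2 : ℝ) * 2 ^ k ≤ 2 ^ (k + 1 + 1) := by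
            rw [pow_succ, pow_succ]; nlinarith [pow_pos (two_pos : (0 : ℝ) < 2) k]
        _ ≤ |ξ| := h
    rw [lpSymbol, lpCutoff_eq_zero h1, lpCutoff_eq_zero h2, sub_zero]

/-- The Littlewood-Paley block `Δ_{j - 1}`. The symbol vanishes at all other frequencies. -/
def lpBlock (j : ℕ) (c : ℤ → ℂ) (x : Torus) : ℂ :=
  ∑ m ∈ Finset.Icc (-(2 ^ (j + 1) : ℤ)) (2 ^ (j + 1)), (lpSymbol j m : ℂ) * c m * fourier m x

/-- The norm of the Besov space `B^a_{∞,∞}`: `sup_{k ≥ -1} 2 ^ (a k) ‖Δ_k c‖_{L^∞}`. -/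
def besovNorm (a : ℝ) (c : ℤ → ℂ) : ℝ≥0∞ :=
  ⨆ j : ℕ, ENNReal.ofReal ((2 : ℝ) ^ (a * ((j : ℝ) - 1))) * ⨆ x : Torus, ‖lpBlock j c x‖ₑ

/-- Membership in the Hölder-Besov space `𝒞^a`, the completion of the smooth functions with
respect to the norm of `B^a_{∞,∞}`. -/
def MemHolderBesov (a : ℝ) (c : ℤ → ℂ) : Prop :=
  ∀ ε : ℝ≥0∞, 0 < ε → ∃ φ : SmoothFun, besovNorm a (fun m => c m - funCoeff φ.1 m) ≤ ε

/-! For `a > 0` the elements of `𝒞^a` are continuous functions. -/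

/-- `f` restricts to a continuous map from `I` to `𝒞^a`. -/
def ContPath (I : Set ℝ) (a : ℝ) (f : ℝ → C(Torus, ℝ)) : Prop :=
  ∀ t ∈ I, MemHolderBesov a (funCoeff (f t)) ∧
    Tendsto (fun s => besovNorm a (funCoeff (f s - f t))) (𝓝[I] t) (𝓝 0)

/-- The norm `sup_{s ∈ [0, t]} ‖f_s‖_{𝒞^a}`. -/
def pathNorm (a t : ℝ) (f : ℝ → C(Torus, ℝ)) : ℝ≥0∞ :=
  ⨆ s ∈ Icc 0 t, besovNorm a (funCoeff (f s))

/-- `f ∈ C_{η;T} 𝒞^a`: `f` is continuous from `(0, T]` to `𝒞^a` and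
`sup_{t ∈ (0, T]} (t ^ η ∧ 1) ‖f_t‖_{𝒞^a} < ∞`. -/
def MemWeighted (η T a : ℝ) (f : ℝ → C(Torus, ℝ)) : Prop :=
  ContPath (Ioc 0 T) a f ∧
    (⨆ t ∈ Ioc 0 T, ENNReal.ofReal (min (t ^ η) 1) * besovNorm a (funCoeff (f t))) < ⊤

/-! ### The remainder equation -/

/-- The heat semigroup `e^{tΔ}`, `t > 0`, applied to the (real) distribution with Fourier
coefficients `c`. -/
def heat (t : ℝ) (c : ℤ → ℂ) (x : Torus) : ℝ :=
  (∑' m : ℤ, (Real.exp (-4 * Real.pi ^ 2 * (m : ℝ) ^ 2 * t) : ℂ) * c m * fourier m x).re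

/-- Fourier coefficients of the distributional derivative. -/
def derivCoeff (c : ℤ → ℂ) (m : ℤ) : ℂ := 2 * Real.pi * Complex.I * m * c m

/-- The classical derivative of a function on the torus. -/
def torusDeriv (f : Torus → ℝ) (x : Torus) : ℝ := deriv (fun h : ℝ => f (x + (h : Torus))) 0

/-- `ρ = ρ_f` is the mean-free solution of `-∂ₓₓ ρ = f - ∫ f` on the torus. -/
structure IsPotential (f ρ : C(Torus, ℝ)) : Prop where
  contDiff : ContDiff ℝ 2 (fun x : ℝ => ρ (x : Torus))
  poisson : ∀ x : Torus, -torusDeriv (torusDeriv ρ) x = f x - ∫ y, f y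
  mean_free : ∫ x, ρ x = 0

/-- `w ∈ C_{η;T} 𝒞^α` is a mild solution on `[0, T]`, started from `ζ` and driven by `Z`, of
`∂ₜ w - ∂ₓₓ w = χ ∂ₓ ((w + Z)² ∂ₓ ρ_{w + Z})`. -/
structure IsMildSolution (α η T χ : ℝ) (ζ : TorusDistribution) (Z w : ℝ → C(Torus, ℝ)) :
    Prop where
  mem : MemWeighted η T α w
  mild : ∃ ρ : ℝ → C(Torus, ℝ), (∀ s ∈ Ioc 0 T, IsPotential (w s + Z s) (ρ s)) ∧
    ∀ t ∈ Ioc 0 T, ∀ x : Torus,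
      w t x = heat t ζ.coeff x +
        ∫ s in 0..t, heat (t - s)
          (derivCoeff (funCoeff fun y => χ * ((w s y + Z s y) ^ 2 * torusDeriv (ρ s) y))) x

end Chemo

end

noncomputable section

namespace Chemo

/-! ### Trigonometric kernels -/

/-! The bound is an energy estimate in which the chemotactic flux damps the solution. Write `p = q +
2`, `u = w + Z`, `R = ∂ₓρ_u` and `N = ‖w‖_{L^p}`. Test the equation with `w ^ (p - 1)` and integrate
by parts. The part `χ w² R` of the flux gives `(w ^ (p + 1))ₓ R` up to a factor. Since `-Rₓ = u - 𝔪`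
is close to `w`, this yields the damping `-χ (p - 1) / (p + 1) ∫ w ^ (p + 2)`, at most `-(χ / 3) N ^
(p + 2)` by monotonicity of `L^p` norms. If every other term is absorbed, `N ^ p` has derivative at
most `-p (χ / 8) N ^ (p + 2)`. Hence `N⁻²` grows at rate at least `χ / 4`, so `N(t) ≤ (χ t / 4) ^
(-1/2)` whatever the initial datum (`rpow_neg_ge_of_deriv_le`, `le_threshold_of_decay`).

The terms containing `Z` are absorbed once `N` exceeds a threshold `L`. Cut the Littlewood-Paley
series of `Z` at frequency about `N`. The low part `Z₁` is differentiable and can be integrated by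
parts like `w`, with `|Z₁'| ≲ N ^ (1 - α) ‖Z‖`. The remainder is of size `N ^ (-α) ‖Z‖` and is
paired with `wₓ`, then absorbed by the viscous term `(p - 1) ∫ w ^ (p - 2) wₓ²`. Both are small
compared with the damping when `N ^ α` exceeds a multiple of `(p ∨ χ) ‖Z‖`. Because `α γ ≥ 1`, the
stated threshold suffices (`exists_lp_decomposition`, `exists_splits`, `threshold_le`, `energy_le`).

A mild solution is only Hölder in space, so the computation is made on de la Vallée-Poussin means.
They are multipliers bounded on continuous functions, commute with derivatives, and converge
uniformly on compact sets of functions. The Duhamel formula gives an ODE for each Fourier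
coefficient (`hasDerivAt_funCoeff_of_mild`), so the means solve the equation with a uniformly small
flux error. The order tends to infinity only in the time-integrated inequality (`lpn_decay`). -/

theorem volume_eq_haar : (volume : Measure Torus) = AddCircle.haarAddCircle := by
  rw [AddCircle.volume_eq_smul_haarAddCircle]; simp

theorem norm_fourier_apply (m : ℤ) (x : Torus) : ‖(fourier m x : ℂ)‖ = 1 := by
  rw [fourier_apply]; exact Circle.norm_coe _

theorem integral_fourier (m : ℤ) :
    ∫ x : Torus, (fourier m x : ℂ) ∂AddCircle.haarAddCircle = if m = 0 then 1 else 0 := by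
  have h := congrFun (fourierCoeff_fourier (T := (1 : ℝ)) m) 0
  simp only [fourierCoeff, neg_zero, fourier_zero, one_smul] at h
  rw [h]
  by_cases hm : m = 0
  · simp [hm]
  · rw [if_neg hm, Pi.single_eq_of_ne (Ne.symm hm)]

theorem integrable_torus {E : Type*} [NormedAddCommGroup E] {f : Torus → E} (hf : Continuous f) :
    Integrable f AddCircle.haarAddCircle :=
  hf.integrable_of_hasCompactSupport (HasCompactSupport.of_compactSpace f)

theorem integral_norm_sq_trig (s : Finset ℤ) (a : ℤ → ℂ) :
    ∫ y : Torus, ‖∑ k ∈ s, a k * fourier (-k) y‖ ^ 2 ∂AddCircle.haarAddCircle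
      = ∑ k ∈ s, ‖a k‖ ^ 2 := by
  have h : ∀ y : Torus, ((‖∑ k ∈ s, a k * fourier (-k) y‖ ^ 2 : ℝ) : ℂ)
      = ∑ k ∈ s, ∑ l ∈ s, (starRingEnd ℂ (a k) * a l) * fourier (k - l) y := by
    intro y
    push_cast
    rw [← Complex.conj_mul', map_sum, Finset.sum_mul_sum]
    refine Finset.sum_congr rfl fun k _ => Finset.sum_congr rfl fun l _ => ?_
    rw [map_mul, ← fourier_neg, neg_neg, sub_eq_add_neg, fourier_add]
    ring
  have h2 : ((∫ y : Torus, ‖∑ k ∈ s, a k * fourier (-k) y‖ ^ 2 ∂AddCircle.haarAddCircle : ℝ) : ℂ)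
      = ((∑ k ∈ s, ‖a k‖ ^ 2 : ℝ) : ℂ) := by
    rw [← integral_complex_ofReal]
    simp only [h]
    rw [integral_finsetSum _ fun k _ => integrable_torus (by fun_prop)]
    push_cast
    refine Finset.sum_congr rfl fun k hk => ?_
    rw [integral_finsetSum _ fun l _ => integrable_torus (by fun_prop)]
    simp only [integral_const_mul, integral_fourier, sub_eq_zero]
    simp [hk, Complex.conj_mul']
  exact_mod_cast h2

/-- The double sum is `∫ A B f` for two trigonometric polynomials, so `|A B| ≤ (θ |A|² + θ⁻¹ |B|²) /
2` and Parseval bound it. This controls the `L¹` norm of a product kernel, and `θ` is left free to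
balance the two factors. -/
theorem norm_sum_sum_fourier_le (s t : Finset ℤ) (a b : ℤ → ℂ) (f : C(Torus, ℂ)) {M θ : ℝ}
    (hM : ∀ x, ‖f x‖ ≤ M) (hθ : 0 < θ) (x : Torus) :
    ‖∑ k ∈ s, ∑ l ∈ t, a k * b l * (fourierCoeff f (k + l) * fourier (k + l) x)‖
      ≤ M * ((θ * ∑ k ∈ s, ‖a k‖ ^ 2 + θ⁻¹ * ∑ l ∈ t, ‖b l‖ ^ 2) / 2) := by
  set A : Torus → ℂ := fun y => ∑ k ∈ s, (a k * fourier k x) * fourier (-k) y with hA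
  set B : Torus → ℂ := fun y => ∑ l ∈ t, (b l * fourier l x) * fourier (-l) y with hB
  have hAc : Continuous A := by fun_prop
  have hBc : Continuous B := by fun_prop
  have key : ∑ k ∈ s, ∑ l ∈ t, a k * b l * (fourierCoeff f (k + l) * fourier (k + l) x)
      = ∫ y, A y * B y * f y ∂AddCircle.haarAddCircle := by
    have : ∀ y, A y * B y * f y = ∑ k ∈ s, ∑ l ∈ t,
        (a k * b l * fourier (k + l) x) * (fourier (-(k + l)) y * f y) := by
      intro y
      rw [hA, hB, Finset.sum_mul_sum, Finset.sum_mul]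
      refine Finset.sum_congr rfl fun k _ => ?_
      rw [Finset.sum_mul]
      refine Finset.sum_congr rfl fun l _ => ?_
      rw [neg_add, fourier_add, fourier_add]
      ring
    simp only [this]
    rw [integral_finsetSum _ fun k _ => integrable_torus (by fun_prop)]
    refine Finset.sum_congr rfl fun k _ => ?_
    rw [integral_finsetSum _ fun l _ => integrable_torus (by fun_prop)]
    refine Finset.sum_congr rfl fun l _ => ?_
    rw [integral_const_mul, fourierCoeff]
    simp only [smul_eq_mul]
    ring
  rw [key]
  have hM0 : 0 ≤ M := (norm_nonneg _).trans (hM x)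
  calc ‖∫ y, A y * B y * f y ∂AddCircle.haarAddCircle‖
      ≤ ∫ y, M * ((θ * ‖A y‖ ^ 2 + θ⁻¹ * ‖B y‖ ^ 2) / 2) ∂AddCircle.haarAddCircle := by
        refine norm_integral_le_of_norm_le (integrable_torus (by fun_prop)) (ae_of_all _ fun y => ?_)
        rw [norm_mul, norm_mul, mul_comm]
        refine mul_le_mul (hM y) ?_ (by positivity) hM0
        have h1 : θ * θ⁻¹ = 1 := mul_inv_cancel₀ hθ.ne'
        have h2 : θ * ‖A y‖ ^ 2 + θ⁻¹ * ‖B y‖ ^ 2 - 2 * (‖A y‖ * ‖B y‖)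
            = θ * (‖A y‖ - θ⁻¹ * ‖B y‖) ^ 2 := by
          linear_combination (2 * ‖A y‖ * ‖B y‖ - θ⁻¹ * ‖B y‖ ^ 2) * h1
        have : 0 ≤ θ * (‖A y‖ - θ⁻¹ * ‖B y‖) ^ 2 := by positivity
        linarith
    _ = M * ((θ * ∑ k ∈ s, ‖a k‖ ^ 2 + θ⁻¹ * ∑ l ∈ t, ‖b l‖ ^ 2) / 2) := by
        rw [integral_const_mul, integral_div, integral_add (integrable_torus (by fun_prop))
          (integrable_torus (by fun_prop)), integral_const_mul, integral_const_mul, hA, hB,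
          integral_norm_sq_trig, integral_norm_sq_trig]
        simp only [norm_mul, norm_fourier_apply, mul_one]

/-- The de la Vallée-Poussin mean of order `n` of the distribution with Fourier coefficients `c`. -/
def vallee (n : ℕ) (c : ℤ → ℂ) (x : Torus) : ℂ :=
  ∑ k ∈ Finset.Icc (-(n : ℤ)) n, ∑ l ∈ Finset.Icc (-(2 * n : ℤ)) (2 * n),
    ((2 * n + 1 : ℂ))⁻¹ * (c (k + l) * fourier (k + l) x)

theorem continuous_vallee (n : ℕ) (c : ℤ → ℂ) : Continuous (vallee n c) := by
  unfold vallee; fun_prop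

theorem vallee_sub (n : ℕ) (c d : ℤ → ℂ) (x : Torus) :
    vallee n (fun m => c m - d m) x = vallee n c x - vallee n d x := by
  simp only [vallee, ← Finset.sum_sub_distrib]
  refine Finset.sum_congr rfl fun k _ => Finset.sum_congr rfl fun l _ => by ring

theorem vallee_add (n : ℕ) (c d : ℤ → ℂ) (x : Torus) :
    vallee n (fun m => c m + d m) x = vallee n c x + vallee n d x := by
  simp only [vallee, ← Finset.sum_add_distrib]
  refine Finset.sum_congr rfl fun k _ => Finset.sum_congr rfl fun l _ => by ring

theorem card_Icc_neg (n : ℕ) : (Finset.Icc (-(n : ℤ)) n).card = 2 * n + 1 := by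
  rw [Int.card_Icc]; omega

theorem norm_vallee_le (n : ℕ) (f : C(Torus, ℂ)) {M : ℝ} (hM : ∀ x, ‖f x‖ ≤ M) (x : Torus) :
    ‖vallee n (fourierCoeff f) x‖ ≤ 2 * M := by
  have hM0 : 0 ≤ M := (norm_nonneg _).trans (hM x)
  -- With `θ = 2n + 1` the two halves are `1` and `(4n + 1) / (2n + 1) ≤ 2`.
  have h := norm_sum_sum_fourier_le (Finset.Icc (-(n : ℤ)) n) (Finset.Icc (-(2 * n : ℤ)) (2 * n))
    (fun _ => (2 * n + 1 : ℂ)⁻¹) (fun _ => 1) f hM (θ := 2 * n + 1) (by positivity) x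
  have h1 := card_Icc_neg n
  have h2 : (Finset.Icc (-(2 * n : ℤ)) (2 * n)).card = 4 * n + 1 := by
    rw [Int.card_Icc]; omega
  have h3 : ‖(2 * n + 1 : ℂ)‖ = 2 * n + 1 := by
    have : (2 * n + 1 : ℂ) = ((2 * n + 1 : ℝ) : ℂ) := by push_cast; ring
    rw [this, Complex.norm_real, Real.norm_of_nonneg (by positivity)]
  simp only [Finset.sum_const, h1, h2, norm_inv, h3, norm_one, nsmul_eq_mul, mul_one] at h
  refine (h.trans ?_)
  rw [mul_comm 2 M]
  refine mul_le_mul_of_nonneg_left ?_ hM0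
  push_cast
  have h5 : (0 : ℝ) < 2 * n + 1 := by positivity
  field_simp
  have : (0:ℝ) ≤ n := by positivity
  nlinarith

/-- For `|m| ≤ n` each `k` in `[-n, n]` has its partner `m - k` in `[-2n, 2n]`. The mode is
therefore counted exactly `2n + 1` times, which cancels the normalization; this is why the second
range is twice the first. -/
theorem vallee_single (n : ℕ) {m : ℤ} (hm : |m| ≤ n) (x : Torus) :
    vallee n (fourierCoeff (fourier m : C(Torus, ℂ))) x = fourier m x := by
  have h : ∀ k ∈ Finset.Icc (-(n : ℤ)) n, ∑ l ∈ Finset.Icc (-(2 * n : ℤ)) (2 * n),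
    ((2 * n + 1 : ℂ))⁻¹ * (fourierCoeff (fourier m : C(Torus, ℂ)) (k + l) * fourier (k + l) x)
      = (2 * n + 1 : ℂ)⁻¹ * fourier m x := by
    intro k hk
    rw [Finset.mem_Icc] at hk
    rw [abs_le] at hm
    rw [Finset.sum_eq_single (m - k)]
    · rw [fourierCoeff_fourier]; simp
    · intro l _ hl
      rw [fourierCoeff_fourier, Pi.single_eq_of_ne (by omega)]; simp
    · intro hl
      exact absurd (Finset.mem_Icc.2 (by omega)) hl
  rw [vallee, Finset.sum_congr rfl h, Finset.sum_const, card_Icc_neg, nsmul_eq_mul]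
  have : (2 * n + 1 : ℂ) ≠ 0 := by exact_mod_cast (by positivity : (2 * n + 1 : ℝ) ≠ 0)
  push_cast
  field_simp

theorem vallee_const_mul (n : ℕ) (b : ℂ) (c : ℤ → ℂ) (x : Torus) :
    vallee n (fun m => b * c m) x = b * vallee n c x := by
  simp only [vallee, Finset.mul_sum]
  refine Finset.sum_congr rfl fun k _ => Finset.sum_congr rfl fun l _ => by ring

theorem fourierCoeff_add_apply (f g : C(Torus, ℂ)) (m : ℤ) :
    fourierCoeff (f + g : C(Torus, ℂ)) m = fourierCoeff f m + fourierCoeff g m := by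
  rw [ContinuousMap.coe_add, fourierCoeff.add (integrable_torus f.continuous)
    (integrable_torus g.continuous)]
  rfl

theorem fourierCoeff_smul_apply (b : ℂ) (f : C(Torus, ℂ)) (m : ℤ) :
    fourierCoeff (b • f : C(Torus, ℂ)) m = b * fourierCoeff f m := by
  rw [ContinuousMap.coe_smul, fourierCoeff.const_smul]
  rfl

theorem fourierCoeff_sub_apply (f g : C(Torus, ℂ)) (m : ℤ) :
    fourierCoeff (f - g : C(Torus, ℂ)) m = fourierCoeff f m - fourierCoeff g m := by
  have h : f - g = f + (-1 : ℂ) • g := by ext; simp [sub_eq_add_neg]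
  rw [h, fourierCoeff_add_apply, fourierCoeff_smul_apply]
  ring

/-- `P` is reproduced by all de la Vallée-Poussin means of order at least `n`. -/
def Reproduced (n : ℕ) (P : C(Torus, ℂ)) : Prop :=
  ∀ k ≥ n, ∀ x, vallee k (fourierCoeff P) x = P x

theorem Reproduced.mono {n n' : ℕ} {P : C(Torus, ℂ)} (h : Reproduced n P) (hn : n ≤ n') :
    Reproduced n' P := fun k hk => h k (hn.trans hk)

theorem Reproduced.fourier {n : ℕ} {m : ℤ} (hm : |m| ≤ n) : Reproduced n (fourier m) :=
  fun k hk x => vallee_single k (hm.trans (by exact_mod_cast hk)) x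

theorem Reproduced.add {n : ℕ} {P Q : C(Torus, ℂ)} (hP : Reproduced n P) (hQ : Reproduced n Q) :
    Reproduced n (P + Q) := fun k hk x => by
  have : fourierCoeff (P + Q : C(Torus, ℂ)) = fun m => fourierCoeff P m + fourierCoeff Q m :=
    funext (fourierCoeff_add_apply P Q)
  rw [this, vallee_add, hP k hk, hQ k hk]; rfl

theorem Reproduced.smul {n : ℕ} (b : ℂ) {P : C(Torus, ℂ)} (hP : Reproduced n P) :
    Reproduced n (b • P) := fun k hk x => by
  have : fourierCoeff (b • P : C(Torus, ℂ)) = fun m => b * fourierCoeff P m :=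
    funext (fourierCoeff_smul_apply b P)
  rw [this, vallee_const_mul, hP k hk]; rfl

theorem Reproduced.zero (n : ℕ) : Reproduced n 0 :=
  fun k _ x => by simp [vallee, fourierCoeff]

theorem Reproduced.sum {ι : Type*} {n : ℕ} (s : Finset ι) (P : ι → C(Torus, ℂ))
    (h : ∀ i ∈ s, Reproduced n (P i)) : Reproduced n (∑ i ∈ s, P i) :=
  Finset.sum_induction _ (Reproduced n) (fun _ _ => Reproduced.add) (Reproduced.zero n) h

theorem exists_reproduced_of_mem_span {P : C(Torus, ℂ)}
    (hP : P ∈ Submodule.span ℂ (range (fourier (T := (1 : ℝ))))) : ∃ n, Reproduced n P := by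
  induction hP using Submodule.span_induction with
  | mem x h =>
    obtain ⟨m, rfl⟩ := h
    exact ⟨m.natAbs, Reproduced.fourier (by simp)⟩
  | zero => exact ⟨0, Reproduced.zero 0⟩
  | add P Q _ _ hP hQ =>
    obtain ⟨n, hn⟩ := hP
    obtain ⟨k, hk⟩ := hQ
    exact ⟨max n k, (hn.mono (le_max_left _ _)).add (hk.mono (le_max_right _ _))⟩
  | smul b P _ hP =>
    obtain ⟨n, hn⟩ := hP
    exact ⟨n, hn.smul b⟩

theorem exists_reproduced_near (f : C(Torus, ℂ)) {ε : ℝ} (hε : 0 < ε) :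
    ∃ (P : C(Torus, ℂ)) (n : ℕ), Reproduced n P ∧ ∀ x, ‖f x - P x‖ ≤ ε := by
  have h : f ∈ (Submodule.span ℂ (range (fourier (T := (1 : ℝ))))).topologicalClosure := by
    rw [span_fourier_closure_eq_top]; trivial
  obtain ⟨P, hP, hd⟩ := Metric.mem_closure_iff.1 h ε hε
  obtain ⟨n, hn⟩ := exists_reproduced_of_mem_span hP
  exact ⟨P, n, hn, fun x => by
    rw [← dist_eq_norm]; exact (ContinuousMap.dist_apply_le_dist x).trans hd.le⟩

theorem norm_vallee_sub_le (n : ℕ) (f P : C(Torus, ℂ)) (hP : Reproduced n P) {ε : ℝ}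
    (h : ∀ x, ‖f x - P x‖ ≤ ε) {k : ℕ} (hk : n ≤ k) (x : Torus) :
    ‖vallee k (fourierCoeff f) x - f x‖ ≤ 3 * ε := by
  have h1 := norm_vallee_le k (f - P) h x
  have h2 : fourierCoeff (f - P : C(Torus, ℂ)) = fun m => fourierCoeff f m - fourierCoeff P m :=
    funext (fourierCoeff_sub_apply f P)
  rw [h2, vallee_sub, hP k hk] at h1
  calc ‖vallee k (fourierCoeff f) x - f x‖
      = ‖(vallee k (fourierCoeff f) x - P x) - (f x - P x)‖ := by congr 1; ring
    _ ≤ 2 * ε + ε := (norm_sub_le _ _).trans (add_le_add h1 (h x))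
    _ = 3 * ε := by ring

/-- The de la Vallée-Poussin means converge uniformly on compact sets of continuous functions. -/
theorem exists_vallee_near_of_isCompact {K : Set C(Torus, ℂ)} (hK : IsCompact K) {ε : ℝ}
    (hε : 0 < ε) :
    ∃ n, ∀ k ≥ n, ∀ f ∈ K, ∀ x, ‖vallee k (fourierCoeff f) x - f x‖ ≤ ε := by
  -- A function within `ε / 6` of a centre is within `ε / 3` of the polynomial attached to that
  -- centre, and `norm_vallee_sub_le` loses a factor `3`.
  choose P n hP hd using fun f : C(Torus, ℂ) => exists_reproduced_near f (ε := ε / 6) (by positivity)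
  obtain ⟨t, -, ht⟩ := hK.elim_nhds_subcover (fun f => Metric.ball f (ε / 6))
    (fun f _ => Metric.ball_mem_nhds f (by positivity))
  refine ⟨t.sup n, fun k hk f hf x => ?_⟩
  obtain ⟨g, hg, hfg⟩ := mem_iUnion₂.1 (ht hf)
  have h : ∀ y, ‖f y - P g y‖ ≤ ε / 3 := fun y => by
    have h1 : ‖f y - g y‖ ≤ ε / 6 := by
      rw [← dist_eq_norm]
      exact (ContinuousMap.dist_apply_le_dist y).trans (Metric.mem_ball.1 hfg).le
    calc ‖f y - P g y‖ = ‖(f y - g y) + (g y - P g y)‖ := by congr 1; ring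
      _ ≤ ε / 6 + ε / 6 := (norm_add_le _ _).trans (add_le_add h1 (hd g y))
      _ = ε / 3 := by ring
  have := norm_vallee_sub_le (n g) f (P g) (hP g) h ((Finset.le_sup hg).trans hk) x
  linarith

/-- Both functions are uniform limits of the same de la Vallée-Poussin means. -/
theorem eq_of_fourierCoeff_eq {f g : C(Torus, ℂ)} (h : ∀ m, fourierCoeff f m = fourierCoeff g m) :
    f = g := by
  have hc : fourierCoeff f = fourierCoeff g := funext h
  ext x
  refine sub_eq_zero.1 (norm_le_zero_iff.1 (le_of_forall_pos_le_add fun ε hε => ?_))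
  obtain ⟨P, n, hP, hd⟩ := exists_reproduced_near f (ε := ε / 6) (by positivity)
  obtain ⟨Q, k, hQ, he⟩ := exists_reproduced_near g (ε := ε / 6) (by positivity)
  have h1 := norm_vallee_sub_le n f P hP hd (le_max_left n k) x
  have h2 := norm_vallee_sub_le k g Q hQ he (le_max_right n k) x
  rw [hc] at h1
  calc ‖f x - g x‖ = ‖(vallee (max n k) (fourierCoeff g) x - g x)
        - (vallee (max n k) (fourierCoeff g) x - f x)‖ := by congr 1; ring
    _ ≤ 3 * (ε / 6) + 3 * (ε / 6) := (norm_sub_le _ _).trans (add_le_add h2 h1)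
    _ = 0 + ε := by ring

theorem hasDerivAt_vallee (n : ℕ) (c : ℤ → ℂ) (x : ℝ) :
    HasDerivAt (fun y : ℝ => vallee n c (y : Torus)) (vallee n (derivCoeff c) (x : Torus)) x := by
  unfold vallee
  refine HasDerivAt.fun_sum fun k _ => HasDerivAt.fun_sum fun l _ => ?_
  have h := (((hasDerivAt_fourier (1 : ℝ) (k + l) x).const_mul (c (k + l))).const_mul
    ((2 * n + 1 : ℂ)⁻¹))
  refine h.congr_deriv ?_
  simp only [derivCoeff]
  push_cast
  ring

/-- Bernstein's inequality for de la Vallée-Poussin means. -/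
theorem norm_vallee_derivCoeff_le (n : ℕ) (hn : 1 ≤ n) (f : C(Torus, ℂ)) {M : ℝ}
    (hM : ∀ x, ‖f x‖ ≤ M) (x : Torus) :
    ‖vallee n (derivCoeff (fourierCoeff f)) x‖ ≤ 12 * Real.pi * n * M := by
  have hM0 : 0 ≤ M := (norm_nonneg _).trans (hM x)
  have hn1 : (1 : ℝ) ≤ n := by exact_mod_cast hn
  have h1 := card_Icc_neg n
  have h2 : (Finset.Icc (-(2 * n : ℤ)) (2 * n)).card = 4 * n + 1 := by
    rw [Int.card_Icc]; omega
  have h3 : ‖(2 * n + 1 : ℂ)‖ = 2 * n + 1 := by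
    have : (2 * n + 1 : ℂ) = ((2 * n + 1 : ℝ) : ℂ) := by push_cast; ring
    rw [this, Complex.norm_real, Real.norm_of_nonneg (by positivity)]
  -- The frequency `k + l` produced by the derivative is split between the two factors of the
  -- kernel. With the values of `θ` below, the halves cost `3n/2` and `9n/2`, and `2π · 6n = 12πn`.
  have e : vallee n (derivCoeff (fourierCoeff f)) x = (2 * Real.pi * Complex.I) *
      ((∑ k ∈ Finset.Icc (-(n : ℤ)) n, ∑ l ∈ Finset.Icc (-(2 * n : ℤ)) (2 * n),
        ((2 * n + 1 : ℂ)⁻¹ * k) * (fourierCoeff f (k + l) * fourier (k + l) x)) +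
      ∑ k ∈ Finset.Icc (-(n : ℤ)) n, ∑ l ∈ Finset.Icc (-(2 * n : ℤ)) (2 * n),
        (2 * n + 1 : ℂ)⁻¹ * l * (fourierCoeff f (k + l) * fourier (k + l) x)) := by
    simp only [vallee, derivCoeff, ← Finset.sum_add_distrib, Finset.mul_sum]
    refine Finset.sum_congr rfl fun k _ => Finset.sum_congr rfl fun l _ => ?_
    push_cast; ring
  have b1 := norm_sum_sum_fourier_le (Finset.Icc (-(n : ℤ)) n) (Finset.Icc (-(2 * n : ℤ)) (2 * n))
    (fun k => (2 * n + 1 : ℂ)⁻¹ * k) (fun _ => 1) f hM (θ := (2 * n + 1) / n) (by positivity) x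
  have b2 := norm_sum_sum_fourier_le (Finset.Icc (-(n : ℤ)) n) (Finset.Icc (-(2 * n : ℤ)) (2 * n))
    (fun _ => (2 * n + 1 : ℂ)⁻¹) (fun l => l) f hM (θ := (2 * n + 1) * n) (by positivity) x
  have s1 : ∑ k ∈ Finset.Icc (-(n : ℤ)) n, ‖(2 * n + 1 : ℂ)⁻¹ * k‖ ^ 2 ≤ n ^ 2 / (2 * n + 1) := by
    calc _ ≤ ∑ k ∈ Finset.Icc (-(n : ℤ)) n, ((2 * n + 1 : ℝ)⁻¹ * n) ^ 2 := by
          refine Finset.sum_le_sum fun k hk => ?_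
          rw [norm_mul, norm_inv, h3]
          have : ‖(k : ℂ)‖ ≤ n := by
            rw [Complex.norm_intCast]
            exact_mod_cast abs_le.2 (Finset.mem_Icc.1 hk)
          gcongr
      _ = n ^ 2 / (2 * n + 1) := by
          rw [Finset.sum_const, h1, nsmul_eq_mul]; push_cast; field_simp
  have s2 : ∑ k ∈ Finset.Icc (-(2 * n : ℤ)) (2 * n), ‖(k : ℂ)‖ ^ 2 ≤ (4 * n + 1) * (2 * n) ^ 2 := by
    calc _ ≤ ∑ k ∈ Finset.Icc (-(2 * n : ℤ)) (2 * n), (2 * n : ℝ) ^ 2 := by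
          refine Finset.sum_le_sum fun k hk => ?_
          have : ‖(k : ℂ)‖ ≤ 2 * n := by
            rw [Complex.norm_intCast]
            exact_mod_cast abs_le.2 (Finset.mem_Icc.1 hk)
          gcongr
      _ = (4 * n + 1) * (2 * n) ^ 2 := by
          rw [Finset.sum_const, h2, nsmul_eq_mul]; push_cast; ring
  simp only [Finset.sum_const, h1, h2, norm_inv, h3, norm_one, nsmul_eq_mul, mul_one] at b1 b2
  rw [e, norm_mul]
  have h4 : ‖(2 * Real.pi * Complex.I : ℂ)‖ = 2 * Real.pi := by
    simp [abs_of_pos Real.pi_pos]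
  rw [h4]
  have h5 : (0 : ℝ) < 2 * n + 1 := by positivity
  have t1 : M * (((2 * n + 1) / n * ∑ k ∈ Finset.Icc (-(n : ℤ)) n, ‖(2 * n + 1 : ℂ)⁻¹ * k‖ ^ 2 +
      ((2 * n + 1) / n : ℝ)⁻¹ * ((4 * n + 1 : ℕ) * 1 ^ 2)) / 2) ≤ M * (3 * n / 2) := by
    refine mul_le_mul_of_nonneg_left ?_ hM0
    have : (2 * n + 1) / n * ∑ k ∈ Finset.Icc (-(n : ℤ)) n, ‖(2 * n + 1 : ℂ)⁻¹ * k‖ ^ 2 ≤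
        (2 * n + 1) / n * (n ^ 2 / (2 * n + 1) : ℝ) := by gcongr
    have e1 : (2 * n + 1) / n * (n ^ 2 / (2 * n + 1) : ℝ) = n := by field_simp
    have e2 : ((2 * n + 1) / n : ℝ)⁻¹ * ((4 * n + 1 : ℕ) * 1 ^ 2) ≤ 2 * n := by
      push_cast; rw [inv_div, one_pow, mul_one, div_mul_eq_mul_div, div_le_iff₀ h5]; nlinarith
    linarith
  have t2 : M * (((2 * n + 1) * n * ((2 * n + 1 : ℕ) * (2 * n + 1 : ℝ)⁻¹ ^ 2) +
      ((2 * n + 1) * n : ℝ)⁻¹ * ∑ k ∈ Finset.Icc (-(2 * n : ℤ)) (2 * n), ‖(k : ℂ)‖ ^ 2) / 2)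
      ≤ M * (9 * n / 2) := by
    refine mul_le_mul_of_nonneg_left ?_ hM0
    have e1 : (2 * n + 1) * n * ((2 * n + 1 : ℕ) * (2 * n + 1 : ℝ)⁻¹ ^ 2) = n := by
      push_cast; field_simp
    have : ((2 * n + 1) * n : ℝ)⁻¹ * ∑ k ∈ Finset.Icc (-(2 * n : ℤ)) (2 * n), ‖(k : ℂ)‖ ^ 2
        ≤ ((2 * n + 1) * n : ℝ)⁻¹ * ((4 * n + 1) * (2 * n) ^ 2) := by gcongr
    have e2 : ((2 * n + 1) * n : ℝ)⁻¹ * ((4 * n + 1) * (2 * n) ^ 2) ≤ 8 * n := by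
      rw [inv_mul_le_iff₀ (by positivity)]; nlinarith
    linarith
  calc _ ≤ 2 * Real.pi * (M * (3 * n / 2) + M * (9 * n / 2)) := by
        refine mul_le_mul_of_nonneg_left ((norm_add_le _ _).trans (add_le_add (b1.trans t1) ?_))
          (by positivity)
        exact b2.trans t2
    _ = 12 * Real.pi * n * M := by ring

/-! ### Littlewood-Paley decomposition of Hölder functions -/

theorem norm_fourierCoeff_le (f : C(Torus, ℂ)) {M : ℝ} (hM : ∀ x, ‖f x‖ ≤ M) (m : ℤ) :
    ‖fourierCoeff f m‖ ≤ M := by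
  refine (norm_integral_le_of_norm_le_const (C := M) (ae_of_all _ fun x => ?_)).trans ?_
  · rw [norm_smul, norm_fourier_apply, one_mul]; exact hM x
  · simp

/-- The `m`-th Fourier coefficient as a continuous linear functional. -/
def fourierCoeffCLM (m : ℤ) : C(Torus, ℂ) →L[ℂ] ℂ :=
  LinearMap.mkContinuous
    { toFun := fun f => fourierCoeff f m
      map_add' := fun f g => fourierCoeff_add_apply f g m
      map_smul' := fun b f => fourierCoeff_smul_apply b f m } 1
    fun f => by rw [one_mul]; exact norm_fourierCoeff_le f f.norm_coe_le_norm m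

theorem fourierCoeffCLM_apply (m : ℤ) (f : C(Torus, ℂ)) :
    fourierCoeffCLM m f = fourierCoeff f m := rfl

/-- The complex-valued continuous function underlying a real one. -/
def toComplex (f : C(Torus, ℝ)) : C(Torus, ℂ) := ⟨fun x => (f x : ℂ), by fun_prop⟩

theorem toComplex_apply (f : C(Torus, ℝ)) (x : Torus) : toComplex f x = (f x : ℂ) := rfl

theorem funCoeff_eq (f : C(Torus, ℝ)) : funCoeff f = fourierCoeff (toComplex f) := rfl

/-- A Littlewood-Paley block as a continuous function. -/
def lpBlockMap (j : ℕ) (c : ℤ → ℂ) : C(Torus, ℂ) :=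
  ∑ m ∈ Finset.Icc (-(2 ^ (j + 1) : ℤ)) (2 ^ (j + 1)), ((lpSymbol j m : ℂ) * c m) • fourier m

theorem lpBlockMap_apply (j : ℕ) (c : ℤ → ℂ) (x : Torus) : lpBlockMap j c x = lpBlock j c x := by
  simp [lpBlockMap, lpBlock, ContinuousMap.sum_apply]

theorem fourierCoeff_lpBlockMap (j : ℕ) (c : ℤ → ℂ) (m : ℤ) :
    fourierCoeff (lpBlockMap j c) m = lpSymbol j m * c m := by
  rw [← fourierCoeffCLM_apply, lpBlockMap, map_sum]
  simp only [map_smul, fourierCoeffCLM_apply, fourierCoeff_fourier, smul_eq_mul]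
  by_cases hm : m ∈ Finset.Icc (-(2 ^ (j + 1) : ℤ)) (2 ^ (j + 1))
  · rw [Finset.sum_eq_single_of_mem m hm fun k _ hk => by
      rw [Pi.single_eq_of_ne (Ne.symm hk), mul_zero]]
    simp
  · rw [Finset.sum_eq_zero fun k hk => by
      rw [Pi.single_eq_of_ne (by rintro rfl; exact hm hk), mul_zero]]
    rw [Finset.mem_Icc, ← abs_le, not_le] at hm
    rw [lpSymbol_eq_zero j (by exact_mod_cast hm.le)]
    simp

theorem reproduced_lpBlockMap (j : ℕ) (c : ℤ → ℂ) : Reproduced (2 ^ (j + 1)) (lpBlockMap j c) :=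
  Reproduced.sum _ _ fun m hm => (Reproduced.fourier (by
    rw [Finset.mem_Icc, ← abs_le] at hm; exact_mod_cast hm)).smul _

theorem hasSum_lpSymbol (m : ℤ) : HasSum (fun j => (lpSymbol j m : ℝ)) 1 := by
  obtain ⟨n, hn⟩ := pow_unbounded_of_one_lt |(m : ℝ)| (one_lt_two)
  have h0 : ∀ j ∉ Finset.range (n + 1), lpSymbol j m = 0 := by
    intro j hj
    rw [Finset.mem_range, not_lt] at hj
    obtain ⟨k, rfl⟩ : ∃ k, j = k + 1 := ⟨j - 1, by omega⟩
    have h1 : ∀ i, n ≤ i → lpCutoff ((m : ℝ) / 2 ^ i) = 1 := fun i hi => lpCutoff_eq_one (by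
      rw [abs_div, abs_of_pos (by positivity : (0 : ℝ) < 2 ^ i), div_le_one (by positivity)]
      exact hn.le.trans (pow_le_pow_right₀ one_le_two hi))
    rw [lpSymbol, h1 _ (by omega), h1 _ (by omega), sub_self]
  have h : HasSum _ _ := hasSum_sum_of_ne_finset_zero h0
  rwa [sum_lpSymbol, lpCutoff_eq_one] at h
  rw [abs_div, abs_of_pos (by positivity : (0 : ℝ) < 2 ^ n), div_le_one (by positivity)]
  exact hn.le

theorem norm_lpBlock_le {a B : ℝ} (hB : 0 ≤ B) {c : ℤ → ℂ} (h : besovNorm a c ≤ ENNReal.ofReal B)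
    (j : ℕ) (x : Torus) : ‖lpBlock j c x‖ ≤ 2 ^ a * B * ((2 : ℝ) ^ (-a)) ^ j := by
  have h1 : ENNReal.ofReal ((2 : ℝ) ^ (a * ((j : ℝ) - 1))) * ‖lpBlock j c x‖ₑ
      ≤ ENNReal.ofReal B :=
    le_trans (by gcongr; exact le_iSup (fun x => ‖lpBlock j c x‖ₑ) x)
      ((le_iSup (fun j : ℕ => ENNReal.ofReal ((2 : ℝ) ^ (a * ((j : ℝ) - 1))) *
        ⨆ x : Torus, ‖lpBlock j c x‖ₑ) j).trans h)
  rw [← ofReal_norm, ← ENNReal.ofReal_mul (by positivity),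
    ENNReal.ofReal_le_ofReal_iff hB] at h1
  have h2 : (2 : ℝ) ^ (a * ((j : ℝ) - 1)) * (2 ^ a * ((2 : ℝ) ^ (-a)) ^ j) = 1 := by
    rw [← Real.rpow_natCast, ← Real.rpow_mul two_pos.le, ← Real.rpow_add two_pos,
      ← Real.rpow_add two_pos]
    ring_nf
    exact Real.rpow_zero 2
  have h3 : (0 : ℝ) < 2 ^ a * ((2 : ℝ) ^ (-a)) ^ j := by positivity
  calc ‖lpBlock j c x‖ = ((2 : ℝ) ^ (a * ((j : ℝ) - 1)) * (2 ^ a * ((2 : ℝ) ^ (-a)) ^ j)) *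
        ‖lpBlock j c x‖ := by rw [h2, one_mul]
    _ = (2 ^ a * ((2 : ℝ) ^ (-a)) ^ j) * ((2 : ℝ) ^ (a * ((j : ℝ) - 1)) * ‖lpBlock j c x‖) := by
        ring
    _ ≤ (2 ^ a * ((2 : ℝ) ^ (-a)) ^ j) * B := by gcongr
    _ = _ := by ring

/-- For `a > 0` the blocks decay geometrically, so the series converges uniformly. Its sum is
identified with `f` through Fourier coefficients, where the symbols telescope to `1`. -/
theorem hasSum_lpBlockMap {a B : ℝ} (ha : 0 < a) (hB : 0 ≤ B) (f : C(Torus, ℂ))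
    (h : besovNorm a (fourierCoeff f) ≤ ENNReal.ofReal B) :
    HasSum (fun j => lpBlockMap j (fourierCoeff f)) f := by
  have hq : (2 : ℝ) ^ (-a) < 1 := Real.rpow_lt_one_of_one_lt_of_neg one_lt_two (by linarith)
  have hs : Summable (fun j => lpBlockMap j (fourierCoeff f)) := by
    refine Summable.of_norm_bounded
      (g := fun j : ℕ => 2 ^ a * B * ((2 : ℝ) ^ (-a)) ^ j)
      ((summable_geometric_of_lt_one (by positivity) hq).mul_left _) fun j => ?_
    rw [ContinuousMap.norm_le _ (by positivity)]
    intro x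
    rw [lpBlockMap_apply]
    exact norm_lpBlock_le hB h j x
  have he : ∑' j, lpBlockMap j (fourierCoeff f) = f := by
    refine eq_of_fourierCoeff_eq fun m => ?_
    have h1 := hs.hasSum.mapL (fourierCoeffCLM m)
    simp only [fourierCoeffCLM_apply, fourierCoeff_lpBlockMap] at h1
    have h2 : HasSum (fun j => (lpSymbol j m : ℂ) * fourierCoeff f m) (1 * fourierCoeff f m) := by
      refine HasSum.mul_right _ ?_
      have h3 := Complex.hasSum_ofReal.2 (hasSum_lpSymbol m)
      rwa [Complex.ofReal_one] at h3
    rw [one_mul] at h2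
    exact h1.unique h2
  rw [← he]
  convert hs.hasSum

/-- The function `g` is the sum of the first `J` blocks. The tail is geometric with ratio `2 ^ (-a)
< 1`. By Bernstein the derivatives of the blocks are bounded by a geometric sequence of ratio `2 ^
(1 - a) > 1`, whose sum is comparable to its last term; this is where `a < 1` enters. -/
theorem exists_lp_decomposition {a : ℝ} (ha : 0 < a) (ha1 : a < 1) :
    ∃ K : ℝ, 0 < K ∧ ∀ (f : C(Torus, ℝ)) (z : ℝ), 0 ≤ z →
      besovNorm a (funCoeff f) ≤ ENNReal.ofReal z →
      (∀ x, |f x| ≤ K * z) ∧ ∀ J : ℕ, ∃ g g' : ℝ → ℝ, (∀ x, HasDerivAt g (g' x) x) ∧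
        Continuous g' ∧ Function.Periodic g 1 ∧ (∀ x : ℝ, |g x| ≤ K * z) ∧
        (∀ x : ℝ, |f (x : Torus) - g x| ≤ K * ((2 : ℝ) ^ (-a)) ^ J * z) ∧
        (∀ x : ℝ, |g' x| ≤ K * ((2 : ℝ) ^ (1 - a)) ^ J * z) := by
  set q : ℝ := (2 : ℝ) ^ (-a) with hqd
  have hq : q < 1 := Real.rpow_lt_one_of_one_lt_of_neg one_lt_two (by linarith)
  have hq0 : 0 < q := by positivity
  have hr : (2 : ℝ) ^ (1 - a) = 2 * q := by
    rw [hqd, sub_eq_add_neg, Real.rpow_add two_pos, Real.rpow_one]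
  have hr1 : 1 < 2 * q := by rw [← hr]; exact Real.one_lt_rpow one_lt_two (by linarith)
  set K₀ : ℝ := 2 ^ a / (1 - q) with hK₀
  set K₁ : ℝ := 24 * Real.pi * 2 ^ a / (2 * q - 1) with hK₁
  have hK₀p : 0 < K₀ := div_pos (by positivity) (by linarith)
  have hK₁p : 0 < K₁ := div_pos (by positivity) (by linarith)
  refine ⟨2 * K₀ + K₁, by positivity, fun f z hz hf => ?_⟩
  rw [funCoeff_eq] at hf
  set F := toComplex f with hF
  have hb := norm_lpBlock_le hz hf
  have hsum := hasSum_lpBlockMap ha hz F hf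
  have tail : ∀ (J : ℕ) (x : Torus),
      ‖F x - ∑ j ∈ Finset.range J, lpBlock j (fourierCoeff F) x‖ ≤ K₀ * q ^ J * z := by
    intro J x
    have h1 : HasSum (fun j => lpBlock j (fourierCoeff F) x) (F x) := by
      have := hsum.mapL (ContinuousMap.evalCLM ℂ x)
      simpa only [ContinuousMap.evalCLM_apply, lpBlockMap_apply] using this
    have h2 := (hasSum_nat_add_iff' J).2 h1
    have h3 : HasSum (fun j : ℕ => 2 ^ a * z * q ^ J * q ^ j) (2 ^ a * z * q ^ J * (1 - q)⁻¹) :=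
      (hasSum_geometric_of_lt_one hq0.le hq).mul_left _
    have h4 := h2.norm_le_of_bounded h3 fun j => (hb (j + J) x).trans_eq (by rw [pow_add]; ring)
    refine h4.trans_eq ?_
    rw [hK₀]; ring
  have bound : ∀ x, |f x| ≤ K₀ * z := by
    intro x
    have := tail 0 x
    simpa [hF, toComplex_apply] using this
  refine ⟨fun x => (bound x).trans (by gcongr; linarith), fun J => ?_⟩
  refine ⟨fun x => (∑ j ∈ Finset.range J, lpBlock j (fourierCoeff F) (x : Torus)).re,
    fun x => (∑ j ∈ Finset.range J,
      vallee (2 ^ (j + 1)) (derivCoeff (fourierCoeff (lpBlockMap j (fourierCoeff F))))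
        (x : Torus)).re, ?_, ?_, ?_, ?_, ?_, ?_⟩
  · intro x
    have h : HasDerivAt (fun y : ℝ => ∑ j ∈ Finset.range J, lpBlock j (fourierCoeff F) (y : Torus))
        (∑ j ∈ Finset.range J, vallee (2 ^ (j + 1))
          (derivCoeff (fourierCoeff (lpBlockMap j (fourierCoeff F)))) (x : Torus)) x := by
      refine HasDerivAt.fun_sum fun j _ => ?_
      -- A block coincides with its own mean of order `2 ^ (j + 1)`, so its derivative is again a de
      -- la Vallée-Poussin mean, to which Bernstein's inequality applies.
      have h := hasDerivAt_vallee (2 ^ (j + 1)) (fourierCoeff (lpBlockMap j (fourierCoeff F))) x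
      simpa only [reproduced_lpBlockMap j (fourierCoeff F) _ le_rfl, lpBlockMap_apply] using h
    exact Complex.reCLM.hasFDerivAt.comp_hasDerivAt x h
  · refine Complex.continuous_re.comp (continuous_finsetSum _ fun j _ => ?_)
    exact (continuous_vallee _ _).comp (AddCircle.continuous_mk' 1)
  · intro x
    simp only [AddCircle.coe_add_period]
  · intro x
    have h := tail J (x : Torus)
    have h2 : |f (x : Torus) - (∑ j ∈ Finset.range J, lpBlock j (fourierCoeff F) (x : Torus)).re|
        ≤ K₀ * q ^ J * z := by
      refine le_trans ?_ h
      have := Complex.abs_re_le_norm (F x - ∑ j ∈ Finset.range J, lpBlock j (fourierCoeff F) x)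
      simpa [hF, toComplex_apply] using this
    have h3 : K₀ * q ^ J * z ≤ K₀ * z := by
      rw [mul_assoc]
      refine mul_le_mul_of_nonneg_left ?_ hK₀p.le
      exact mul_le_of_le_one_left hz (pow_le_one₀ hq0.le hq.le)
    have h4 := bound (x : Torus)
    have h5 : 0 ≤ K₁ * z := by positivity
    rw [abs_le] at *
    constructor <;> nlinarith
  · intro x
    have h := tail J (x : Torus)
    refine le_trans ?_ (h.trans ?_)
    · have := Complex.abs_re_le_norm (F x - ∑ j ∈ Finset.range J, lpBlock j (fourierCoeff F) x)
      simpa [hF, toComplex_apply] using this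
    · gcongr; linarith
  · intro x
    rw [hr]
    refine (Complex.abs_re_le_norm _).trans ((norm_sum_le _ _).trans ?_)
    calc _ ≤ ∑ j ∈ Finset.range J, 24 * Real.pi * 2 ^ a * z * (2 * q) ^ j := by
          refine Finset.sum_le_sum fun j _ => ?_
          have h := norm_vallee_derivCoeff_le (2 ^ (j + 1)) Nat.one_le_two_pow
            (lpBlockMap j (fourierCoeff F)) (M := 2 ^ a * z * q ^ j)
            (fun x => by rw [lpBlockMap_apply]; exact hb j x) (x : Torus)
          refine h.trans_eq ?_
          push_cast
          rw [mul_pow]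
          ring
      _ = 24 * Real.pi * 2 ^ a * z * (((2 * q) ^ J - 1) / (2 * q - 1)) := by
          rw [← Finset.mul_sum, geom_sum_eq hr1.ne']
      _ ≤ 24 * Real.pi * 2 ^ a * z * ((2 * q) ^ J / (2 * q - 1)) := by
          gcongr; linarith
      _ = K₁ * (2 * q) ^ J * z := by rw [hK₁]; ring
      _ ≤ _ := by gcongr; linarith

/-! ### Potentials and paths of continuous functions -/

theorem torusDeriv_coe (f : Torus → ℝ) (x : ℝ) :
    torusDeriv f (x : Torus) = deriv (fun y : ℝ => f (y : Torus)) x := by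
  unfold torusDeriv
  have h := deriv_comp_const_add (fun y : ℝ => f (y : Torus)) x 0
  rw [add_zero] at h
  simpa only [AddCircle.coe_add] using h

theorem integral_torus_eq (f : Torus → ℝ) : ∫ x, f x = ∫ x in (0 : ℝ)..1, f (x : Torus) := by
  have h := UnitAddCircle.intervalIntegral_preimage 0 f
  rw [zero_add] at h
  exact h.symm

theorem continuous_of_lift {f : Torus → ℝ} (h : Continuous fun x : ℝ => f (x : Torus)) :
    Continuous f :=
  (QuotientAddGroup.isOpenQuotientMap_mk.isQuotientMap.continuous_iff).2 h

theorem IsPotential.hasDerivAt {f ρ : C(Torus, ℝ)} (h : IsPotential f ρ) (x : ℝ) :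
    HasDerivAt (fun y : ℝ => ρ (y : Torus)) (torusDeriv ρ (x : Torus)) x := by
  rw [torusDeriv_coe]
  exact (h.contDiff.differentiable (by norm_num) x).hasDerivAt

theorem IsPotential.hasDerivAt_torusDeriv {f ρ : C(Torus, ℝ)} (h : IsPotential f ρ) (x : ℝ) :
    HasDerivAt (fun y : ℝ => torusDeriv ρ (y : Torus)) (-(f (x : Torus) - ∫ y, f y)) x := by
  rw [← h.poisson, neg_neg, torusDeriv_coe]
  have h1 : (fun y : ℝ => torusDeriv ρ (y : Torus)) = deriv (fun y : ℝ => ρ (y : Torus)) :=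
    funext fun y => torusDeriv_coe _ y
  rw [h1]
  have h2 : ContDiff ℝ 1 (deriv fun y : ℝ => ρ (y : Torus)) := by
    have := h.contDiff
    rw [show (2 : WithTop ℕ∞) = 1 + 1 by norm_num, contDiff_succ_iff_deriv] at this
    exact this.2.2
  exact (h2.differentiable (by norm_num) x).hasDerivAt

theorem IsPotential.continuous_torusDeriv {f ρ : C(Torus, ℝ)} (h : IsPotential f ρ) :
    Continuous (torusDeriv ρ) :=
  continuous_of_lift (continuous_iff_continuousAt.2 fun x => (h.hasDerivAt_torusDeriv x).continuousAt)

/-- By Rolle, `R = P'` vanishes somewhere in the period before `x`; integrating `R' = g` from that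
point covers at most one period. -/
theorem abs_deriv_le_integral {P R g : ℝ → ℝ} (hP : ∀ x, HasDerivAt P (R x) x)
    (hR : ∀ x, HasDerivAt R (g x) x) (hg : Continuous g) (hPp : Function.Periodic P 1)
    (hgp : Function.Periodic g 1) (x : ℝ) : |R x| ≤ ∫ y in (0 : ℝ)..1, |g y| := by
  obtain ⟨c, hc, hc0⟩ := exists_hasDerivAt_eq_zero (f := P) (f' := R) (a := x - 1) (b := x)
    (by linarith) (fun y _ => (hP y).continuousAt.continuousWithinAt)
    (by have := hPp (x - 1); rw [sub_add_cancel] at this; exact this.symm) (fun y _ => hP y)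
  have h1 : ∫ y in c..x, g y = R x := by
    rw [intervalIntegral.integral_eq_sub_of_hasDerivAt (fun y _ => hR y)
      (hg.intervalIntegrable _ _), hc0, sub_zero]
  have h2 : ∫ y in (x - 1)..x, |g y| = ∫ y in (0 : ℝ)..1, |g y| := by
    have h3 : Function.Periodic (fun y => |g y|) 1 := fun y => by simp only [hgp y]
    have := h3.intervalIntegral_add_eq (x - 1) 0
    rwa [sub_add_cancel, zero_add] at this
  rw [← h1, ← h2]
  refine (intervalIntegral.abs_integral_le_integral_abs hc.2.le).trans ?_
  refine intervalIntegral.integral_mono_interval hc.1.le hc.2.le le_rfl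
    (ae_of_all _ fun y => abs_nonneg _) (hg.abs.intervalIntegrable _ _)

theorem IsPotential.abs_torusDeriv_le {f ρ : C(Torus, ℝ)} (h : IsPotential f ρ) (x : Torus) :
    |torusDeriv ρ x| ≤ ∫ y in (0 : ℝ)..1, |f (y : Torus) - ∫ z, f z| := by
  induction x using QuotientAddGroup.induction_on with | _ x =>
  have := abs_deriv_le_integral h.hasDerivAt h.hasDerivAt_torusDeriv
    (by have := f.continuous; have h2 := AddCircle.continuous_mk' (1 : ℝ); fun_prop)
    (fun y => by simp only [AddCircle.coe_add_period])
    (fun y => by simp only [AddCircle.coe_add_period]) x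
  simpa only [abs_neg] using this

theorem abs_integral_torus_le {f : Torus → ℝ} {M : ℝ} (h : ∀ x, |f x| ≤ M) : |∫ x, f x| ≤ M := by
  have := norm_integral_le_of_norm_le_const (μ := (volume : Measure Torus)) (f := f) (C := M)
    (ae_of_all _ h)
  rwa [Measure.real, UnitAddCircle.measure_univ, ENNReal.toReal_one, mul_one] at this

theorem IsPotential.abs_torusDeriv_le_of_bound {f ρ : C(Torus, ℝ)} (h : IsPotential f ρ) {M : ℝ}
    (hM : ∀ x, |f x| ≤ M) (x : Torus) : |torusDeriv ρ x| ≤ 2 * M := by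
  refine (h.abs_torusDeriv_le x).trans ?_
  rw [← integral_torus_eq (fun y => |f y - ∫ z, f z|)]
  refine (le_abs_self _).trans (abs_integral_torus_le fun y => ?_)
  rw [abs_abs]
  refine (abs_sub _ _).trans ?_
  have := abs_integral_torus_le hM
  have := hM y
  linarith

theorem IsPotential.sub {f g ρ σ : C(Torus, ℝ)} (h : IsPotential f ρ) (h' : IsPotential g σ) :
    IsPotential (f - g) (ρ - σ) ∧ torusDeriv (ρ - σ : C(Torus, ℝ)) = torusDeriv ρ - torusDeriv σ := by
  have e : torusDeriv (ρ - σ : C(Torus, ℝ)) = torusDeriv ρ - torusDeriv σ := by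
    ext x
    induction x using QuotientAddGroup.induction_on with | _ x =>
    rw [Pi.sub_apply]
    erw [torusDeriv_coe]
    exact ((h.hasDerivAt x).sub (h'.hasDerivAt x)).deriv
  refine ⟨⟨?_, fun x => ?_, ?_⟩, e⟩
  · exact h.contDiff.sub h'.contDiff
  · rw [e]
    induction x using QuotientAddGroup.induction_on with | _ x =>
    have h1 : torusDeriv (torusDeriv ρ - torusDeriv σ) (x : Torus) =
        -(f (x : Torus) - ∫ y, f y) - -(g (x : Torus) - ∫ y, g y) := by
      rw [torusDeriv_coe]
      exact ((h.hasDerivAt_torusDeriv x).sub (h'.hasDerivAt_torusDeriv x)).deriv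
    erw [h1]
    simp only [ContinuousMap.coe_sub, Pi.sub_apply]
    rw [integral_sub]
    · change _ = f (x : Torus) - g (x : Torus) - _
      ring
    · rw [volume_eq_haar]; exact integrable_torus f.continuous
    · rw [volume_eq_haar]; exact integrable_torus g.continuous
  · simp only [ContinuousMap.coe_sub, Pi.sub_apply]
    rw [integral_sub, h.mean_free, h'.mean_free, sub_zero]
    · rw [volume_eq_haar]; exact integrable_torus ρ.continuous
    · rw [volume_eq_haar]; exact integrable_torus σ.continuous

theorem ContPath.continuousOn {I : Set ℝ} {a : ℝ} (ha : 0 < a) (ha1 : a < 1) {f : ℝ → C(Torus, ℝ)}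
    (h : ContPath I a f) : ContinuousOn f I := by
  obtain ⟨K, hK, hK2⟩ := exists_lp_decomposition ha ha1
  intro t ht
  rw [ContinuousWithinAt, Metric.tendsto_nhds]
  intro ε hε
  have h1 := (h t ht).2
  have h2 : (0 : ℝ≥0∞) < ENNReal.ofReal (ε / (2 * K)) := ENNReal.ofReal_pos.2 (by positivity)
  filter_upwards [h1.eventually (gt_mem_nhds h2)] with s hs
  have h3 := (hK2 (f s - f t) (ε / (2 * K)) (by positivity) hs.le).1
  have h4 : dist (f s) (f t) ≤ ε / 2 := by
    rw [ContinuousMap.dist_le (by positivity)]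
    intro x
    rw [Real.dist_eq]
    refine (h3 x).trans_eq ?_
    field_simp
  linarith

/-! ### The energy inequality at a fixed time -/

theorem pow_mul_pow_le_add_pow {b N : ℝ} (hb : 0 ≤ b) (hN : 0 ≤ N) (k l : ℕ) :
    b ^ k * N ^ l ≤ b ^ (k + l) + N ^ (k + l) := by
  rcases le_total b N with h | h
  · have : b ^ k * N ^ l ≤ N ^ k * N ^ l := by gcongr
    rw [← pow_add] at this
    have h2 : 0 ≤ b ^ (k + l) := by positivity
    linarith
  · have : b ^ k * N ^ l ≤ b ^ k * b ^ l := by gcongr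
    rw [← pow_add] at this
    have h2 : 0 ≤ N ^ (k + l) := by positivity
    linarith

/-- Weighted AM-GM. Integrated with `N` equal to an `L^p` norm, it gives the comparisons between
`L^p` norms used in `energy_le`. -/
theorem young_pow {b N : ℝ} (hb : 0 ≤ b) (hN : 0 ≤ N) (p k : ℕ) (hpk : 0 < p + k) :
    ((p : ℝ) + k) * (b ^ p * N ^ k) ≤ p * b ^ (p + k) + k * N ^ (p + k) := by
  have hs : (0 : ℝ) < p + k := by exact_mod_cast hpk
  have h := Real.geom_mean_le_arith_mean2_weighted (w₁ := p / (p + k)) (w₂ := k / (p + k))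
    (p₁ := b ^ (p + k)) (p₂ := N ^ (p + k)) (by positivity) (by positivity) (by positivity)
    (by positivity) (by rw [← add_div, div_self hs.ne'])
  have e : ∀ {x : ℝ} (_ : 0 ≤ x) (j : ℕ), (x ^ (p + k)) ^ ((j : ℝ) / (p + k)) = x ^ j := by
    intro x hx j
    rw [← Real.rpow_natCast, ← Real.rpow_mul hx]
    push_cast
    rw [mul_div_cancel₀ _ hs.ne', Real.rpow_natCast]
  rw [e hb, e hN] at h
  calc ((p : ℝ) + k) * (b ^ p * N ^ k)
      ≤ (p + k) * (p / (p + k) * b ^ (p + k) + k / (p + k) * N ^ (p + k)) := by gcongr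
    _ = p * b ^ (p + k) + k * N ^ (p + k) := by field_simp

set_option maxHeartbeats 800000 in
-- The integrand of the energy identity after all integrations by parts. The first line pairs `v₁ =
-- vₓ` with itself and with what stays undifferentiated: the flux error `ε` and the contributions of
-- `Z - Z₁`. The remaining lines come from moving the derivative off `v²`, `2 v Z₁` and `Z₁²`. All
-- errors are multiples of `δ χ`, with total constant `25 + 3 + 12 + 8 = 48`.
theorem energy_pointwise {q : ℕ} (hq : Even q) {χ N v v₁ ε R r Z Z₁ Z₁' δ : ℝ} (hχ : 0 < χ)
    (hN : 0 < N) (hδ : 0 ≤ δ) (hδ1 : δ ≤ 1)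
    (hε : (q + 1) * ε ^ 2 ≤ δ * χ * N ^ 4) (hR : |R| ≤ 2 * N) (hr : |r - v| ≤ 3 * δ * N)
    (hZ : |Z| ≤ δ * N) (hZ₁ : |Z₁| ≤ δ * N) (hZ₁' : |Z₁'| ≤ δ * N)
    (hZZ₁ : (q + 1) * χ * (Z - Z₁) ^ 2 ≤ δ) :
    -(q + 1) * v ^ q * v₁ * (v₁ + (ε + χ * (2 * v * (Z - Z₁) * R + (Z ^ 2 - Z₁ ^ 2) * R)))
      - χ * ((q + 1) / (q + 3)) * v ^ (q + 3) * r
      + 2 * χ * ((q + 1) / (q + 2)) * v ^ (q + 2) * (Z₁' * R - Z₁ * r)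
      + χ * v ^ (q + 1) * (2 * Z₁ * Z₁' * R - Z₁ ^ 2 * r)
      ≤ -(χ / 3) * |v| ^ (q + 4) + 48 * δ * χ * (|v| ^ (q + 4) + N ^ (q + 4)) := by
  set b := |v| with hb
  set M := b ^ (q + 4) + N ^ (q + 4) with hM
  have hb0 : 0 ≤ b := abs_nonneg v
  have hvb : v ^ q = b ^ q := (hq.pow_abs v).symm
  have m0 : b ^ q * N ^ 4 ≤ M := pow_mul_pow_le_add_pow hb0 hN.le q 4
  have m1 : b ^ (q + 1) * N ^ 3 ≤ M := pow_mul_pow_le_add_pow hb0 hN.le (q + 1) 3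
  have m2 : b ^ (q + 2) * N ^ 2 ≤ M := pow_mul_pow_le_add_pow hb0 hN.le (q + 2) 2
  have m3 : b ^ (q + 3) * N ≤ M := by
    simpa using pow_mul_pow_le_add_pow hb0 hN.le (q + 3) 1
  have hM0 : 0 ≤ M := by positivity
  have hδ2 : δ ^ 2 ≤ δ := by nlinarith
  have hδ3 : δ ^ 3 ≤ δ := by nlinarith
  have hrb : |r| ≤ b + 3 * δ * N := by
    have := abs_add_le v (r - v)
    rw [add_sub_cancel] at this
    linarith
  have q0 : (0 : ℝ) ≤ q := q.cast_nonneg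
  -- dissipation
  have p1 : -(q + 1) * v ^ q * v₁ * (v₁ + (ε + χ * (2 * v * (Z - Z₁) * R + (Z ^ 2 - Z₁ ^ 2) * R)))
      ≤ 25 * δ * χ * M := by
    set s₂ := χ * (2 * v * (Z - Z₁) * R) with hs₂
    set s₃ := χ * ((Z ^ 2 - Z₁ ^ 2) * R) with hs₃
    have hR2 : R ^ 2 ≤ 4 * N ^ 2 := by
      rw [← sq_abs]
      calc |R| ^ 2 ≤ (2 * N) ^ 2 := by gcongr
        _ = 4 * N ^ 2 := by ring
    have a2 : (q + 1) * s₂ ^ 2 ≤ 16 * δ * χ * (b ^ 2 * N ^ 2) := by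
      calc (q + 1) * s₂ ^ 2 = ((q + 1) * χ * (Z - Z₁) ^ 2) * (4 * χ * b ^ 2) * R ^ 2 := by
            rw [hs₂, hb, sq_abs]; ring
        _ ≤ δ * (4 * χ * b ^ 2) * (4 * N ^ 2) := by gcongr
        _ = _ := by ring
    have hsum : (Z + Z₁) ^ 2 ≤ 4 * N ^ 2 := by
      rw [← sq_abs]
      have : |Z + Z₁| ≤ 2 * N := by
        have := abs_add_le Z Z₁
        nlinarith
      calc |Z + Z₁| ^ 2 ≤ (2 * N) ^ 2 := by gcongr
        _ = 4 * N ^ 2 := by ring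
    have a3 : (q + 1) * s₃ ^ 2 ≤ 16 * δ * χ * N ^ 4 := by
      calc (q + 1) * s₃ ^ 2 = ((q + 1) * χ * (Z - Z₁) ^ 2) * χ * (Z + Z₁) ^ 2 * R ^ 2 := by
            rw [hs₃]; ring
        _ ≤ δ * χ * (4 * N ^ 2) * (4 * N ^ 2) := by gcongr
        _ = _ := by ring
    have a4 : (ε + s₂ + s₃) ^ 2 ≤ 3 * (ε ^ 2 + s₂ ^ 2 + s₃ ^ 2) := by
      nlinarith [sq_nonneg (ε - s₂), sq_nonneg (ε - s₃), sq_nonneg (s₂ - s₃)]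
    have a5 : 0 ≤ (q + 1) * b ^ q * (v₁ + (ε + s₂ + s₃) / 2) ^ 2 := by positivity
    have a6 : (q + 1) * (ε + s₂ + s₃) ^ 2
        ≤ 3 * (δ * χ * N ^ 4 + 16 * δ * χ * (b ^ 2 * N ^ 2) + 16 * δ * χ * N ^ 4) := by
      calc (q + 1) * (ε + s₂ + s₃) ^ 2 ≤ (q + 1) * (3 * (ε ^ 2 + s₂ ^ 2 + s₃ ^ 2)) := by gcongr
        _ = 3 * ((q + 1) * ε ^ 2 + (q + 1) * s₂ ^ 2 + (q + 1) * s₃ ^ 2) := by ring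
        _ ≤ _ := by gcongr
    have a7 : b ^ q * ((q + 1) * (ε + s₂ + s₃) ^ 2)
        ≤ b ^ q * (3 * (δ * χ * N ^ 4 + 16 * δ * χ * (b ^ 2 * N ^ 2) + 16 * δ * χ * N ^ 4)) := by
      gcongr
    have a8 : b ^ q * (3 * (δ * χ * N ^ 4 + 16 * δ * χ * (b ^ 2 * N ^ 2) + 16 * δ * χ * N ^ 4))
        = 3 * (δ * χ) * (17 * (b ^ q * N ^ 4) + 16 * (b ^ (q + 2) * N ^ 2)) := by ring
    have a9 : 3 * (δ * χ) * (17 * (b ^ q * N ^ 4) + 16 * (b ^ (q + 2) * N ^ 2))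
        ≤ 3 * (δ * χ) * (17 * M + 16 * M) := by gcongr
    -- Completing the square in `v₁`: the square is dropped, being the viscous dissipation, and a
    -- quarter of the squared perturbation remains. The constant is `3 (17 + 16) / 4 ≤ 25`.
    have e : -(q + 1) * v ^ q * v₁ *
        (v₁ + (ε + χ * (2 * v * (Z - Z₁) * R + (Z ^ 2 - Z₁ ^ 2) * R)))
        = -((q + 1) * b ^ q * (v₁ + (ε + s₂ + s₃) / 2) ^ 2)
          + b ^ q * ((q + 1) * (ε + s₂ + s₃) ^ 2) / 4 := by
      rw [hvb, hs₂, hs₃]; ring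
    rw [e]
    have : 0 ≤ δ * χ * M := by positivity
    linarith
  -- damping
  have p2 : -(χ * ((q + 1) / (q + 3)) * v ^ (q + 3) * r) ≤ -(χ / 3) * b ^ (q + 4)
      + 3 * δ * χ * M := by
    have e : v ^ (q + 3) * r = b ^ (q + 4) + v ^ (q + 3) * (r - v) := by
      rw [pow_add b, ← hvb, hb, show |v| ^ 4 = v ^ 4 from (by decide : Even 4).pow_abs v]; ring
    -- The worst case is `q = 0`, that is `p = 2`.
    have c1 : (1 : ℝ) / 3 ≤ (q + 1) / (q + 3) := by
      rw [div_le_div_iff₀ (by norm_num) (by positivity)]; linarith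
    have c2 : ((q : ℝ) + 1) / (q + 3) ≤ 1 := by
      rw [div_le_one (by positivity)]; linarith
    have a1 : |v ^ (q + 3) * (r - v)| ≤ 3 * δ * M := by
      rw [abs_mul, abs_pow]
      calc b ^ (q + 3) * |r - v| ≤ b ^ (q + 3) * (3 * δ * N) := by gcongr
        _ = 3 * δ * (b ^ (q + 3) * N) := by ring
        _ ≤ _ := by gcongr
    have a2 : -(v ^ (q + 3) * (r - v)) ≤ 3 * δ * M := (neg_le_abs _).trans a1
    calc -(χ * ((q + 1) / (q + 3)) * v ^ (q + 3) * r)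
        = -(χ * ((q + 1) / (q + 3) * b ^ (q + 4)))
          + χ * ((q + 1) / (q + 3)) * -(v ^ (q + 3) * (r - v)) := by
          rw [mul_assoc _ (v ^ (q + 3)), e]; ring
      _ ≤ -(χ * (1 / 3 * b ^ (q + 4))) + χ * ((q + 1) / (q + 3)) * (3 * δ * M) := by
          gcongr
      _ ≤ -(χ * (1 / 3 * b ^ (q + 4))) + χ * 1 * (3 * δ * M) := by
          gcongr
      _ = _ := by ring
  have p3 : 2 * χ * ((q + 1) / (q + 2)) * v ^ (q + 2) * (Z₁' * R - Z₁ * r) ≤ 12 * δ * χ * M := by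
    have c2 : ((q : ℝ) + 1) / (q + 2) ≤ 1 := by
      rw [div_le_one (by positivity)]; linarith
    refine (le_abs_self _).trans ?_
    have a1 : |Z₁' * R - Z₁ * r| ≤ δ * N * (2 * N) + δ * N * (b + 3 * δ * N) := by
      refine (abs_sub _ _).trans ?_
      rw [abs_mul, abs_mul]
      gcongr
    rw [abs_mul, abs_mul, abs_pow, abs_of_nonneg (by positivity)]
    calc 2 * χ * ((q + 1) / (q + 2)) * b ^ (q + 2) * |Z₁' * R - Z₁ * r|
        ≤ 2 * χ * 1 * b ^ (q + 2) * (δ * N * (2 * N) + δ * N * (b + 3 * δ * N)) := by gcongr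
      _ = 2 * χ * ((2 * δ + 3 * δ ^ 2) * (b ^ (q + 2) * N ^ 2) + δ * (b ^ (q + 3) * N)) := by ring
      _ ≤ 2 * χ * ((2 * δ + 3 * δ) * M + δ * M) := by gcongr
      _ = _ := by ring
  have p4 : χ * v ^ (q + 1) * (2 * Z₁ * Z₁' * R - Z₁ ^ 2 * r) ≤ 8 * δ * χ * M := by
    refine (le_abs_self _).trans ?_
    have a1 : |2 * Z₁ * Z₁' * R - Z₁ ^ 2 * r|
        ≤ 2 * (δ * N) * (δ * N) * (2 * N) + (δ * N) ^ 2 * (b + 3 * δ * N) := by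
      refine (abs_sub _ _).trans ?_
      rw [abs_mul, abs_mul, abs_mul, abs_mul, abs_pow, abs_two]
      gcongr
    rw [abs_mul, abs_mul, abs_pow, abs_of_pos hχ]
    calc χ * b ^ (q + 1) * |2 * Z₁ * Z₁' * R - Z₁ ^ 2 * r|
        ≤ χ * b ^ (q + 1) * (2 * (δ * N) * (δ * N) * (2 * N) + (δ * N) ^ 2 * (b + 3 * δ * N)) := by
          gcongr
      _ = χ * ((4 * δ ^ 2 + 3 * δ ^ 3) * (b ^ (q + 1) * N ^ 3) + δ ^ 2 * (b ^ (q + 2) * N ^ 2)) := by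
          ring
      _ ≤ χ * ((4 * δ + 3 * δ) * M + δ * M) := by gcongr
      _ = _ := by ring
  calc _ ≤ 25 * δ * χ * M + (-(χ / 3) * b ^ (q + 4) + 3 * δ * χ * M) + 12 * δ * χ * M
        + 8 * δ * χ * M := by linarith
    _ = _ := by ring

theorem integral_deriv_periodic {f f' : ℝ → ℝ} (h : ∀ x, HasDerivAt f (f' x) x)
    (hc : Continuous f') (hp : Function.Periodic f 1) : ∫ x in (0 : ℝ)..1, f' x = 0 := by
  rw [intervalIntegral.integral_eq_sub_of_hasDerivAt (fun y _ => h y) (hc.intervalIntegrable _ _)]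
  have := hp 0
  rw [zero_add] at this
  rw [this, sub_self]

/-- Here `N` is the `L^(q + 2)` norm of `v`. Subtracting the derivative of a periodic function from
the integrand performs all the integrations by parts at once and leaves the expression of
`energy_pointwise`. -/
theorem energy_le {q : ℕ} (hq : Even q) {χ N δ : ℝ} (hχ : 0 < χ) (hN : 0 < N) (hδ : 0 ≤ δ)
    (hδ1 : δ ≤ 1 / 500) {v v₁ v₂ G G₁ P R r Z Z₁ Z₁' : ℝ → ℝ}
    (hv : ∀ x, HasDerivAt v (v₁ x) x) (hv₁ : ∀ x, HasDerivAt v₁ (v₂ x) x) (hv₂ : Continuous v₂)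
    (hG : ∀ x, HasDerivAt G (G₁ x) x) (hG₁ : Continuous G₁)
    (hP : ∀ x, HasDerivAt P (R x) x) (hR : ∀ x, HasDerivAt R (-r x) x) (hr : Continuous r)
    (hZ₁ : ∀ x, HasDerivAt Z₁ (Z₁' x) x) (hZ₁c : Continuous Z₁')
    (pv : Function.Periodic v 1) (pv₁ : Function.Periodic v₁ 1) (pG : Function.Periodic G 1)
    (pP : Function.Periodic P 1) (pr : Function.Periodic r 1) (pR : Function.Periodic R 1)
    (pZ₁ : Function.Periodic Z₁ 1)
    (hNv : N ^ (q + 2) = ∫ x in (0 : ℝ)..1, v x ^ (q + 2))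
    (bG : ∀ x, (q + 1) * (G x - χ * ((v x + Z x) ^ 2 * R x)) ^ 2 ≤ δ * χ * N ^ 4)
    (br : ∀ x, |r x - v x| ≤ 3 * δ * N) (bZ : ∀ x, |Z x| ≤ δ * N) (bZ₁ : ∀ x, |Z₁ x| ≤ δ * N)
    (bZ₁' : ∀ x, |Z₁' x| ≤ δ * N) (bZZ₁ : ∀ x, (q + 1) * χ * (Z x - Z₁ x) ^ 2 ≤ δ) :
    ∫ x in (0 : ℝ)..1, v x ^ (q + 1) * (v₂ x + G₁ x) ≤ -(χ / 8) * N ^ (q + 4) := by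
  have cv : Continuous v := continuous_iff_continuousAt.2 fun x => (hv x).continuousAt
  have cv₁ : Continuous v₁ := continuous_iff_continuousAt.2 fun x => (hv₁ x).continuousAt
  have cG : Continuous G := continuous_iff_continuousAt.2 fun x => (hG x).continuousAt
  have cR : Continuous R := continuous_iff_continuousAt.2 fun x => (hR x).continuousAt
  have cZ₁ : Continuous Z₁ := continuous_iff_continuousAt.2 fun x => (hZ₁ x).continuousAt
  have q0 : (0 : ℝ) ≤ q := q.cast_nonneg
  have hvb : ∀ x, v x ^ (q + 2) = |v x| ^ (q + 2) := fun x =>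
    ((hq.add (by decide : Even 2)).pow_abs (v x)).symm
  have ii : ∀ {f : ℝ → ℝ}, Continuous f → IntervalIntegrable f volume 0 1 :=
    fun h => h.intervalIntegrable _ _
  -- Jensen
  have j1 : ∫ x in (0 : ℝ)..1, |v x| ≤ N := by
    have h1 : ∫ x in (0 : ℝ)..1, ((q + 2 : ℝ) * N ^ (q + 1)) * |v x|
        ≤ ∫ x in (0 : ℝ)..1, (|v x| ^ (q + 2) + (q + 1) * N ^ (q + 2)) := by
      refine intervalIntegral.integral_mono zero_le_one (ii (by fun_prop)) (ii (by fun_prop))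
        fun x => ?_
      have := young_pow (abs_nonneg (v x)) hN.le 1 (q + 1) (by omega)
      rw [show 1 + (q + 1) = q + 2 by ring] at this
      push_cast at this
      simp only [pow_one, one_mul] at this
      linarith
    rw [intervalIntegral.integral_const_mul, intervalIntegral.integral_add (ii (by fun_prop))
      (ii (by fun_prop)), ← intervalIntegral.integral_congr fun x _ => hvb x, ← hNv,
      intervalIntegral.integral_const, sub_zero, one_smul] at h1
    have h2 : 0 < (q + 2 : ℝ) * N ^ (q + 1) := by positivity
    refine le_of_mul_le_mul_left (h1.trans_eq ?_) h2
    ring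
  have j2 : N ^ (q + 4) ≤ ∫ x in (0 : ℝ)..1, |v x| ^ (q + 4) := by
    have h1 : ∫ x in (0 : ℝ)..1, ((q + 4 : ℝ) * N ^ 2) * |v x| ^ (q + 2)
        ≤ ∫ x in (0 : ℝ)..1, ((q + 2) * |v x| ^ (q + 4) + 2 * N ^ (q + 4)) := by
      refine intervalIntegral.integral_mono zero_le_one (ii (by fun_prop)) (ii (by fun_prop))
        fun x => ?_
      have := young_pow (abs_nonneg (v x)) hN.le (q + 2) 2 (by omega)
      push_cast at this
      norm_num [add_assoc] at this ⊢
      linarith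
    rw [intervalIntegral.integral_const_mul, intervalIntegral.integral_add (ii (by fun_prop))
      (ii (by fun_prop)), ← intervalIntegral.integral_congr fun x _ => hvb x, ← hNv,
      intervalIntegral.integral_const, sub_zero, one_smul, intervalIntegral.integral_const_mul] at h1
    have h2 : (0 : ℝ) < q + 2 := by positivity
    refine le_of_mul_le_mul_left ?_ h2
    have h3 : (q + 4 : ℝ) * N ^ 2 * N ^ (q + 2) = (q + 4) * N ^ (q + 4) := by ring
    linarith
  have bR : ∀ x, |R x| ≤ 2 * N := by
    intro x
    have h1 := abs_deriv_le_integral hP hR (by fun_prop) pP (fun y => by simp only [pr y]) x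
    have h2 : ∫ y in (0 : ℝ)..1, |-r y| ≤ ∫ y in (0 : ℝ)..1, (|v y| + 3 * δ * N) := by
      refine intervalIntegral.integral_mono zero_le_one (ii (by fun_prop)) (ii (by fun_prop))
        fun y => ?_
      have := abs_add_le (v y) (r y - v y)
      rw [add_sub_cancel] at this
      simp only [abs_neg]
      linarith [br y]
    rw [intervalIntegral.integral_add (ii (by fun_prop)) (ii (by fun_prop)),
      intervalIntegral.integral_const, sub_zero, one_smul] at h2
    nlinarith
  -- The products `v ^ (q + 3) R`, `v ^ (q + 2) Z₁ R` and `v ^ (q + 1) Z₁² R` are primitives that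
  -- move the derivative from powers of `v` onto `R` and `Z₁`. The rough `Z` does not occur in `Φ`,
  -- since it cannot be differentiated.
  set Φ : ℝ → ℝ := fun x => v x ^ (q + 1) * (v₁ x + G x)
    - χ * ((q + 1) / (q + 3) * (v x ^ (q + 3) * R x)
      + 2 * ((q + 1) / (q + 2)) * (v x ^ (q + 2) * (Z₁ x * R x))
      + v x ^ (q + 1) * (Z₁ x ^ 2 * R x)) with hΦ
  set Φ' : ℝ → ℝ := fun x => ((q + 1) * v x ^ q * v₁ x * (v₁ x + G x)
      + v x ^ (q + 1) * (v₂ x + G₁ x))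
    - χ * ((q + 1) / (q + 3) * ((q + 3) * v x ^ (q + 2) * v₁ x * R x + v x ^ (q + 3) * -r x)
      + 2 * ((q + 1) / (q + 2)) * ((q + 2) * v x ^ (q + 1) * v₁ x * (Z₁ x * R x)
        + v x ^ (q + 2) * (Z₁' x * R x + Z₁ x * -r x))
      + ((q + 1) * v x ^ q * v₁ x * (Z₁ x ^ 2 * R x)
        + v x ^ (q + 1) * (2 * Z₁ x * Z₁' x * R x + Z₁ x ^ 2 * -r x))) with hΦ'
  have dΦ : ∀ x, HasDerivAt Φ (Φ' x) x := by
    intro x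
    have e1 : HasDerivAt (fun x => v x ^ (q + 1)) ((q + 1) * v x ^ q * v₁ x) x := by
      simpa using (hv x).fun_pow (q + 1)
    have e2 : HasDerivAt (fun x => v x ^ (q + 2)) ((q + 2) * v x ^ (q + 1) * v₁ x) x := by
      simpa using (hv x).fun_pow (q + 2)
    have e3 : HasDerivAt (fun x => v x ^ (q + 3)) ((q + 3) * v x ^ (q + 2) * v₁ x) x := by
      simpa using (hv x).fun_pow (q + 3)
    have e4 : HasDerivAt (fun x => Z₁ x ^ 2 * R x)
        (2 * Z₁ x * Z₁' x * R x + Z₁ x ^ 2 * -r x) x := by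
      simpa using ((hZ₁ x).fun_pow 2).fun_mul (hR x)
    exact (e1.mul ((hv₁ x).add (hG x))).sub
      (((((e3.mul (hR x)).const_mul _).add ((e2.mul ((hZ₁ x).mul (hR x))).const_mul _)).add
        (e1.mul e4)).const_mul χ)
  have iΦ : ∫ x in (0 : ℝ)..1, Φ' x = 0 := by
    refine integral_deriv_periodic dΦ (by fun_prop) fun x => ?_
    simp only [hΦ, pv x, pv₁ x, pG x, pR x, pZ₁ x]
  have main : ∫ x in (0 : ℝ)..1, (v x ^ (q + 1) * (v₂ x + G₁ x) - Φ' x)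
      ≤ ∫ x in (0 : ℝ)..1, ((-(χ / 3) + 48 * δ * χ) * |v x| ^ (q + 4) + 48 * δ * χ * N ^ (q + 4)) := by
    refine intervalIntegral.integral_mono zero_le_one (ii (by fun_prop)) (ii (by fun_prop))
      fun x => ?_
    have h := energy_pointwise hq (v₁ := v₁ x) hχ hN hδ (by linarith) (bG x) (bR x) (br x) (bZ x)
      (bZ₁ x) (bZ₁' x) (bZZ₁ x)
    refine (le_of_eq ?_).trans (h.trans (le_of_eq (by ring)))
    simp only [hΦ']
    have h3 : (q + 3 : ℝ) ≠ 0 := by positivity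
    have h2 : (q + 2 : ℝ) ≠ 0 := by positivity
    field_simp
    ring
  rw [intervalIntegral.integral_sub (ii (by fun_prop)) (ii (by fun_prop)), iΦ, sub_zero,
    intervalIntegral.integral_add (ii (by fun_prop)) (ii (by fun_prop)),
    intervalIntegral.integral_const_mul, intervalIntegral.integral_const, sub_zero, one_smul] at main
  -- The choice `δ ≤ 1/500` is made for `1/3 - 96 δ ≥ 1/8`.
  have hneg : -(χ / 3) + 48 * δ * χ ≤ 0 := by nlinarith
  have := mul_le_mul_of_nonpos_left j2 hneg
  have hpos : 0 < χ * N ^ (q + 4) := by positivity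
  nlinarith

/-! ### The heat semigroup on Fourier coefficients -/

theorem exists_real_of_summable {a : ℤ → ℂ} (ha : Summable fun m => ‖a m‖)
    (hconj : ∀ m, a (-m) = starRingEnd ℂ (a m)) :
    ∃ F : C(Torus, ℝ), (∀ x, F x = (∑' m, a m * fourier m x).re) ∧
      (∀ m, funCoeff F m = a m) := by
  have hs : Summable fun m => a m • (fourier m : C(Torus, ℂ)) :=
    Summable.of_norm (by simpa only [norm_smul, fourier_norm, mul_one] using ha)
  set H := ∑' m, a m • (fourier m : C(Torus, ℂ)) with hH
  have hx : ∀ x, HasSum (fun m => a m * fourier m x) (H x) := fun x => by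
    have := hs.hasSum.mapL (ContinuousMap.evalCLM ℂ x)
    simpa only [ContinuousMap.evalCLM_apply, ContinuousMap.smul_apply, smul_eq_mul] using this
  have hreal : ∀ x, ((H x).re : ℂ) = H x := fun x => by
    have h1 := (Complex.hasSum_conj'.2 (hx x))
    have h2 : HasSum (fun m => a m * fourier m x) (starRingEnd ℂ (H x)) := by
      rw [← (Equiv.neg ℤ).hasSum_iff]
      convert h1 using 2 with m
      simp only [Function.comp_apply, Equiv.neg_apply, hconj, map_mul, fourier_neg]
    exact Complex.conj_eq_iff_re.1 (h2.unique (hx x))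
  refine ⟨⟨fun x => (H x).re, by fun_prop⟩, fun x => by rw [(hx x).tsum_eq]; rfl, fun m => ?_⟩
  have h1 : toComplex ⟨fun x => (H x).re, by fun_prop⟩ = H := by
    ext x; exact hreal x
  rw [funCoeff_eq, h1]
  have h2 := hs.hasSum.mapL (fourierCoeffCLM m)
  simp only [map_smul, fourierCoeffCLM_apply, fourierCoeff_fourier, smul_eq_mul] at h2
  refine h2.unique ?_
  convert hasSum_single m fun k hk => ?_ using 1
  · simp
  · rw [Pi.single_eq_of_ne (Ne.symm hk), mul_zero]

theorem heat_spec {c : ℤ → ℂ} {t : ℝ}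
    (hs : Summable fun m : ℤ => ‖(Real.exp (-4 * Real.pi ^ 2 * (m : ℝ) ^ 2 * t) : ℂ) * c m‖)
    (hconj : ∀ m, c (-m) = starRingEnd ℂ (c m)) :
    ∃ F : C(Torus, ℝ), (∀ x, F x = heat t c x) ∧
      (∀ m, funCoeff F m = (Real.exp (-4 * Real.pi ^ 2 * (m : ℝ) ^ 2 * t) : ℂ) * c m) := by
  obtain ⟨F, h1, h2⟩ := exists_real_of_summable hs fun m => by
    simp only [hconj, map_mul, Complex.conj_ofReal]
    push_cast; simp only [neg_sq]
  exact ⟨F, h1, h2⟩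

theorem abs_heat_le {c : ℤ → ℂ} {t : ℝ}
    (hs : Summable fun m : ℤ => ‖(Real.exp (-4 * Real.pi ^ 2 * (m : ℝ) ^ 2 * t) : ℂ) * c m‖)
    (x : Torus) :
    |heat t c x| ≤ ∑' m : ℤ, ‖(Real.exp (-4 * Real.pi ^ 2 * (m : ℝ) ^ 2 * t) : ℂ) * c m‖ := by
  refine (Complex.abs_re_le_norm _).trans ?_
  have h : ∀ m : ℤ, ‖(Real.exp (-4 * Real.pi ^ 2 * (m : ℝ) ^ 2 * t) : ℂ) * c m * fourier m x‖
      = ‖(Real.exp (-4 * Real.pi ^ 2 * (m : ℝ) ^ 2 * t) : ℂ) * c m‖ := fun m => by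
    rw [norm_mul, norm_fourier_apply, mul_one]
  refine (norm_tsum_le_tsum_norm (by simpa only [h] using hs)).trans_eq ?_
  simp only [h]

/-! #### Distributions -/

theorem TorusDistribution.coeff_neg (u : TorusDistribution) (m : ℤ) :
    u.coeff (-m) = starRingEnd ℂ (u.coeff m) := by
  have h1 : cosMode (-m) = cosMode m := by
    refine Subtype.ext (funext fun x => ?_)
    change (fourier (-m) x : ℂ).re = (fourier m x : ℂ).re
    rw [fourier_neg, Complex.conj_re]
  have h2 : sinMode (-m) = -sinMode m := by
    refine Subtype.ext (funext fun x => ?_)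
    change (fourier (-m) x : ℂ).im = -(fourier m x : ℂ).im
    rw [fourier_neg, Complex.conj_im]
  simp only [TorusDistribution.coeff, h1, h2, map_neg, map_sub, map_mul, Complex.conj_ofReal,
    Complex.conj_I]
  push_cast
  ring

theorem TorusDistribution.coeff_zero (u : TorusDistribution) : u.coeff 0 = u.mean := by
  have h1 : cosMode 0 = oneFun := by
    refine Subtype.ext (funext fun x => ?_)
    change (fourier 0 x : ℂ).re = 1
    simp
  have h2 : sinMode 0 = 0 := by
    refine Subtype.ext (funext fun x => ?_)
    change (fourier 0 x : ℂ).im = 0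
    simp
  simp [TorusDistribution.coeff, TorusDistribution.mean, h1, h2]

/-- Continuity against finitely many derivatives means polynomial growth of the coefficients, since
each derivative of a mode costs `2π|m|`. The Gaussian factor of the heat semigroup then gives
summability. -/
theorem TorusDistribution.norm_coeff_le (u : TorusDistribution) :
    ∃ (N : ℕ) (K : ℝ), ∀ m : ℤ,
      ‖u.coeff m‖ ≤ K * ∑ k ∈ Finset.range (N + 1), (2 * Real.pi) ^ k * |(m : ℝ)| ^ k := by
  obtain ⟨N, K, h⟩ := u.continuous'
  refine ⟨N, 2 * |K|, fun m => ?_⟩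
  set M := ∑ k ∈ Finset.range (N + 1), (2 * Real.pi) ^ k * |(m : ℝ)| ^ k with hM
  have hM0 : 0 ≤ M := Finset.sum_nonneg fun k _ => by positivity
  have hk : ∀ k ≤ N, |2 * Real.pi * m| ^ k ≤ M := fun k hk => by
    rw [abs_mul, abs_of_pos Real.two_pi_pos, mul_pow]
    exact Finset.single_le_sum (f := fun k => (2 * Real.pi) ^ k * |(m : ℝ)| ^ k)
      (fun i _ => by positivity) (Finset.mem_range.2 (by omega))
  have hc : |u.toLin (cosMode m)| ≤ |K| * M := by
    refine (h (cosMode m) M fun k hkN x => ?_).trans (by gcongr; exact le_abs_self K)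
    have e : (fun y : ℝ => (cosMode m).1 (y : Torus)) = fun y => Real.cos (2 * Real.pi * m * y) := by
      funext y
      change (fourier m (y : Torus) : ℂ).re = _
      rw [fourier_coe_eq, Complex.exp_ofReal_mul_I_re]
    rw [e, iteratedDeriv_comp_const_mul Real.contDiff_cos, abs_mul, abs_pow]
    exact (mul_le_of_le_one_right (by positivity) (Real.abs_iteratedDeriv_cos_le_one k _)).trans
      (hk k hkN)
  have hs : |u.toLin (sinMode m)| ≤ |K| * M := by
    refine (h (sinMode m) M fun k hkN x => ?_).trans (by gcongr; exact le_abs_self K)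
    have e : (fun y : ℝ => (sinMode m).1 (y : Torus)) = fun y => Real.sin (2 * Real.pi * m * y) := by
      funext y
      change (fourier m (y : Torus) : ℂ).im = _
      rw [fourier_coe_eq, Complex.exp_ofReal_mul_I_im]
    rw [e, iteratedDeriv_comp_const_mul Real.contDiff_sin, abs_mul, abs_pow]
    exact (mul_le_of_le_one_right (by positivity) (Real.abs_iteratedDeriv_sin_le_one k _)).trans
      (hk k hkN)
  refine (norm_sub_le _ _).trans ?_
  rw [norm_mul, Complex.norm_I, one_mul, Complex.norm_real, Complex.norm_real, Real.norm_eq_abs,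
    Real.norm_eq_abs]
  linarith

theorem TorusDistribution.summable_heat (u : TorusDistribution) {t : ℝ} (ht : 0 < t) :
    Summable fun m : ℤ => ‖(Real.exp (-4 * Real.pi ^ 2 * (m : ℝ) ^ 2 * t) : ℂ) * u.coeff m‖ := by
  obtain ⟨N, K, h⟩ := u.norm_coeff_le
  have h1 : Summable fun m : ℤ => K * ∑ k ∈ Finset.range (N + 1), (2 * Real.pi) ^ k *
      ((|m| ^ k : ℝ) * Real.exp (-Real.pi * (4 * Real.pi * t * m ^ 2 - 2 * 0 * |m|))) :=
    (summable_sum fun k _ => (summable_pow_mul_jacobiTheta₂_term_bound 0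
      (T := 4 * Real.pi * t) (by positivity) k).mul_left _).mul_left K
  refine Summable.of_nonneg_of_le (fun m => norm_nonneg _) (fun m => ?_) h1
  have e : Real.exp (-Real.pi * (4 * Real.pi * t * m ^ 2 - 2 * 0 * |m|))
      = Real.exp (-4 * Real.pi ^ 2 * (m : ℝ) ^ 2 * t) := by congr 1; ring
  rw [norm_mul, Complex.norm_real, Real.norm_eq_abs, abs_of_pos (Real.exp_pos _), e]
  calc _ ≤ Real.exp (-4 * Real.pi ^ 2 * (m : ℝ) ^ 2 * t) *
        (K * ∑ k ∈ Finset.range (N + 1), (2 * Real.pi) ^ k * |(m : ℝ)| ^ k) := by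
        gcongr; exact h m
    _ = _ := by
        simp only [Finset.mul_sum]
        refine Finset.sum_congr rfl fun k _ => by push_cast; ring

/-! #### Smoothing of derivatives -/

theorem funCoeff_neg (f : C(Torus, ℝ)) (m : ℤ) :
    funCoeff f (-m) = starRingEnd ℂ (funCoeff f m) := by
  simp only [funCoeff, fourierCoeff]
  rw [← integral_conj]
  refine integral_congr_ae (ae_of_all _ fun x => ?_)
  simp

theorem derivCoeff_neg {c : ℤ → ℂ} (hc : ∀ m, c (-m) = starRingEnd ℂ (c m)) (m : ℤ) :
    derivCoeff c (-m) = starRingEnd ℂ (derivCoeff c m) := by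
  simp only [derivCoeff, hc, map_mul, Complex.conj_ofReal, Complex.conj_I, map_ofNat]
  push_cast
  rw [map_intCast]
  ring

theorem bessel (f : C(Torus, ℝ)) {M : ℝ} (hM : ∀ x, |f x| ≤ M) :
    Summable (fun m => ‖funCoeff f m‖ ^ 2) ∧ ∑' m, ‖funCoeff f m‖ ^ 2 ≤ M ^ 2 := by
  have h := hasSum_sq_fourierCoeff
    (ContinuousMap.toLp (E := ℂ) 2 AddCircle.haarAddCircle ℂ (toComplex f))
  simp only [fourierCoeff_toLp] at h
  refine ⟨h.summable, ?_⟩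
  change ∑' m, ‖fourierCoeff (toComplex f) m‖ ^ 2 ≤ M ^ 2
  rw [h.tsum_eq]
  have h2 : ∫ x, ‖ContinuousMap.toLp (E := ℂ) 2 AddCircle.haarAddCircle ℂ (toComplex f) x‖ ^ 2
      ∂AddCircle.haarAddCircle = ∫ x, ‖toComplex f x‖ ^ 2 ∂AddCircle.haarAddCircle := by
    refine integral_congr_ae ?_
    filter_upwards [ContinuousMap.coeFn_toLp (E := ℂ) (p := 2) (𝕜 := ℂ) AddCircle.haarAddCircle
      (toComplex f)] with x hx
    rw [hx]
  rw [h2]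
  calc _ ≤ ∫ x : Torus, M ^ 2 ∂AddCircle.haarAddCircle := by
        refine integral_mono (integrable_torus (by fun_prop)) (integrable_const _) fun x => ?_
        simp only [toComplex_apply, Complex.norm_real, Real.norm_eq_abs]
        exact pow_le_pow_left₀ (abs_nonneg _) (hM x) 2
    _ = M ^ 2 := by simp

/-- The Gaussian is traded for `(m² t) ^ (-7/4)`. The exponent must exceed `3/2`, so that the sum
over `m` converges, and stay below `2`, so that the square root `t ^ (-7/8)` is integrable at `0`.
-/
theorem exp_mul_sq_le {t : ℝ} (ht : 0 < t) (m : ℤ) :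
    (Real.exp (-4 * Real.pi ^ 2 * (m : ℝ) ^ 2 * t) * (2 * Real.pi * |(m : ℝ)|)) ^ 2
      ≤ 8 * Real.pi ^ 2 * t ^ (-(7 / 4) : ℝ) * |(m : ℝ)| ^ (-(3 / 2) : ℝ) := by
  rcases eq_or_ne m 0 with rfl | hm
  · simp
  have hm' : 0 < |(m : ℝ)| := abs_pos.2 (by exact_mod_cast hm)
  set y := |(m : ℝ)| ^ 2 * t with hy
  have hy0 : 0 < y := by positivity
  have h1 : y ^ (7 / 4 : ℝ) ≤ 2 * Real.exp y := by
    have h2 : y ^ (7 / 4 : ℝ) ≤ 1 + y ^ 2 := by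
      rcases le_total y 1 with h | h
      · have := Real.rpow_le_one hy0.le h (by norm_num : (0 : ℝ) ≤ 7 / 4)
        nlinarith
      · have := Real.rpow_le_rpow_of_exponent_le h (by norm_num : (7 / 4 : ℝ) ≤ (2 : ℕ))
        rw [Real.rpow_natCast] at this
        linarith
    have := Real.quadratic_le_exp_of_nonneg hy0.le
    nlinarith
  have h2 : Real.exp (-y) ≤ 2 * y ^ (-(7 / 4) : ℝ) := by
    rw [Real.exp_neg, Real.rpow_neg hy0.le, ← div_eq_mul_inv, le_div_iff₀ (by positivity),
      inv_mul_le_iff₀ (Real.exp_pos _)]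
    linarith
  have h3 : Real.exp (-4 * Real.pi ^ 2 * (m : ℝ) ^ 2 * t) ^ 2 ≤ Real.exp (-y) := by
    rw [← Real.exp_nat_mul, Real.exp_le_exp, hy, sq_abs]
    have : 1 ≤ Real.pi := by linarith [Real.pi_gt_three]
    have h5 : 1 ≤ Real.pi ^ 2 := one_le_pow₀ this
    have h6 : 0 ≤ (m : ℝ) ^ 2 * t := by positivity
    push_cast
    nlinarith
  have h4 : |(m : ℝ)| ^ 2 * y ^ (-(7 / 4) : ℝ)
      = t ^ (-(7 / 4) : ℝ) * |(m : ℝ)| ^ (-(3 / 2) : ℝ) := by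
    rw [hy, Real.mul_rpow (by positivity) ht.le, ← Real.rpow_natCast, ← Real.rpow_mul hm'.le,
      ← mul_assoc, ← Real.rpow_add hm', mul_comm]
    norm_num
  calc _ = 4 * Real.pi ^ 2 * |(m : ℝ)| ^ 2 *
        Real.exp (-4 * Real.pi ^ 2 * (m : ℝ) ^ 2 * t) ^ 2 := by ring
    _ ≤ 4 * Real.pi ^ 2 * |(m : ℝ)| ^ 2 * (2 * y ^ (-(7 / 4) : ℝ)) := by
        gcongr; exact h3.trans h2
    _ = 8 * Real.pi ^ 2 * (|(m : ℝ)| ^ 2 * y ^ (-(7 / 4) : ℝ)) := by ring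
    _ = _ := by rw [h4]; ring

theorem norm_derivCoeff (c : ℤ → ℂ) (m : ℤ) :
    ‖derivCoeff c m‖ = 2 * Real.pi * |(m : ℝ)| * ‖c m‖ := by
  simp only [derivCoeff, norm_mul, Complex.norm_I, mul_one, Complex.norm_intCast]
  simp [abs_of_pos Real.pi_pos]

/-- The heat semigroup maps derivatives of bounded functions to bounded functions, with a norm
that is integrable in time. -/
theorem exists_heat_derivCoeff_bound :
    ∃ C : ℝ, 0 < C ∧ ∀ (f : C(Torus, ℝ)) (M t : ℝ), 0 < M → 0 < t → (∀ x, |f x| ≤ M) →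
      (Summable fun m : ℤ =>
        ‖(Real.exp (-4 * Real.pi ^ 2 * (m : ℝ) ^ 2 * t) : ℂ) * derivCoeff (funCoeff f) m‖) ∧
      ∀ x, |heat t (derivCoeff (funCoeff f)) x| ≤ C * M * t ^ (-(7 / 8) : ℝ) := by
  have hu : Summable fun m : ℤ => |(m : ℝ)| ^ (-(3 / 2) : ℝ) :=
    Real.summable_abs_int_rpow (by norm_num)
  set S := ∑' m : ℤ, |(m : ℝ)| ^ (-(3 / 2) : ℝ) with hS
  have hS0 : 0 ≤ S := tsum_nonneg fun m => by positivity
  refine ⟨(8 * Real.pi ^ 2 * S + 1) / 2, by positivity, fun f M t hM ht hf => ?_⟩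
  obtain ⟨hb1, hb2⟩ := bessel f hf
  set θ := t ^ (7 / 8 : ℝ) with hθ
  have hθ0 : 0 < θ := by positivity
  have hθi : t ^ (-(7 / 8) : ℝ) = θ⁻¹ := Real.rpow_neg ht.le _
  have hθ2 : θ * t ^ (-(7 / 4) : ℝ) = θ⁻¹ := by
    rw [← hθi, hθ, ← Real.rpow_add ht]; norm_num
  have hle : ∀ m : ℤ,
      ‖(Real.exp (-4 * Real.pi ^ 2 * (m : ℝ) ^ 2 * t) : ℂ) * derivCoeff (funCoeff f) m‖
      ≤ θ⁻¹ * M / 2 * (8 * Real.pi ^ 2 * |(m : ℝ)| ^ (-(3 / 2) : ℝ)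
          + (M ^ 2)⁻¹ * ‖funCoeff f m‖ ^ 2) := by
    intro m
    have h1 := exp_mul_sq_le ht m
    set A := Real.exp (-4 * Real.pi ^ 2 * (m : ℝ) ^ 2 * t) * (2 * Real.pi * |(m : ℝ)|) with hA
    set B := ‖funCoeff f m‖ with hB
    have h2 : ‖(Real.exp (-4 * Real.pi ^ 2 * (m : ℝ) ^ 2 * t) : ℂ) * derivCoeff (funCoeff f) m‖
        = A * B := by
      rw [norm_mul, norm_derivCoeff, Complex.norm_real, Real.norm_eq_abs,
        abs_of_pos (Real.exp_pos _), hA, hB]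
      ring
    -- Cauchy-Schwarz between the Gaussian weights and Bessel's inequality, in AM-GM form. The
    -- weight `θ = t ^ (7/8)` makes both halves scale like `t ^ (-7/8)`.
    have h3 : 2 * (A * B) ≤ θ * M * A ^ 2 + θ⁻¹ * M⁻¹ * B ^ 2 := by
      have h4 : 0 ≤ θ * M * (A - θ⁻¹ * M⁻¹ * B) ^ 2 := by positivity
      have h5 : θ * M * (A - θ⁻¹ * M⁻¹ * B) ^ 2
          = θ * M * A ^ 2 - 2 * (A * B) + θ⁻¹ * M⁻¹ * B ^ 2 := by
        field_simp; ring
      linarith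
    have h6 : θ * M * A ^ 2 ≤ θ⁻¹ * M * (8 * Real.pi ^ 2 * |(m : ℝ)| ^ (-(3 / 2) : ℝ)) := by
      calc θ * M * A ^ 2 ≤ θ * M * (8 * Real.pi ^ 2 * t ^ (-(7 / 4) : ℝ) *
            |(m : ℝ)| ^ (-(3 / 2) : ℝ)) := by gcongr
        _ = (θ * t ^ (-(7 / 4) : ℝ)) * M * (8 * Real.pi ^ 2 * |(m : ℝ)| ^ (-(3 / 2) : ℝ)) := by ring
        _ = _ := by rw [hθ2]
    have h7 : θ⁻¹ * M * ((M ^ 2)⁻¹ * B ^ 2) = θ⁻¹ * M⁻¹ * B ^ 2 := by field_simp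
    rw [h2]
    linarith
  have hsum : Summable fun m : ℤ => θ⁻¹ * M / 2 * (8 * Real.pi ^ 2 * |(m : ℝ)| ^ (-(3 / 2) : ℝ)
          + (M ^ 2)⁻¹ * ‖funCoeff f m‖ ^ 2) :=
    ((hu.mul_left _).add (hb1.mul_left _)).mul_left _
  have hs := Summable.of_nonneg_of_le (fun m => norm_nonneg _) hle hsum
  refine ⟨hs, fun x => (abs_heat_le hs x).trans ((hs.tsum_le_tsum hle hsum).trans ?_)⟩
  rw [tsum_mul_left, (hu.mul_left _).tsum_add (hb1.mul_left _), tsum_mul_left, tsum_mul_left, hθi]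
  have : (M ^ 2)⁻¹ * ∑' m, ‖funCoeff f m‖ ^ 2 ≤ 1 := by
    rw [inv_mul_le_iff₀ (by positivity)]; linarith
  calc _ ≤ θ⁻¹ * M / 2 * (8 * Real.pi ^ 2 * S + 1) := by gcongr
    _ = _ := by ring

/-! ### Fourier coefficients of mild solutions -/

theorem continuousOn_funCoeff {I : Set ℝ} {G : ℝ → C(Torus, ℝ)} (hG : ContinuousOn G I) (m : ℤ) :
    ContinuousOn (fun s => funCoeff (G s) m) I := by
  have h : Continuous toComplex := by
    refine (LipschitzWith.of_dist_le_mul (K := 1) fun f g => ?_).continuous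
    rw [NNReal.coe_one, one_mul, ContinuousMap.dist_le dist_nonneg]
    intro x
    rw [toComplex_apply, toComplex_apply, Complex.dist_of_im_eq (by simp), Complex.ofReal_re,
      Complex.ofReal_re]
    exact ContinuousMap.dist_apply_le_dist x
  exact (fourierCoeffCLM m).continuous.comp_continuousOn (h.comp_continuousOn hG)

/-- A beta-type integrand: on each side of `t / 2` only one of the two factors is singular. -/
theorem integrableOn_rpow_mul_rpow {θ t : ℝ} (hθ : 0 < θ) (hθ1 : θ < 1) (ht : 0 < t) :
    ∃ g : ℝ → ℝ, IntegrableOn g (Ioo 0 t) ∧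
      ∀ s ∈ Ioo 0 t, s ^ (-θ) * (t - s) ^ (-(7 / 8) : ℝ) ≤ g s := by
  refine ⟨fun s => (t / 2) ^ (-(7 / 8) : ℝ) * s ^ (-θ)
    + (t / 2) ^ (-θ) * (t - s) ^ (-(7 / 8) : ℝ), ?_, fun s hs => ?_⟩
  · rw [← integrableOn_Ioc_iff_integrableOn_Ioo, ← intervalIntegrable_iff_integrableOn_Ioc_of_le ht.le]
    refine ((intervalIntegral.intervalIntegrable_rpow' (by linarith)).const_mul _).add
      (IntervalIntegrable.const_mul ?_ _)
    have h := ((intervalIntegral.intervalIntegrable_rpow' (a := 0) (b := t)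
      (r := -(7 / 8)) (by norm_num)).comp_sub_left t).symm
    simpa using h
  · have h2 : 0 < t - s := by linarith [hs.2]
    have hs0 : 0 < s := hs.1
    rcases le_total s (t / 2) with h | h
    · have h1 : (t - s) ^ (-(7 / 8) : ℝ) ≤ (t / 2) ^ (-(7 / 8) : ℝ) :=
        Real.rpow_le_rpow_of_nonpos (by positivity) (by linarith) (by norm_num)
      calc s ^ (-θ) * (t - s) ^ (-(7 / 8) : ℝ) ≤ s ^ (-θ) * (t / 2) ^ (-(7 / 8) : ℝ) := by gcongr
        _ = (t / 2) ^ (-(7 / 8) : ℝ) * s ^ (-θ) := mul_comm _ _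
        _ ≤ _ := le_add_of_nonneg_right (by positivity)
    · have h1 : s ^ (-θ) ≤ (t / 2) ^ (-θ) :=
        Real.rpow_le_rpow_of_nonpos (by positivity) h (by linarith)
      calc s ^ (-θ) * (t - s) ^ (-(7 / 8) : ℝ) ≤ (t / 2) ^ (-θ) * (t - s) ^ (-(7 / 8) : ℝ) := by
            gcongr
        _ ≤ _ := le_add_of_nonneg_left (by positivity)

/-- Provides the hypothesis of Fubini for the Duhamel term. Joint measurability holds because the
heat series is a pointwise limit of finite sums that are continuous in `(s, x)`. -/
theorem integrable_heat_prod {θ B T t : ℝ} (hθ : 0 < θ) (hθ1 : θ < 1) (hB : 0 < B)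
    {G : ℝ → C(Torus, ℝ)} (hG : ContinuousOn G (Ioc 0 T))
    (hGB : ∀ s ∈ Ioc 0 T, ∀ x, |G s x| ≤ B * s ^ (-θ)) (ht : t ∈ Ioc 0 T) :
    Integrable (fun p : ℝ × Torus => heat (t - p.1) (derivCoeff (funCoeff (G p.1))) p.2)
      ((volume.restrict (Ioo 0 t)).prod AddCircle.haarAddCircle) := by
  obtain ⟨C, hC, hheat⟩ := exists_heat_derivCoeff_bound
  obtain ⟨g, hg, hgb⟩ := integrableOn_rpow_mul_rpow hθ hθ1 ht.1
  have hsub : Ioo 0 t ⊆ Ioc 0 T := fun s hs => ⟨hs.1, hs.2.le.trans ht.2⟩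
  have hprod : (volume.restrict (Ioo 0 t)).prod (AddCircle.haarAddCircle (T := 1))
      = (volume.prod AddCircle.haarAddCircle).restrict (Ioo 0 t ×ˢ univ) := by
    rw [← Measure.prod_restrict, Measure.restrict_univ]
  have hmem : ∀ᵐ p ∂(volume.restrict (Ioo 0 t)).prod (AddCircle.haarAddCircle (T := 1)),
      p.1 ∈ Ioo 0 t := by
    rw [hprod]
    filter_upwards [ae_restrict_mem (measurableSet_Ioo.prod MeasurableSet.univ)] with p hp
    exact hp.1
  have hspec : ∀ s ∈ Ioo 0 t, _ := fun s hs =>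
    hheat (G s) (B * s ^ (-θ)) (t - s) (mul_pos hB (Real.rpow_pos_of_pos hs.1 _))
      (by linarith [hs.2]) (hGB s (hsub hs))
  refine Integrable.mono' (g := fun p => C * B * g p.1) ((Integrable.comp_fst hg _).const_mul _)
    ?_ ?_
  · refine Complex.continuous_re.comp_aestronglyMeasurable (f := fun p : ℝ × Torus =>
      ∑' m : ℤ, (Real.exp (-4 * Real.pi ^ 2 * (m : ℝ) ^ 2 * (t - p.1)) : ℂ) *
        derivCoeff (funCoeff (G p.1)) m * fourier m p.2) ?_
    refine aestronglyMeasurable_of_tendsto_ae (atTop : Filter (Finset ℤ))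
      (f := fun F p => ∑ m ∈ F, (Real.exp (-4 * Real.pi ^ 2 * (m : ℝ) ^ 2 * (t - p.1)) : ℂ) *
        derivCoeff (funCoeff (G p.1)) m * fourier m p.2) (fun F => ?_) ?_
    · rw [hprod]
      refine ContinuousOn.aestronglyMeasurable ?_ (measurableSet_Ioo.prod MeasurableSet.univ)
      refine continuousOn_finsetSum _ fun m _ => ?_
      have h1 : ContinuousOn (fun p : ℝ × Torus => funCoeff (G p.1) m) (Ioo 0 t ×ˢ univ) :=
        ((continuousOn_funCoeff hG m).mono hsub).comp continuousOn_fst fun p hp => hp.1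
      unfold derivCoeff
      refine ContinuousOn.mul (ContinuousOn.mul (by fun_prop) (ContinuousOn.mul (by fun_prop) h1)) ?_
      fun_prop
    · filter_upwards [hmem] with p hp
      refine Summable.hasSum ?_
      refine Summable.of_norm ?_
      simpa only [norm_mul, norm_fourier_apply, mul_one] using (hspec p.1 hp).1
  · filter_upwards [hmem] with p hp
    rw [Real.norm_eq_abs]
    calc _ ≤ C * (B * p.1 ^ (-θ)) * (t - p.1) ^ (-(7 / 8) : ℝ) := (hspec p.1 hp).2 p.2
      _ = C * B * (p.1 ^ (-θ) * (t - p.1) ^ (-(7 / 8) : ℝ)) := by ring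
      _ ≤ C * B * g p.1 := by gcongr; exact hgb p.1 hp

theorem funCoeff_of_mild {θ B T t : ℝ} (hθ : 0 < θ) (hθ1 : θ < 1) (hB : 0 < B)
    {G : ℝ → C(Torus, ℝ)} (hG : ContinuousOn G (Ioc 0 T))
    (hGB : ∀ s ∈ Ioc 0 T, ∀ x, |G s x| ≤ B * s ^ (-θ)) (ht : t ∈ Ioc 0 T)
    {u : TorusDistribution} {w : C(Torus, ℝ)}
    (hw : ∀ x, w x = heat t u.coeff x
      + ∫ s in 0..t, heat (t - s) (derivCoeff (funCoeff (G s))) x) (m : ℤ) :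
    funCoeff w m = (Real.exp (-4 * Real.pi ^ 2 * (m : ℝ) ^ 2 * t) : ℂ) * u.coeff m
      + ∫ s in 0..t, (Real.exp (-4 * Real.pi ^ 2 * (m : ℝ) ^ 2 * (t - s)) : ℂ) *
        derivCoeff (funCoeff (G s)) m := by
  obtain ⟨C, hC, hheat⟩ := exists_heat_derivCoeff_bound
  obtain ⟨F, hF, hFc⟩ := heat_spec (u.summable_heat ht.1) u.coeff_neg
  have hint := integrable_heat_prod hθ hθ1 hB hG hGB ht
  have hsub : Ioo 0 t ⊆ Ioc 0 T := fun s hs => ⟨hs.1, hs.2.le.trans ht.2⟩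
  have hii : ∀ {E : Type} [NormedAddCommGroup E] [NormedSpace ℝ E] (f : ℝ → E),
      ∫ s in 0..t, f s = ∫ s in Ioo 0 t, f s := fun f => by
    rw [intervalIntegral.integral_of_le ht.1.le, integral_Ioc_eq_integral_Ioo]
  have hw2 : ∀ x, (w x : ℂ) = F x
      + ∫ s in Ioo 0 t, (heat (t - s) (derivCoeff (funCoeff (G s))) x : ℂ) := fun x => by
    rw [hw x, hF, hii, integral_complex_ofReal]
    push_cast; rfl
  have hint2 : Integrable (fun p : Torus × ℝ => (fourier (-m) p.1 : ℂ) *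
      (heat (t - p.2) (derivCoeff (funCoeff (G p.2))) p.1 : ℂ))
      (AddCircle.haarAddCircle.prod (volume.restrict (Ioo 0 t))) := by
    refine Integrable.bdd_mul (c := 1) hint.swap.ofReal ?_
      (ae_of_all _ fun p => (norm_fourier_apply _ _).le)
    exact Continuous.aestronglyMeasurable (by fun_prop)
  have e1 : funCoeff w m = funCoeff F m + ∫ x : Torus, (∫ s in Ioo 0 t, (fourier (-m) x : ℂ) *
      (heat (t - s) (derivCoeff (funCoeff (G s))) x : ℂ)) ∂AddCircle.haarAddCircle := by
    simp only [funCoeff, fourierCoeff, hw2, smul_eq_mul, mul_add, integral_const_mul]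
    refine integral_add (integrable_torus (by fun_prop)) ?_
    have := hint2.integral_prod_left
    simpa only [integral_const_mul] using this
  rw [e1, hFc, integral_integral_swap hint2, hii]
  congr 1
  refine setIntegral_congr_fun measurableSet_Ioo fun s hs => ?_
  have h1 := hheat (G s) (B * s ^ (-θ)) (t - s) (mul_pos hB (Real.rpow_pos_of_pos hs.1 _))
      (by linarith [hs.2]) (hGB s (hsub hs))
  obtain ⟨Q, hQ, hQc⟩ := heat_spec h1.1 (derivCoeff_neg (funCoeff_neg (G s)))
  simp only [← hQ]
  exact hQc m

/-- Factoring `exp (l t)` out of the Duhamel formula leaves the primitive of a function continuous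
on `(0, T]` and integrable at `0`; the product rule then gives the ODE of the mode. -/
theorem hasDerivAt_funCoeff_of_mild {θ B T t : ℝ} (hθ : 0 < θ) (hθ1 : θ < 1) (hB : 0 < B)
    {G : ℝ → C(Torus, ℝ)} (hG : ContinuousOn G (Ioc 0 T))
    (hGB : ∀ s ∈ Ioc 0 T, ∀ x, |G s x| ≤ B * s ^ (-θ)) (ht : t ∈ Ioo 0 T)
    {u : TorusDistribution} {w : ℝ → C(Torus, ℝ)}
    (hw : ∀ t ∈ Ioc 0 T, ∀ x, w t x = heat t u.coeff x
      + ∫ s in 0..t, heat (t - s) (derivCoeff (funCoeff (G s))) x) (m : ℤ) :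
    HasDerivAt (fun t => funCoeff (w t) m)
      (derivCoeff (derivCoeff (funCoeff (w t))) m + derivCoeff (funCoeff (G t)) m) t := by
  set l : ℝ := -4 * Real.pi ^ 2 * (m : ℝ) ^ 2 with hl
  set φ : ℝ → ℂ := fun s => (Real.exp (l * -s) : ℂ) * derivCoeff (funCoeff (G s)) m with hφ
  have hsplit : ∀ s ∈ Ioc 0 T, funCoeff (w s) m
      = (Real.exp (l * s) : ℂ) * (u.coeff m + ∫ r in 0..s, φ r) := fun s hs => by
    rw [funCoeff_of_mild hθ hθ1 hB hG hGB hs (hw s hs), mul_add,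
      ← intervalIntegral.integral_const_mul]
    congr 1
    refine intervalIntegral.integral_congr fun r _ => ?_
    simp only [hφ, ← mul_assoc, ← Complex.ofReal_mul, ← Real.exp_add]
    congr 3
    ring
  have hc : ContinuousOn φ (Ioc 0 T) := by
    refine ContinuousOn.mul (by fun_prop) ?_
    unfold derivCoeff
    exact continuousOn_const.mul (continuousOn_funCoeff hG m)
  have hnhds : Ioc 0 T ∈ 𝓝 t := Ioc_mem_nhds ht.1 ht.2
  have hint : IntervalIntegrable φ volume 0 t := by
    rw [intervalIntegrable_iff_integrableOn_Ioc_of_le ht.1.le]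
    have hsub : Ioc 0 t ⊆ Ioc 0 T := Ioc_subset_Ioc_right ht.2.le
    have hg : IntegrableOn (fun s => Real.exp (-l * t) * (2 * Real.pi * |(m : ℝ)| * B) * s ^ (-θ))
        (Ioc 0 t) := by
      rw [← intervalIntegrable_iff_integrableOn_Ioc_of_le ht.1.le]
      exact (intervalIntegral.intervalIntegrable_rpow' (by linarith)).const_mul _
    refine Integrable.mono' hg ((hc.mono hsub).aestronglyMeasurable measurableSet_Ioc) ?_
    filter_upwards [ae_restrict_mem measurableSet_Ioc] with s hs
    rw [hφ, norm_mul, norm_derivCoeff, Complex.norm_real, Real.norm_eq_abs,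
      abs_of_pos (Real.exp_pos _)]
    have h1 : ‖funCoeff (G s) m‖ ≤ B * s ^ (-θ) := by
      refine norm_fourierCoeff_le (toComplex (G s)) (fun x => ?_) m
      rw [toComplex_apply, Complex.norm_real]
      exact hGB s (hsub hs) x
    have h2 : l * -s ≤ -l * t := by
      have : l ≤ 0 := by rw [hl]; nlinarith [sq_nonneg (Real.pi * m)]
      nlinarith [hs.2]
    calc _ ≤ Real.exp (-l * t) * (2 * Real.pi * |(m : ℝ)| * (B * s ^ (-θ))) := by gcongr
      _ = _ := by ring
  have hI : HasDerivAt (fun s => ∫ r in 0..s, φ r) (φ t) t := by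
    refine intervalIntegral.integral_hasDerivAt_right hint ?_ (hc.continuousAt hnhds)
    exact (hc.mono Ioo_subset_Ioc_self).stronglyMeasurableAtFilter isOpen_Ioo t ht
  have hE : HasDerivAt (fun s : ℝ => (Real.exp (l * s) : ℂ)) ((Real.exp (l * t) * l : ℝ) : ℂ) t :=
    HasDerivAt.ofReal_comp (by simpa using ((hasDerivAt_id t).const_mul l).exp)
  have hD := hE.mul (hI.const_add (u.coeff m))
  refine (hD.congr_of_eventuallyEq (f₁ := fun t => funCoeff (w t) m) ?_).congr_deriv ?_
  · filter_upwards [hnhds] with s hs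
    exact hsplit s hs
  · have e1 : derivCoeff (derivCoeff (funCoeff (w t))) m = l * funCoeff (w t) m := by
      simp only [derivCoeff, hl]
      push_cast
      linear_combination (4 * Real.pi ^ 2 * m ^ 2 * funCoeff (w t) m : ℂ) * Complex.I_sq
    have e2 : (Real.exp (l * t) : ℂ) * φ t = derivCoeff (funCoeff (G t)) m := by
      simp only [hφ, ← mul_assoc, ← Complex.ofReal_mul, ← Real.exp_add]
      simp
    rw [e1, e2, hsplit t ⟨ht.1, ht.2.le⟩]
    push_cast
    ring

/-- The nonlinearity is a derivative, so the zero mode is conserved. -/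
theorem integral_of_mild {θ B T t : ℝ} (hθ : 0 < θ) (hθ1 : θ < 1) (hB : 0 < B)
    {G : ℝ → C(Torus, ℝ)} (hG : ContinuousOn G (Ioc 0 T))
    (hGB : ∀ s ∈ Ioc 0 T, ∀ x, |G s x| ≤ B * s ^ (-θ)) (ht : t ∈ Ioc 0 T)
    {u : TorusDistribution} {w : C(Torus, ℝ)}
    (hw : ∀ x, w x = heat t u.coeff x
      + ∫ s in 0..t, heat (t - s) (derivCoeff (funCoeff (G s))) x) :
    ∫ x, w x = u.mean := by
  have h := funCoeff_of_mild hθ hθ1 hB hG hGB ht hw 0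
  simp only [derivCoeff, Int.cast_zero, mul_zero, zero_mul, intervalIntegral.integral_zero,
    add_zero, u.coeff_zero] at h
  have h2 : funCoeff w 0 = ((∫ x, w x : ℝ) : ℂ) := by
    simp only [funCoeff, fourierCoeff, neg_zero, fourier_zero, one_smul]
    rw [volume_eq_haar, integral_complex_ofReal]
  rw [h2] at h
  norm_num at h
  exact_mod_cast h

/-! ### `L^p` norms of continuous functions -/

/-- The `L^p` norm of a continuous function. -/
def lpn (p : ℕ) (f : C(Torus, ℝ)) : ℝ := (eLpNorm f p volume).toReal

theorem memLp_torus (p : ℕ) (f : C(Torus, ℝ)) : MemLp f p (volume : Measure Torus) := by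
  refine MemLp.of_bound f.continuous.aestronglyMeasurable ‖f‖ (ae_of_all _ fun x => f.norm_coe_le_norm x)

theorem lpn_pow {p : ℕ} (hp : p ≠ 0) (hpe : Even p) (f : C(Torus, ℝ)) :
    lpn p f ^ p = ∫ x, f x ^ p := by
  have hp' : (p : ℝ≥0∞) ≠ 0 := by exact_mod_cast hp
  rw [lpn, (memLp_torus p f).eLpNorm_eq_integral_rpow_norm hp' (ENNReal.natCast_ne_top p),
    ENNReal.toReal_ofReal (by positivity), ENNReal.toReal_natCast, ← Real.rpow_natCast,
    ← Real.rpow_mul (by positivity), inv_mul_cancel₀ (by exact_mod_cast hp), Real.rpow_one]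
  simp only [Real.norm_eq_abs, Real.rpow_natCast, hpe.pow_abs]

theorem lpn_le_add {p : ℕ} (hp : 1 ≤ p) (f g : C(Torus, ℝ)) {ε : ℝ} (hε : 0 ≤ ε)
    (h : ∀ x, |f x - g x| ≤ ε) : lpn p f ≤ lpn p g + ε := by
  have hp' : (1 : ℝ≥0∞) ≤ p := by exact_mod_cast hp
  have h1 : eLpNorm f p volume ≤ eLpNorm g p volume + ENNReal.ofReal ε := by
    have e : (f : Torus → ℝ) = g + (f - g : Torus → ℝ) := by ext; simp
    rw [e]
    refine (eLpNorm_add_le g.continuous.aestronglyMeasurable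
      (f.continuous.sub g.continuous).aestronglyMeasurable hp').trans ?_
    gcongr
    refine (eLpNorm_le_of_ae_bound (C := ε) (ae_of_all _ h)).trans ?_
    simp
  rw [lpn, lpn]
  have h2 := ENNReal.toReal_mono (by
    simp [(memLp_torus p g).eLpNorm_ne_top]) h1
  rwa [ENNReal.toReal_add (memLp_torus p g).eLpNorm_ne_top ENNReal.ofReal_ne_top,
    ENNReal.toReal_ofReal hε] at h2

theorem continuous_lpn {p : ℕ} (hp : 1 ≤ p) : Continuous (lpn p) := by
  refine (LipschitzWith.of_dist_le_mul (K := 1) fun f g => ?_).continuous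
  rw [NNReal.coe_one, one_mul, Real.dist_eq, abs_sub_le_iff]
  have h1 := lpn_le_add hp f g dist_nonneg fun x => by
    rw [← Real.dist_eq]; exact ContinuousMap.dist_apply_le_dist x
  have h2 := lpn_le_add hp g f dist_nonneg fun x => by
    rw [← Real.dist_eq]; exact ContinuousMap.dist_apply_le_dist x
  rw [dist_comm g f] at h2
  constructor <;> linarith

/-! ### Regularized solutions -/

/-- The real part of a de la Vallée-Poussin mean. -/
def valleeRe (n : ℕ) (c : ℤ → ℂ) : C(Torus, ℝ) :=
  ⟨fun x => (vallee n c x).re, Complex.continuous_re.comp (continuous_vallee n c)⟩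

theorem hasDerivAt_valleeRe (n : ℕ) (c : ℤ → ℂ) (x : ℝ) :
    HasDerivAt (fun y : ℝ => valleeRe n c (y : Torus)) (valleeRe n (derivCoeff c) (x : Torus)) x :=
  Complex.reCLM.hasFDerivAt.comp_hasDerivAt x (hasDerivAt_vallee n c x)

theorem hasDerivAt_valleeRe_time (n : ℕ) {c : ℝ → ℤ → ℂ} {c' : ℤ → ℂ} {t : ℝ}
    (h : ∀ m, HasDerivAt (fun s => c s m) (c' m) t) (x : Torus) :
    HasDerivAt (fun s => valleeRe n (c s) x) (valleeRe n c' x) t := by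
  have : HasDerivAt (fun s => vallee n (c s) x) (vallee n c' x) t := by
    unfold vallee
    exact HasDerivAt.fun_sum fun k _ => HasDerivAt.fun_sum fun l _ =>
      ((h (k + l)).mul_const _).const_mul _
  exact Complex.reCLM.hasFDerivAt.comp_hasDerivAt t this

theorem continuousOn_valleeRe (n : ℕ) {c : ℝ → ℤ → ℂ} {I : Set ℝ}
    (h : ∀ m, ContinuousOn (fun s => c s m) I) :
    ContinuousOn (fun p : ℝ × Torus => valleeRe n (c p.1) p.2) (I ×ˢ univ) := by
  refine Complex.continuous_re.comp_continuousOn (f := fun p : ℝ × Torus => vallee n (c p.1) p.2) ?_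
  unfold vallee
  refine continuousOn_finsetSum _ fun k _ => continuousOn_finsetSum _ fun l _ => ?_
  refine continuousOn_const.mul (ContinuousOn.mul ?_ (by fun_prop))
  exact (h (k + l)).comp continuousOn_fst fun p hp => hp.1

theorem continuousOn_derivCoeff {c : ℝ → ℤ → ℂ} {I : Set ℝ}
    (h : ∀ m, ContinuousOn (fun s => c s m) I) (m : ℤ) :
    ContinuousOn (fun s => derivCoeff (c s) m) I := by
  unfold derivCoeff
  exact continuousOn_const.mul (h m)

theorem exists_valleeRe_near {f : ℝ → C(Torus, ℝ)} {I : Set ℝ} (hI : IsCompact I)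
    (hf : ContinuousOn f I) {ε : ℝ} (hε : 0 < ε) :
    ∃ n₀, ∀ n ≥ n₀, ∀ t ∈ I, ∀ x, |valleeRe n (funCoeff (f t)) x - f t x| ≤ ε := by
  have h : Continuous toComplex := by
    refine (LipschitzWith.of_dist_le_mul (K := 1) fun f g => ?_).continuous
    rw [NNReal.coe_one, one_mul, ContinuousMap.dist_le dist_nonneg]
    intro x
    rw [toComplex_apply, toComplex_apply, Complex.dist_of_im_eq (by simp), Complex.ofReal_re,
      Complex.ofReal_re]
    exact ContinuousMap.dist_apply_le_dist x
  obtain ⟨n₀, hn⟩ := exists_vallee_near_of_isCompact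
    (hI.image_of_continuousOn (h.comp_continuousOn hf)) hε
  refine ⟨n₀, fun n hn' t ht x => ?_⟩
  have h1 := hn n hn' _ ⟨t, ht, rfl⟩ x
  exact (Complex.abs_re_le_norm _).trans h1

/-! ### Differentiation under the integral and comparison in time -/

theorem hasDerivAt_integral_torus {T : ℝ} {F F' : ℝ → Torus → ℝ}
    (hF : ContinuousOn (fun p : ℝ × Torus => F p.1 p.2) (Ioc 0 T ×ˢ univ))
    (hF' : ContinuousOn (fun p : ℝ × Torus => F' p.1 p.2) (Ioc 0 T ×ˢ univ))
    (hd : ∀ t ∈ Ioo 0 T, ∀ x, HasDerivAt (fun s => F s x) (F' t x) t) {t : ℝ} (ht : t ∈ Ioo 0 T) :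
    HasDerivAt (fun s => ∫ x, F s x) (∫ x, F' t x) t := by
  obtain ⟨a, b, hab, hnhds, hsub⟩ : ∃ a b, t ∈ Icc a b ∧ Icc a b ∈ 𝓝 t ∧ Icc a b ⊆ Ioo 0 T := by
    obtain ⟨ε, hε, h⟩ := Metric.nhds_basis_closedBall.mem_iff.1 (Ioo_mem_nhds ht.1 ht.2)
    rw [Real.closedBall_eq_Icc] at h
    exact ⟨t - ε, t + ε, ⟨by linarith, by linarith⟩, Icc_mem_nhds (by linarith) (by linarith), h⟩
  have hsub2 : Icc a b ⊆ Ioc 0 T := hsub.trans Ioo_subset_Ioc_self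
  obtain ⟨C, hC⟩ := (isCompact_Icc.prod isCompact_univ).exists_bound_of_continuousOn
    (hF'.mono (prod_mono hsub2 (subset_refl (univ : Set Torus))))
  have slice : ∀ {H : ℝ → Torus → ℝ}, ContinuousOn (fun p : ℝ × Torus => H p.1 p.2)
      (Ioc 0 T ×ˢ univ) → ∀ s ∈ Icc a b, Continuous (H s) := fun hH s hs =>
    continuousOn_univ.1 (hH.comp (f := fun x : Torus => (s, x)) (by fun_prop)
      fun x _ => ⟨hsub2 hs, trivial⟩)
  refine (hasDerivAt_integral_of_dominated_loc_of_deriv_le (bound := fun _ => C) hnhds ?_ ?_ ?_ ?_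
    (integrable_const C) ?_).2
  · filter_upwards [hnhds] with s hs
    exact (slice hF s hs).aestronglyMeasurable
  · rw [volume_eq_haar]
    exact integrable_torus (slice hF t hab)
  · exact (slice hF' t hab).aestronglyMeasurable
  · exact ae_of_all _ fun x s hs => hC (s, x) ⟨hs, trivial⟩
  · exact ae_of_all _ fun x s hs => hd s (hsub hs) x

/-- For `y = N ^ p` the power `y ^ (-2/p)` is `N⁻²`, and the chain rule turns the hypothesis into a
lower bound `(2/p) · p (χ / 8) = χ / 4` for its derivative. -/
theorem rpow_neg_ge_of_deriv_le {p : ℕ} (hp : 0 < p) {χ s t : ℝ} (hst : s ≤ t) {y y' : ℝ → ℝ}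
    (hc : ContinuousOn y (Icc s t)) (hpos : ∀ r ∈ Icc s t, 0 < y r)
    (hd : ∀ r ∈ Ioo s t, HasDerivAt y (y' r) r)
    (hy : ∀ r ∈ Ioo s t, y' r ≤ -(p * (χ / 8)) * y r ^ ((p + 2 : ℝ) / p)) :
    y s ^ (-(2 : ℝ) / p) + χ / 4 * (t - s) ≤ y t ^ (-(2 : ℝ) / p) := by
  have hp' : (0 : ℝ) < p := by exact_mod_cast hp
  set φ : ℝ → ℝ := fun r => y r ^ (-(2 : ℝ) / p) - χ / 4 * r with hφ
  have hdφ : ∀ r ∈ Ioo s t,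
      HasDerivAt φ (y' r * (-(2 : ℝ) / p) * y r ^ (-(2 : ℝ) / p - 1) - χ / 4) r := fun r hr => by
    have h1 := (hd r hr).rpow_const (p := -(2 : ℝ) / p)
      (Or.inl (hpos r (Ioo_subset_Icc_self hr)).ne')
    have h2 := (hasDerivAt_id r).const_mul (χ / 4)
    simpa using h1.fun_sub h2
  have hmono : MonotoneOn φ (Icc s t) := by
    refine monotoneOn_of_deriv_nonneg (convex_Icc s t) ?_ ?_ ?_
    · exact (hc.rpow_const fun r hr => Or.inl (hpos r hr).ne').sub (by fun_prop)
    · rw [interior_Icc]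
      exact fun r hr => (hdφ r hr).differentiableAt.differentiableWithinAt
    · rw [interior_Icc]
      intro r hr
      rw [(hdφ r hr).deriv]
      have hyr := hpos r (Ioo_subset_Icc_self hr)
      have h1 := mul_le_mul_of_nonneg_right (hy r hr)
        (by positivity : (0 : ℝ) ≤ 2 / p * y r ^ (-(2 : ℝ) / p - 1))
      have h2 : y r ^ ((p + 2 : ℝ) / p) * y r ^ (-(2 : ℝ) / p - 1) = 1 := by
        have h0 : (p + 2 : ℝ) / p + (-(2 : ℝ) / p - 1) = 0 := by field_simp; ring
        rw [← Real.rpow_add hyr, h0, Real.rpow_zero]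
      have h3 : -(p * (χ / 8)) * y r ^ ((p + 2 : ℝ) / p) * (2 / p * y r ^ (-(2 : ℝ) / p - 1))
          = -(χ / 4) * (y r ^ ((p + 2 : ℝ) / p) * y r ^ (-(2 : ℝ) / p - 1)) := by
        field_simp; ring
      rw [h3, h2] at h1
      have h4 : y' r * (-(2 : ℝ) / p) * y r ^ (-(2 : ℝ) / p - 1)
          = -(y' r * (2 / p * y r ^ (-(2 : ℝ) / p - 1))) := by ring
      rw [h4]
      linarith
  have h := hmono (left_mem_Icc.2 hst) (right_mem_Icc.2 hst) hst
  simp only [hφ] at h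
  linarith

/-! ### Decay of the `L^p` norm -/

/-- A splitting of `Z` into a smooth and a small part, adapted to the energy estimate at height
`N`. -/
def Splits (q : ℕ) (χ δ N : ℝ) (Z : C(Torus, ℝ)) : Prop :=
  (∀ x, |Z x| ≤ δ * N) ∧ ∃ Z₁ Z₁' : ℝ → ℝ, (∀ x, HasDerivAt Z₁ (Z₁' x) x) ∧ Continuous Z₁' ∧
    Function.Periodic Z₁ 1 ∧ (∀ x, |Z₁ x| ≤ δ * N) ∧ (∀ x, |Z₁' x| ≤ δ * N) ∧
    ∀ x : ℝ, (q + 1) * χ * (Z (x : Torus) - Z₁ x) ^ 2 ≤ δ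

/-- `energy_le` for the regularized solution. The potential is still that of the true `w + Z`, so
the defect `r - v` collects `w - v`, `Z` and the mean, each at most `δ N`; hence the `3 δ N` there.
-/
theorem energy_le_of_near {q : ℕ} (hq : Even q) {χ δ N 𝔪 ε e : ℝ} (hχ : 0 < χ) (hN : 0 < N)
    (hδ : 0 ≤ δ) (hδ1 : δ ≤ 1 / 500) {w Z ρ G : C(Torus, ℝ)} {n : ℕ}
    (hρ : IsPotential (w + Z) ρ) (hmean : ∫ x, (w + Z) x = 𝔪) (h𝔪 : |𝔪| ≤ δ * N)
    (hZ : Splits q χ δ N Z) (hw : ∀ x, |valleeRe n (funCoeff w) x - w x| ≤ ε) (hε : ε ≤ δ * N)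
    (hG : ∀ x, |valleeRe n (funCoeff G) x
      - χ * ((valleeRe n (funCoeff w) x + Z x) ^ 2 * torusDeriv ρ x)| ≤ e)
    (he : (q + 1) * e ^ 2 ≤ δ * χ * N ^ 4)
    (hNv : lpn (q + 2) (valleeRe n (funCoeff w)) = N) :
    ∫ x, valleeRe n (funCoeff w) x ^ (q + 1) *
      (valleeRe n (derivCoeff (derivCoeff (funCoeff w))) x
        + valleeRe n (derivCoeff (funCoeff G)) x) ≤ -(χ / 8) * N ^ (q + 4) := by
  obtain ⟨bZ, Z₁, Z₁', dZ₁, cZ₁, pZ₁, bZ₁, bZ₁', bZZ⟩ := hZ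
  have hcoe : Continuous (fun x : ℝ => (x : Torus)) := AddCircle.continuous_mk' 1
  rw [integral_torus_eq]
  refine energy_le hq (v := fun x : ℝ => valleeRe n (funCoeff w) (x : Torus))
    (G := fun x : ℝ => valleeRe n (funCoeff G) (x : Torus))
    (P := fun x : ℝ => ρ (x : Torus)) (R := fun x : ℝ => torusDeriv ρ (x : Torus))
    (r := fun x : ℝ => (w + Z) (x : Torus) - 𝔪) (Z := fun x : ℝ => Z (x : Torus)) hχ hN hδ hδ1
    (hasDerivAt_valleeRe n _) (hasDerivAt_valleeRe n _) (by fun_prop) (hasDerivAt_valleeRe n _)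
    (by fun_prop) hρ.hasDerivAt (fun x => by rw [← hmean]; exact hρ.hasDerivAt_torusDeriv x)
    (by fun_prop) dZ₁ cZ₁ (fun x => ?_) (fun x => ?_) (fun x => ?_) (fun x => ?_) (fun x => ?_)
    (fun x => ?_) pZ₁ ?_ (fun x => ?_) (fun x => ?_) (fun x => bZ x) bZ₁ bZ₁' bZZ
  · simp only [AddCircle.coe_add_period]
  · simp only [AddCircle.coe_add_period]
  · simp only [AddCircle.coe_add_period]
  · simp only [AddCircle.coe_add_period]
  · simp only [AddCircle.coe_add_period]
  · simp only [AddCircle.coe_add_period]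
  · rw [← integral_torus_eq (fun x => valleeRe n (funCoeff w) x ^ (q + 2)), ← hNv]
    exact lpn_pow (by omega) (hq.add (by decide)) _
  · have h1 := sq_le_sq' (abs_le.1 (hG x)).1 (abs_le.1 (hG x)).2
    exact (mul_le_mul_of_nonneg_left h1 (by positivity)).trans he
  · have h1 := hw (x : Torus)
    have h2 := bZ (x : Torus)
    change |w (x : Torus) + Z (x : Torus) - 𝔪 - valleeRe n (funCoeff w) (x : Torus)| ≤ _
    rw [abs_le] at *
    constructor <;> linarith [h1.1, h1.2, h2.1, h2.2, h𝔪.1, h𝔪.2]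

/-- As long as the norm stays above `L` on a compact time interval, the inverse square grows at rate
`χ / 4`. The inequality is proved for means of large order and passed to the limit. -/
theorem lpn_decay {q : ℕ} (hq : Even q) {χ δ T 𝔪 L s t : ℝ} (hχ : 0 < χ) (hδ : 0 < δ)
    (hδ1 : δ ≤ 1 / 500) {w Z ρ R G : ℝ → C(Torus, ℝ)} (hw : ContinuousOn w (Ioc 0 T))
    (hZ : ContinuousOn Z (Ioc 0 T)) (hR : ContinuousOn R (Ioc 0 T)) (hG : ContinuousOn G (Ioc 0 T))
    (hρ : ∀ r ∈ Ioc 0 T, IsPotential (w r + Z r) (ρ r))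
    (hRρ : ∀ r ∈ Ioc 0 T, ∀ x, R r x = torusDeriv (ρ r) x)
    (hGR : ∀ r ∈ Ioc 0 T, ∀ x, G r x = χ * ((w r x + Z r x) ^ 2 * R r x))
    (hode : ∀ r ∈ Ioo 0 T, ∀ m, HasDerivAt (fun t => funCoeff (w t) m)
      (derivCoeff (derivCoeff (funCoeff (w r))) m + derivCoeff (funCoeff (G r)) m) r)
    (hmean : ∀ r ∈ Ioc 0 T, ∫ x, (w r + Z r) x = 𝔪) (hL : 0 < L) (h𝔪 : |𝔪| ≤ δ * L)
    (hs : 0 < s) (hst : s ≤ t) (htT : t ≤ T)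
    (hsplit : ∀ r ∈ Icc s t, ∀ N ≥ L, Splits q χ δ N (Z r))
    (hY : ∀ r ∈ Icc s t, L < lpn (q + 2) (w r)) :
    (lpn (q + 2) (w s) ^ 2)⁻¹ + χ / 4 * (t - s) ≤ (lpn (q + 2) (w t) ^ 2)⁻¹ := by
  have hp1 : 1 ≤ q + 2 := by omega
  have hsub : Icc s t ⊆ Ioc 0 T := fun r hr => ⟨hs.trans_le hr.1, hr.2.trans htT⟩
  have hlim : ∀ r ∈ Icc s t,
      Tendsto (fun n => lpn (q + 2) (valleeRe n (funCoeff (w r)))) atTop (𝓝 (lpn (q + 2) (w r))) := by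
    intro r hr
    rw [Metric.tendsto_atTop]
    intro ε hε
    obtain ⟨n₀, hn⟩ := exists_valleeRe_near (I := {r}) isCompact_singleton
      ((hw.mono (singleton_subset_iff.2 (hsub hr)))) (half_pos hε)
    refine ⟨n₀, fun n hn' => ?_⟩
    have h1 := lpn_le_add hp1 _ _ (half_pos hε).le (hn n hn' r rfl)
    have h2 := lpn_le_add hp1 (w r) (valleeRe n (funCoeff (w r))) (half_pos hε).le fun x => by
      rw [abs_sub_comm]; exact hn n hn' r rfl x
    rw [Real.dist_eq, abs_sub_lt_iff]
    constructor <;> linarith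
  have hlim2 : ∀ r ∈ Icc s t, Tendsto (fun n => (lpn (q + 2) (valleeRe n (funCoeff (w r))) ^ 2)⁻¹)
      atTop (𝓝 (lpn (q + 2) (w r) ^ 2)⁻¹) := fun r hr =>
    ((hlim r hr).pow 2).inv₀ (pow_ne_zero 2 (hL.trans (hY r hr)).ne')
  suffices h : ∀ᶠ n in atTop, (lpn (q + 2) (valleeRe n (funCoeff (w s))) ^ 2)⁻¹ + χ / 4 * (t - s)
      ≤ (lpn (q + 2) (valleeRe n (funCoeff (w t))) ^ 2)⁻¹ from
    le_of_tendsto_of_tendsto ((hlim2 s (left_mem_Icc.2 hst)).add_const _)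
      (hlim2 t (right_mem_Icc.2 hst)) h
  -- choice of the regularization
  obtain ⟨r₀, hr₀, hmin⟩ := isCompact_Icc.exists_isMinOn (nonempty_Icc.2 hst)
    ((continuous_lpn hp1).comp_continuousOn (hw.mono hsub))
  have hgap : 0 < lpn (q + 2) (w r₀) - L := sub_pos.2 (hY r₀ hr₀)
  obtain ⟨B₁, hB₁⟩ := isCompact_Icc.exists_bound_of_continuousOn (hw.mono hsub)
  obtain ⟨B₂, hB₂⟩ := isCompact_Icc.exists_bound_of_continuousOn (hZ.mono hsub)
  obtain ⟨B₃, hB₃⟩ := isCompact_Icc.exists_bound_of_continuousOn (hR.mono hsub)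
  have hB₁0 : 0 ≤ B₁ := (norm_nonneg _).trans (hB₁ r₀ hr₀)
  have hB₂0 : 0 ≤ B₂ := (norm_nonneg _).trans (hB₂ r₀ hr₀)
  have hB₃0 : 0 ≤ B₃ := (norm_nonneg _).trans (hB₃ r₀ hr₀)
  -- The flux error allowed by the energy estimate; `e ≤ 1` gives `e² ≤ e`, so a bound linear in `e`
  -- suffices.
  set e : ℝ := min 1 (δ * χ * L ^ 4 / (q + 1)) with he
  have he0 : 0 < e := lt_min one_pos (by positivity)
  have heL : (q + 1) * e ^ 2 ≤ δ * χ * L ^ 4 := by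
    have h1 : e ^ 2 ≤ e := by
      have : e ≤ 1 := min_le_left _ _
      nlinarith
    have h2 : e ≤ δ * χ * L ^ 4 / (q + 1) := min_le_right _ _
    rw [le_div_iff₀ (by positivity)] at h2
    nlinarith [(q.cast_nonneg : (0 : ℝ) ≤ q)]
  set D : ℝ := χ * (B₃ * (2 * B₁ + 2 * B₂ + 1)) + 1 with hD
  have hD0 : 0 < D := by positivity
  -- The four bounds keep the norm of the mean at least `L`, make `|w - v| ≤ δ L`, bound `v` by `B₁
  -- + 1`, and keep the flux perturbation below `e / 2`.
  set ε : ℝ := min (min (lpn (q + 2) (w r₀) - L) (δ * L)) (min 1 (e / 2 / D)) with hεd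
  have hε0 : 0 < ε := lt_min (lt_min hgap (by positivity)) (lt_min one_pos (by positivity))
  have hε1 : ε ≤ lpn (q + 2) (w r₀) - L := (min_le_left _ _).trans (min_le_left _ _)
  have hε2 : ε ≤ δ * L := (min_le_left _ _).trans (min_le_right _ _)
  have hε3 : ε ≤ 1 := (min_le_right _ _).trans (min_le_left _ _)
  have hε4 : ε * D ≤ e / 2 := by
    rw [← le_div_iff₀ hD0]; exact (min_le_right _ _).trans (min_le_right _ _)
  obtain ⟨n₁, hn₁⟩ := exists_valleeRe_near isCompact_Icc (hw.mono hsub) hε0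
  obtain ⟨n₂, hn₂⟩ := exists_valleeRe_near isCompact_Icc (hG.mono hsub) (half_pos he0)
  filter_upwards [eventually_ge_atTop n₁, eventually_ge_atTop n₂] with n h₁ h₂
  have hv := hn₁ n h₁
  have hGn := hn₂ n h₂
  have hNL : ∀ r ∈ Icc s t, L ≤ lpn (q + 2) (valleeRe n (funCoeff (w r))) := fun r hr => by
    have h3 := lpn_le_add hp1 (w r) (valleeRe n (funCoeff (w r))) hε0.le fun x => by
      rw [abs_sub_comm]; exact hv r hr x
    have h4 : lpn (q + 2) (w r₀) ≤ lpn (q + 2) (w r) := hmin hr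
    linarith
  have hflux : ∀ r ∈ Icc s t, ∀ x, |valleeRe n (funCoeff (G r)) x
      - χ * ((valleeRe n (funCoeff (w r)) x + Z r x) ^ 2 * torusDeriv (ρ r) x)| ≤ e := by
    intro r hr x
    have a1 := hGn r hr x
    rw [hGR r (hsub hr)] at a1
    rw [← hRρ r (hsub hr)]
    set v := valleeRe n (funCoeff (w r)) x with hvd
    have a2 : |v - w r x| ≤ ε := hv r hr x
    have a3 : |w r x| ≤ B₁ := ((w r).norm_coe_le_norm x).trans (hB₁ r hr)
    have a4 : |Z r x| ≤ B₂ := ((Z r).norm_coe_le_norm x).trans (hB₂ r hr)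
    have a5 : |R r x| ≤ B₃ := ((R r).norm_coe_le_norm x).trans (hB₃ r hr)
    have a6 : |v + w r x + 2 * Z r x| ≤ 2 * B₁ + 2 * B₂ + 1 := by
      rw [abs_le] at *
      constructor <;> linarith [a2.1, a2.2, a3.1, a3.2, a4.1, a4.2]
    have a7 : |χ * ((w r x + Z r x) ^ 2 * R r x) - χ * ((v + Z r x) ^ 2 * R r x)| ≤ e / 2 := by
      have : χ * ((w r x + Z r x) ^ 2 * R r x) - χ * ((v + Z r x) ^ 2 * R r x)
          = -((v - w r x) * (χ * (R r x * (v + w r x + 2 * Z r x)))) := by ring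
      rw [this, abs_neg, abs_mul, abs_mul, abs_mul, abs_of_pos hχ]
      calc _ ≤ ε * (χ * (B₃ * (2 * B₁ + 2 * B₂ + 1))) := by gcongr
        _ ≤ ε * D := by gcongr; rw [hD]; linarith
        _ ≤ e / 2 := hε4
    have := abs_add_le (valleeRe n (funCoeff (G r)) x - χ * ((w r x + Z r x) ^ 2 * R r x))
      (χ * ((w r x + Z r x) ^ 2 * R r x) - χ * ((v + Z r x) ^ 2 * R r x))
    rw [sub_add_sub_cancel] at this
    linarith
  -- the differential inequality
  have hwc := continuousOn_funCoeff hw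
  have c0 := continuousOn_valleeRe n hwc
  have c2 := continuousOn_valleeRe n (continuousOn_derivCoeff (continuousOn_derivCoeff hwc))
  have c3 := continuousOn_valleeRe n (continuousOn_derivCoeff (continuousOn_funCoeff hG))
  set F : ℝ → Torus → ℝ := fun r x => valleeRe n (funCoeff (w r)) x ^ (q + 2) with hF
  set F' : ℝ → Torus → ℝ := fun r x => (q + 2) * (valleeRe n (funCoeff (w r)) x ^ (q + 1) *
    (valleeRe n (derivCoeff (derivCoeff (funCoeff (w r)))) x
      + valleeRe n (derivCoeff (funCoeff (G r))) x)) with hF'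
  have hFc : ContinuousOn (fun p : ℝ × Torus => F p.1 p.2) (Ioc 0 T ×ˢ univ) := c0.pow _
  have hFc' : ContinuousOn (fun p : ℝ × Torus => F' p.1 p.2) (Ioc 0 T ×ˢ univ) :=
    continuousOn_const.mul ((c0.pow _).mul (c2.add c3))
  have hFd : ∀ r ∈ Ioo 0 T, ∀ x, HasDerivAt (fun s => F s x) (F' r x) r := fun r hr x => by
    have h1 := (hasDerivAt_valleeRe_time n (hode r hr) x).fun_pow (q + 2)
    refine h1.congr_deriv ?_
    have : valleeRe n (fun m => derivCoeff (derivCoeff (funCoeff (w r))) m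
        + derivCoeff (funCoeff (G r)) m) x = valleeRe n (derivCoeff (derivCoeff (funCoeff (w r)))) x
      + valleeRe n (derivCoeff (funCoeff (G r))) x := by
      change (vallee n _ x).re = _
      rw [vallee_add]; rfl
    rw [this, hF']
    push_cast
    ring
  have hyN : ∀ r, ∫ x, F r x = lpn (q + 2) (valleeRe n (funCoeff (w r))) ^ (q + 2) := fun r =>
    (lpn_pow (by omega) (hq.add (by decide)) _).symm
  have hNpos : ∀ r ∈ Icc s t, 0 < lpn (q + 2) (valleeRe n (funCoeff (w r))) := fun r hr =>
    hL.trans_le (hNL r hr)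
  have main := rpow_neg_ge_of_deriv_le (p := q + 2) (χ := χ) (by omega) hst
    (y := fun r => ∫ x, F r x) (y' := fun r => ∫ x, F' r x) ?_ ?_ ?_ ?_
  · have conv : ∀ r ∈ Icc s t, (∫ x, F r x) ^ (-(2 : ℝ) / (q + 2 : ℕ))
        = (lpn (q + 2) (valleeRe n (funCoeff (w r))) ^ 2)⁻¹ := fun r hr => by
      have h0 := hNpos r hr
      rw [hyN, ← Real.rpow_natCast, ← Real.rpow_mul h0.le, mul_div_cancel₀ _ (by positivity),
        Real.rpow_neg h0.le, Real.rpow_two]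
    rwa [conv s (left_mem_Icc.2 hst), conv t (right_mem_Icc.2 hst)] at main
  · exact (continuousOn_integral_of_compact_support isCompact_univ hFc
      fun _ x _ hx => absurd (mem_univ x) hx).mono hsub
  · intro r hr
    have := hNpos r hr
    rw [hyN]; positivity
  · exact fun r hr => hasDerivAt_integral_torus hFc hFc' hFd
      ⟨hs.trans hr.1, hr.2.trans_le htT⟩
  · intro r hr
    have hr' := Ioo_subset_Icc_self hr
    have h0 := hNpos r hr'
    have hLN := hNL r hr'
    have hδLN : δ * L ≤ δ * lpn (q + 2) (valleeRe n (funCoeff (w r))) := by gcongr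
    have h1 := energy_le_of_near hq hχ h0 hδ.le hδ1 (hρ r (hsub hr')) (hmean r (hsub hr'))
      (h𝔪.trans hδLN) (hsplit r hr' _ hLN) (hv r hr') (hε2.trans hδLN) (hflux r hr')
      (heL.trans (by gcongr)) rfl
    have h2 : ((∫ x, F r x) ^ (((q + 2 : ℕ) + 2 : ℝ) / (q + 2 : ℕ)))
        = lpn (q + 2) (valleeRe n (funCoeff (w r))) ^ (q + 4) := by
      rw [hyN, ← Real.rpow_natCast, ← Real.rpow_mul h0.le, mul_div_cancel₀ _ (by positivity),
        ← Real.rpow_natCast]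
      congr 1
      push_cast; ring
    rw [h2]
    simp only [hF']
    rw [integral_const_mul]
    have h3 : (0 : ℝ) < q + 2 := by positivity
    push_cast
    calc _ ≤ (q + 2 : ℝ) * (-(χ / 8) * lpn (q + 2) (valleeRe n (funCoeff (w r))) ^ (q + 4)) := by
          gcongr
      _ = _ := by ring

/-! ### Thresholds -/

theorem exists_dyadic_ge (N : ℝ) : ∃ J : ℕ, N ≤ 2 ^ J ∧ (J = 0 ∨ (2 : ℝ) ^ J ≤ 2 * N) := by
  rcases le_total N 1 with h | h
  · exact ⟨0, by simpa using h, Or.inl rfl⟩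
  · obtain ⟨J, h1, h2⟩ := exists_nat_pow_near h one_lt_two
    exact ⟨J + 1, h2.le, Or.inr (by rw [pow_succ]; linarith)⟩

/-- The cut is at `2 ^ J ≈ N`. The remainder is then of size `N ^ (-a) z` and the derivative of the
low part of size `N ^ (1 - a) z`, so `N ^ a ≥ C₁ A z` handles both. The condition `C₁ z ≤ N` serves
the sup bounds and the case `J = 0`. -/
theorem exists_splits {a δ : ℝ} (ha : 0 < a) (ha1 : a < 1) (hδ : 0 < δ) (hδ1 : δ ≤ 1) :
    ∃ C₁ : ℝ, 0 < C₁ ∧ ∀ (q : ℕ) (χ A z N : ℝ) (Z : C(Torus, ℝ)), 0 < χ → χ ≤ A → (q : ℝ) + 1 ≤ A →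
      0 < N → 0 ≤ z → besovNorm a (funCoeff Z) ≤ ENNReal.ofReal z → C₁ * z ≤ N →
      C₁ * A * z ≤ N ^ a → Splits q χ δ N Z := by
  obtain ⟨K, hK, hdec⟩ := exists_lp_decomposition ha ha1
  refine ⟨3 * K / δ, by positivity, fun q χ A z N Z hχ hχA hqA hN hz hZ h1 h2 => ?_⟩
  obtain ⟨bZ, hJ⟩ := hdec Z z hz hZ
  obtain ⟨J, hJN, hJ2⟩ := exists_dyadic_ge N
  obtain ⟨g, g', hd, hc, hp, bg, bZg, bg'⟩ := hJ J
  have hA : 1 ≤ A := le_trans (by linarith [(q.cast_nonneg : (0 : ℝ) ≤ q)]) hqA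
  have hA0 : 0 < A := by linarith
  have hKz : 3 * K * z ≤ δ * N := by
    have : 3 * K * z = δ * (3 * K / δ * z) := by field_simp
    rw [this]; gcongr
  have hKAz : 3 * K * (A * z) ≤ δ * N ^ a := by
    have : 3 * K * (A * z) = δ * (3 * K / δ * A * z) := by field_simp
    rw [this]; gcongr
  have hKz2 : 3 * K * z ≤ δ * N ^ a := by
    refine le_trans ?_ hKAz
    gcongr
    exact le_mul_of_one_le_left hz hA
  have hKz0 : 0 ≤ K * z := by positivity
  have hpow : ∀ b : ℝ, ((2 : ℝ) ^ b) ^ J = ((2 : ℝ) ^ J) ^ b := fun b => by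
    rw [← Real.rpow_natCast, ← Real.rpow_mul two_pos.le, mul_comm, Real.rpow_mul two_pos.le,
      Real.rpow_natCast]
  refine ⟨fun x => (bZ x).trans (by linarith), g, g', hd, hc, hp,
    fun x => (bg x).trans (by linarith), fun x => (bg' x).trans ?_, fun x => ?_⟩
  · rw [hpow]
    rcases hJ2 with rfl | hJ2
    · simp only [pow_zero, Real.one_rpow, mul_one]; linarith
    · have e1 : ((2 : ℝ) ^ J) ^ (1 - a) ≤ 2 * N ^ (1 - a) := by
        calc ((2 : ℝ) ^ J) ^ (1 - a) ≤ (2 * N) ^ (1 - a) :=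
              Real.rpow_le_rpow (by positivity) hJ2 (by linarith)
          _ = 2 ^ (1 - a) * N ^ (1 - a) := Real.mul_rpow two_pos.le hN.le
          _ ≤ 2 ^ (1 : ℝ) * N ^ (1 - a) := by
              gcongr
              · norm_num
              · linarith
          _ = 2 * N ^ (1 - a) := by rw [Real.rpow_one]
      have e2 : N ^ a * N ^ (1 - a) = N := by
        rw [← Real.rpow_add hN, add_sub_cancel, Real.rpow_one]
      calc K * ((2 : ℝ) ^ J) ^ (1 - a) * z ≤ K * (2 * N ^ (1 - a)) * z := by gcongr
        _ = 2 * (K * z) * N ^ (1 - a) := by ring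
        _ ≤ (δ * N ^ a) * N ^ (1 - a) :=
            mul_le_mul_of_nonneg_right (by linarith) (by positivity)
        _ = δ * N := by rw [mul_assoc, e2]
  · have e1 : ((2 : ℝ) ^ (-a)) ^ J ≤ N ^ (-a) := by
      rw [hpow]
      exact Real.rpow_le_rpow_of_nonpos hN hJN (by linarith)
    have e2 : N ^ a * N ^ (-a) = 1 := by
      rw [← Real.rpow_add hN, add_neg_cancel, Real.rpow_zero]
    have e3 : A * |Z (x : Torus) - g x| ≤ δ := by
      calc A * |Z (x : Torus) - g x| ≤ A * (K * N ^ (-a) * z) := by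
            gcongr
            refine (bZg x).trans ?_
            gcongr
        _ = K * (A * z) * N ^ (-a) := by ring
        _ ≤ (δ * N ^ a) * N ^ (-a) := by
            have : 0 ≤ K * (A * z) := by positivity
            exact mul_le_mul_of_nonneg_right (by linarith) (by positivity)
        _ = δ := by rw [mul_assoc, e2, mul_one]
    calc (q + 1) * χ * (Z (x : Torus) - g x) ^ 2 ≤ A * A * (Z (x : Torus) - g x) ^ 2 := by gcongr
      _ = (A * |Z (x : Torus) - g x|) ^ 2 := by rw [mul_pow, sq_abs]; ring
      _ ≤ δ ^ 2 := by gcongr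
      _ ≤ δ := by nlinarith

/-- For `N ≥ 1` the bound on `N ^ a` implies the linear one. For `N ≤ 1` the linear bound comes from
the other threshold, `N² χ t / 4 ≥ 1`, together with `χ t ≤ A T`; this is the source of the
dependence of the constant on `T`. -/
theorem threshold_le {a T C₁ χ A z N t γ : ℝ} (ha : 0 < a) (ha1 : a < 1) (hT : 0 < T) (hC₁ : 0 < C₁)
    (hA : 1 ≤ A) (hχ : 0 < χ) (hχA : χ ≤ A) (hz : 0 ≤ z) (ht : 0 < t) (htT : t ≤ T)
    (hγ : 1 ≤ a * γ) (h0 : (χ * t / 4) ^ (-(1 / 2) : ℝ) ≤ N) {C : ℝ} (hC0 : 0 < C)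
    (hC : C₁ * (1 + T / 4) ≤ C ^ a) (h1 : C * A ^ γ * z ^ (1 / a) ≤ N) :
    C₁ * z ≤ N ∧ C₁ * A * z ≤ N ^ a := by
  have hA0 : 0 < A := by linarith
  have hl : 0 < (χ * t / 4) ^ (-(1 / 2) : ℝ) := by positivity
  have hN : 0 < N := hl.trans_le h0
  have key : C₁ * (1 + T / 4) * A * z ≤ N ^ a := by
    calc C₁ * (1 + T / 4) * A * z ≤ C ^ a * A ^ (γ * a) * z := by
          gcongr
          calc A = A ^ (1 : ℝ) := (Real.rpow_one A).symm
            _ ≤ A ^ (γ * a) := Real.rpow_le_rpow_of_exponent_le hA (by linarith)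
      _ = (C * A ^ γ * z ^ (1 / a)) ^ a := by
          rw [Real.mul_rpow (by positivity) (by positivity), Real.mul_rpow hC0.le (by positivity),
            ← Real.rpow_mul hA0.le, ← Real.rpow_mul hz, one_div, inv_mul_cancel₀ ha.ne',
            Real.rpow_one]
      _ ≤ N ^ a := Real.rpow_le_rpow (by positivity) h1 ha.le
  have hCAz : 0 ≤ C₁ * A * z := by positivity
  have key2 : C₁ * A * z * (1 + T / 4) ≤ N ^ a := by linarith
  have h2 : C₁ * A * z ≤ N ^ a := by nlinarith
  refine ⟨?_, h2⟩
  rcases le_total 1 N with hN1 | hN1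
  · calc C₁ * z ≤ C₁ * z * A := le_mul_of_one_le_right (by positivity) hA
      _ = C₁ * A * z := by ring
      _ ≤ N ^ a := h2
      _ ≤ N ^ (1 : ℝ) := Real.rpow_le_rpow_of_exponent_le hN1 ha1.le
      _ = N := Real.rpow_one N
  · have e1 : 1 ≤ N ^ 2 * (χ * t / 4) := by
      have h3 : ((χ * t / 4) ^ (-(1 / 2) : ℝ)) ^ 2 = (χ * t / 4)⁻¹ := by
        rw [← Real.rpow_natCast, ← Real.rpow_mul (by positivity), ← Real.rpow_neg_one]
        norm_num
      have h4 : (χ * t / 4)⁻¹ ≤ N ^ 2 := by rw [← h3]; gcongr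
      rwa [inv_le_iff_one_le_mul₀ (by positivity)] at h4
    have e2 : χ * t / 4 ≤ A * (1 + T / 4) := by
      have : χ * t ≤ A * T := by gcongr
      linarith
    have e3 : N ^ a ≤ 1 := Real.rpow_le_one hN.le hN1 ha.le
    have e4 : 0 < A * (1 + T / 4) := by positivity
    refine le_of_mul_le_mul_right ?_ e4
    calc C₁ * z * (A * (1 + T / 4)) = C₁ * A * z * (1 + T / 4) := by ring
      _ ≤ N ^ 2 * (χ * t / 4) := by linarith
      _ ≤ N ^ 2 * (A * (1 + T / 4)) := by gcongr
      _ ≤ N * (A * (1 + T / 4)) := by gcongr; nlinarith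

/-! ### Mild solutions -/

theorem MemWeighted.exists_bound {η T a : ℝ} (hη : 0 < η) (hT : 0 < T) (ha : 0 < a) (ha1 : a < 1)
    {w : ℝ → C(Torus, ℝ)} (h : MemWeighted η T a w) :
    ∃ B : ℝ, 0 < B ∧ ∀ s ∈ Ioc 0 T, ∀ x, |w s x| ≤ B * s ^ (-η) := by
  obtain ⟨K, hK, hK2⟩ := exists_lp_decomposition ha ha1
  set S := (⨆ t ∈ Ioc 0 T, ENNReal.ofReal (min (t ^ η) 1) * besovNorm a (funCoeff (w t))) with hS
  -- Converts the weight `t ^ η ∧ 1` into `t ^ η` on `(0, T]`.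
  set κ : ℝ := min 1 (T ^ (-η)) with hκ
  have hκ0 : 0 < κ := lt_min one_pos (by positivity)
  refine ⟨K * S.toReal / κ + 1, by positivity, fun s hs x => ?_⟩
  have hs0 : 0 < s := hs.1
  have hsη : 0 < s ^ η := by positivity
  have h1 : ENNReal.ofReal (min (s ^ η) 1) * besovNorm a (funCoeff (w s)) ≤ S :=
    le_iSup₂ (f := fun t (_ : t ∈ Ioc 0 T) =>
      ENNReal.ofReal (min (t ^ η) 1) * besovNorm a (funCoeff (w t))) s hs
  have hm : 0 < min (s ^ η) 1 := lt_min hsη one_pos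
  have hκs : κ * s ^ η ≤ min (s ^ η) 1 := by
    refine le_min (mul_le_of_le_one_left hsη.le (min_le_left _ _)) ?_
    calc κ * s ^ η ≤ T ^ (-η) * T ^ η := by
          gcongr
          · exact min_le_right _ _
          · exact hs.2
      _ = 1 := by rw [← Real.rpow_add hT, neg_add_cancel, Real.rpow_zero]
  have h2 : besovNorm a (funCoeff (w s)) ≤ ENNReal.ofReal (S.toReal / min (s ^ η) 1) := by
    rw [ENNReal.ofReal_div_of_pos hm, ENNReal.ofReal_toReal h.2.ne,
      ENNReal.le_div_iff_mul_le (Or.inl (ENNReal.ofReal_pos.2 hm).ne')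
        (Or.inl ENNReal.ofReal_ne_top), mul_comm]
    exact h1
  refine ((hK2 (w s) _ (by positivity) h2).1 x).trans ?_
  calc K * (S.toReal / min (s ^ η) 1) ≤ K * (S.toReal / (κ * s ^ η)) := by gcongr
    _ = K * S.toReal / κ * s ^ (-η) := by rw [Real.rpow_neg hs0.le]; field_simp
    _ ≤ _ := by gcongr; linarith

/-- The derivative of a potential as a continuous function. -/
def IsPotential.derivMap {f ρ : C(Torus, ℝ)} (h : IsPotential f ρ) : C(Torus, ℝ) :=
  ⟨torusDeriv ρ, h.continuous_torusDeriv⟩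

theorem IsPotential.dist_derivMap_le {f g ρ σ : C(Torus, ℝ)} (h : IsPotential f ρ)
    (h' : IsPotential g σ) : dist h.derivMap h'.derivMap ≤ 2 * dist f g := by
  rw [ContinuousMap.dist_le (by positivity)]
  intro x
  obtain ⟨h1, h2⟩ := h.sub h'
  have h3 := h1.abs_torusDeriv_le_of_bound (M := dist f g) (fun y => by
    rw [ContinuousMap.sub_apply, ← Real.dist_eq]; exact ContinuousMap.dist_apply_le_dist y) x
  rw [h2] at h3
  exact h3

/-- A mild solution has a continuous flux, which drives the evolution of its Fourier
coefficients. -/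
theorem IsMildSolution.exists_flux {α η T χ : ℝ} (hα : 0 < α) (hα1 : α < 1) (hη : 0 < η)
    (hη1 : η < 1 / 4) (hT : 0 < T) (hχ : 0 < χ) {ζ : TorusDistribution} {Z w : ℝ → C(Torus, ℝ)}
    (hZ : ContPath (Icc 0 T) α Z) (h : IsMildSolution α η T χ ζ Z w) :
    ∃ ρ R G : ℝ → C(Torus, ℝ), ContinuousOn R (Ioc 0 T) ∧ ContinuousOn G (Ioc 0 T) ∧
      (∀ r ∈ Ioc 0 T, IsPotential (w r + Z r) (ρ r)) ∧
      (∀ r ∈ Ioc 0 T, ∀ x, R r x = torusDeriv (ρ r) x) ∧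
      (∀ r ∈ Ioc 0 T, ∀ x, G r x = χ * ((w r x + Z r x) ^ 2 * R r x)) ∧
      (∀ r ∈ Ioo 0 T, ∀ m, HasDerivAt (fun t => funCoeff (w t) m)
        (derivCoeff (derivCoeff (funCoeff (w r))) m + derivCoeff (funCoeff (G r)) m) r) ∧
      ∀ r ∈ Ioc 0 T, ∫ x, w r x = ζ.mean := by
  obtain ⟨ρ, hρ, hmild⟩ := h.mild
  have hwc := h.mem.1.continuousOn hα hα1
  have hZc := hZ.continuousOn hα hα1
  have huc : ContinuousOn (fun r => w r + Z r) (Ioc 0 T) := hwc.add (hZc.mono Ioc_subset_Icc_self)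
  obtain ⟨Bw, hBw, hw⟩ := h.mem.exists_bound hη hT hα hα1
  obtain ⟨Bz, hBz⟩ := isCompact_Icc.exists_bound_of_continuousOn hZc
  have hBz0 : 0 ≤ Bz := (norm_nonneg _).trans (hBz 0 ⟨le_rfl, hT.le⟩)
  classical
  set R : ℝ → C(Torus, ℝ) := fun r => if hr : r ∈ Ioc 0 T then (hρ r hr).derivMap else 0 with hR
  have hRr : ∀ r (hr : r ∈ Ioc 0 T), R r = (hρ r hr).derivMap := fun r hr => dif_pos hr
  set G : ℝ → C(Torus, ℝ) := fun r => χ • ((w r + Z r) ^ 2 * R r) with hG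
  have hRc : ContinuousOn R (Ioc 0 T) := by
    intro r hr
    refine tendsto_iff_dist_tendsto_zero.2 ?_
    have h1 : Tendsto (fun s => 2 * dist (w s + Z s) (w r + Z r)) (𝓝[Ioc 0 T] r) (𝓝 0) := by
      have := (tendsto_iff_dist_tendsto_zero.1 (huc r hr)).const_mul 2
      rwa [mul_zero] at this
    refine squeeze_zero' (Eventually.of_forall fun _ => dist_nonneg) ?_ h1
    filter_upwards [self_mem_nhdsWithin] with s hs
    rw [hRr s hs, hRr r hr]
    exact (hρ s hs).dist_derivMap_le (hρ r hr)
  have hGc : ContinuousOn G (Ioc 0 T) := ((huc.pow 2).mul hRc).const_smul χ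
  have hGr : ∀ r x, G r x = χ * ((w r x + Z r x) ^ 2 * R r x) := fun r x => rfl
  set B : ℝ := Bw + Bz * T ^ η with hB
  have hB0 : 0 < B := by positivity
  have hu : ∀ r ∈ Ioc 0 T, ∀ x, |w r x + Z r x| ≤ B * r ^ (-η) := fun r hr x => by
    have h1 := hw r hr x
    have h2 : |Z r x| ≤ Bz := ((Z r).norm_coe_le_norm x).trans (hBz r (Ioc_subset_Icc_self hr))
    have h3 : 1 ≤ T ^ η * r ^ (-η) := by
      rw [Real.rpow_neg hr.1.le, ← div_eq_mul_inv, one_le_div (Real.rpow_pos_of_pos hr.1 _)]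
      exact Real.rpow_le_rpow hr.1.le hr.2 hη.le
    calc |w r x + Z r x| ≤ |w r x| + |Z r x| := abs_add_le _ _
      _ ≤ Bw * r ^ (-η) + Bz * (T ^ η * r ^ (-η)) :=
          add_le_add h1 (h2.trans (le_mul_of_one_le_right hBz0 h3))
      _ = B * r ^ (-η) := by rw [hB]; ring
  -- The flux is cubic in `w + Z`, so it blows up like `r ^ (-3η)`, which is integrable because `η <
  -- 1/4`.
  have hGB : ∀ r ∈ Ioc 0 T, ∀ x, |G r x| ≤ (2 * χ * B ^ 3) * r ^ (-(3 * η)) := fun r hr x => by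
    have h1 := hu r hr x
    have h2 : |R r x| ≤ 2 * (B * r ^ (-η)) := by
      rw [hRr r hr]
      exact (hρ r hr).abs_torusDeriv_le_of_bound (fun y => hu r hr y) x
    have h3 : r ^ (-(3 * η)) = (r ^ (-η)) ^ 3 := by
      rw [← Real.rpow_natCast, ← Real.rpow_mul hr.1.le]
      congr 1; push_cast; ring
    have hr0 : 0 ≤ r ^ (-η) := Real.rpow_nonneg hr.1.le _
    rw [hGr, abs_mul, abs_mul, abs_pow, abs_of_pos hχ, h3]
    calc χ * (|w r x + Z r x| ^ 2 * |R r x|)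
        ≤ χ * ((B * r ^ (-η)) ^ 2 * (2 * (B * r ^ (-η)))) := by gcongr
      _ = _ := by ring
  have hw2 : ∀ t ∈ Ioc 0 T, ∀ x, w t x = heat t ζ.coeff x
      + ∫ s in 0..t, heat (t - s) (derivCoeff (funCoeff (G s))) x := fun t ht x => by
    rw [hmild t ht x, intervalIntegral.integral_of_le ht.1.le,
      intervalIntegral.integral_of_le ht.1.le]
    congr 1
    refine setIntegral_congr_fun measurableSet_Ioc fun s hs => ?_
    have e : (fun y => χ * ((w s y + Z s y) ^ 2 * torusDeriv (ρ s) y)) = G s := by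
      funext y
      rw [hGr, hRr s ⟨hs.1, hs.2.trans ht.2⟩]
      rfl
    simp only [e]
  refine ⟨ρ, R, G, hRc, hGc, hρ, fun r hr x => by rw [hRr r hr]; rfl, fun r _ x => hGr r x,
    fun r hr m => ?_, fun r hr => ?_⟩
  · exact hasDerivAt_funCoeff_of_mild (by positivity) (by linarith) (by positivity) hGc hGB hr hw2 m
  · exact integral_of_mild (by positivity) (by linarith) (by positivity) hGc hGB hr (hw2 r hr)

/-- Suppose `Y t > L`. If `Y > L` on all of `(0, t]`, the growth of `Y⁻²` from times near `0`
contradicts `Y t > (χ t / 4) ^ (-1/2)`. Otherwise `Y` cannot have climbed from `L` to `Y t` since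
the last time it was at most `L`. No control of `Y` at time `0` is needed. -/
theorem le_threshold_of_decay {χ L t : ℝ} (hχ : 0 < χ) (hL : 0 < L) (ht : 0 < t)
    (hLt : (χ * t / 4) ^ (-(1 / 2) : ℝ) ≤ L) {Y : ℝ → ℝ} (hY : ContinuousOn Y (Ioc 0 t))
    (hdecay : ∀ s ∈ Ioc 0 t, (∀ r ∈ Icc s t, L < Y r) →
      (Y s ^ 2)⁻¹ + χ / 4 * (t - s) ≤ (Y t ^ 2)⁻¹) : Y t ≤ L := by
  by_contra! hlt
  have hYt : 0 < Y t := hL.trans hlt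
  by_cases hall : ∀ r ∈ Ioc 0 t, L < Y r
  · have h1 : (Y t ^ 2)⁻¹ < χ * t / 4 := by
      have h3 : ((χ * t / 4) ^ (-(1 / 2) : ℝ)) ^ 2 = (χ * t / 4)⁻¹ := by
        rw [← Real.rpow_natCast, ← Real.rpow_mul (by positivity), ← Real.rpow_neg_one]
        norm_num
      rw [inv_lt_comm₀ (by positivity) (by positivity), ← h3]
      exact pow_lt_pow_left₀ (hLt.trans_lt hlt) (by positivity) two_ne_zero
    set g := χ * t / 4 - (Y t ^ 2)⁻¹ with hg
    have hg0 : 0 < g := sub_pos.2 h1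
    -- Starting at `s > 0` loses `χ s / 4 ≤ g / 2`, less than the gap `g`.
    set s := min t (2 * g / χ) with hs
    have hs0 : 0 < s := lt_min ht (by positivity)
    have hst : s ≤ t := min_le_left _ _
    have h2 := hdecay s ⟨hs0, hst⟩ fun r hr => hall r ⟨hs0.trans_le hr.1, hr.2⟩
    have h4 : χ * s ≤ 2 * g := by
      have : s ≤ 2 * g / χ := min_le_right _ _
      rw [le_div_iff₀ hχ] at this
      linarith
    have h5 : 0 ≤ (Y s ^ 2)⁻¹ := by positivity
    linarith
  · push Not at hall
    obtain ⟨s₁, hs₁, hYs₁⟩ := hall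
    have hsub : Icc s₁ t ⊆ Ioc 0 t := fun r hr => ⟨hs₁.1.trans_le hr.1, hr.2⟩
    have hcl : IsCompact (Icc s₁ t ∩ Y ⁻¹' Iic L) :=
      isCompact_Icc.of_isClosed_subset ((hY.mono hsub).preimage_isClosed_of_isClosed isClosed_Icc
        isClosed_Iic) inter_subset_left
    -- The last time `a` at which `Y ≤ L`. Decay on `[s, t]` for every `s > a` gives `Y t ≤ Y s`,
    -- and `s → a` gives `Y t ≤ Y a ≤ L`.
    obtain ⟨a, ⟨haI, haL⟩, hmax⟩ := hcl.exists_isGreatest ⟨s₁, ⟨le_rfl, hs₁.2⟩, hYs₁⟩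
    have haL' : Y a ≤ L := haL
    have hat : a < t := lt_of_le_of_ne haI.2 fun h => by rw [h] at haL'; linarith
    have hab : ∀ s ∈ Ioc a t, L < Y s := fun s hs => by
      by_contra! hle
      exact absurd (hmax ⟨⟨haI.1.trans hs.1.le, hs.2⟩, hle⟩) (not_le.2 hs.1)
    have hle : ∀ s ∈ Ioc a t, Y t ≤ Y s := fun s hs => by
      have h1 := hdecay s ⟨(hsub haI).1.trans hs.1, hs.2⟩ fun r hr =>
        hab r ⟨hs.1.trans_le hr.1, hr.2⟩
      have hYs : 0 < Y s := hL.trans (hab s hs)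
      have h2 : 0 ≤ χ / 4 * (t - s) := mul_nonneg (by positivity) (by linarith [hs.2])
      have h3 : (Y s ^ 2)⁻¹ ≤ (Y t ^ 2)⁻¹ := by linarith
      rw [inv_le_inv₀ (by positivity) (by positivity)] at h3
      exact (pow_le_pow_iff_left₀ hYt.le hYs.le two_ne_zero).1 h3
    have hlim : Tendsto Y (𝓝[Ioc a t] a) (𝓝 (Y a)) :=
      (hY a (hsub haI)).mono_left (nhdsWithin_mono a fun s hs => hsub ⟨haI.1.trans hs.1.le, hs.2⟩)
    have : (𝓝[Ioc a t] a).NeBot := by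
      rw [nhdsWithin_Ioc_eq_nhdsGT hat]; infer_instance
    have : Y t ≤ Y a := ge_of_tendsto hlim (by
      filter_upwards [self_mem_nhdsWithin] with s hs using hle s hs)
    linarith

end Chemo

end

/-! ### The a priori bound -/

theorem mainTheorem3 (α₀ α η T : ℝ) (hα₀ : -(1 / 2) < α₀ ∧ α₀ < 0)
    (hα : 0 < α ∧ α < α₀ + 1 / 2) (hη : (α - α₀) / 2 < η ∧ η < 1 / 4) (hT : 0 < T) :
    ∃ C : ℝ, 0 < C ∧
      ∀ (p : ℕ) (χ 𝔪 : ℝ) (ζ : Chemo.TorusDistribution) (Z w : ℝ → C(Chemo.Torus, ℝ)),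
        2 ≤ p → Even p → 0 < χ → (𝔪 = 0 ∨ 𝔪 = 1) →
        Chemo.MemHolderBesov α₀ ζ.coeff → ζ.mean = 𝔪 →
        Chemo.ContPath (Icc 0 T) α Z → (∀ t ∈ Icc 0 T, ∫ x, Z t x = 0) →
        Chemo.IsMildSolution α η T χ ζ Z w →
        ∀ t ∈ Ioc 0 T,
          eLpNorm (w t) (p : ℝ≥0∞) volume ≤
            max (ENNReal.ofReal ((χ * t / 4) ^ (-(1 / 2) : ℝ)))
              (max
                (ENNReal.ofReal (C * (max (p : ℝ) χ) ^
                    (((p : ℝ) * (1 + α) + 2 + α) / (α * ((p : ℝ) + 2)))) *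
                  Chemo.pathNorm α t Z ^ (1 / α))
                (ENNReal.ofReal (C * (max (p : ℝ) χ) ^ (((p : ℝ) + 1) / ((p : ℝ) + 2)) * 𝔪))) := by
  obtain ⟨hα0, hα1⟩ := hα
  have hα1 : α < 1 := by linarith [hα₀.2]
  have hη0 : 0 < η := by linarith [hη.1, hα₀.2]
  obtain ⟨C₁, hC₁, hsplits⟩ := Chemo.exists_splits hα0 hα1 (δ := 1 / 500) (by norm_num) (by norm_num)
  -- The first entry feeds `threshold_le`; the second makes the mean at most `L / 500 = δ L`.
  set C : ℝ := max ((C₁ * (1 + T / 4)) ^ (1 / α)) 500 with hC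
  have hC500 : 500 ≤ C := le_max_right _ _
  have hC0 : 0 < C := by linarith
  have hCα : C₁ * (1 + T / 4) ≤ C ^ α := by
    calc C₁ * (1 + T / 4) = ((C₁ * (1 + T / 4)) ^ (1 / α)) ^ α := by
          rw [← Real.rpow_mul (by positivity), one_div, inv_mul_cancel₀ hα0.ne', Real.rpow_one]
      _ ≤ C ^ α := Real.rpow_le_rpow (by positivity) (le_max_left _ _) hα0.le
  refine ⟨C, hC0, fun p χ 𝔪 ζ Z w hp hpe hχ h𝔪 _ hζ hZ hZ0 hw t ht => ?_⟩
  obtain ⟨q, rfl⟩ : ∃ q, p = q + 2 := ⟨p - 2, by omega⟩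
  have hq : Even q := by
    have := Nat.even_add.1 hpe
    exact this.2 (by decide)
  set A : ℝ := max ((q + 2 : ℕ) : ℝ) χ with hA
  have hqA : (q : ℝ) + 2 ≤ A := by
    have := le_max_left ((q + 2 : ℕ) : ℝ) χ
    push_cast at this
    rw [hA]
    push_cast
    exact this
  have hχA : χ ≤ A := le_max_right _ _
  have q0 : (0 : ℝ) ≤ q := q.cast_nonneg
  have hA1 : 1 ≤ A := by linarith
  have hA0 : 0 < A := by linarith
  set γ : ℝ := (((q + 2 : ℕ) : ℝ) * (1 + α) + 2 + α) / (α * (((q + 2 : ℕ) : ℝ) + 2)) with hγ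
  -- In fact `α γ = 1 + α (p + 1) / (p + 2)`.
  have hαγ : 1 ≤ α * γ := by
    have : α * γ = (((q : ℝ) + 2) * (1 + α) + 2 + α) / (q + 2 + 2) := by
      rw [hγ]; push_cast; field_simp
    rw [this, one_le_div (by positivity)]
    nlinarith
  set κ : ℝ := (((q + 2 : ℕ) : ℝ) + 1) / (((q + 2 : ℕ) : ℝ) + 2) with hκ
  have hκ0 : 0 ≤ κ := by positivity
  have h𝔪0 : 0 ≤ 𝔪 := by rcases h𝔪 with rfl | rfl <;> norm_num
  -- If the path norm is infinite, so is the right-hand side.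
  rcases eq_or_ne (Chemo.pathNorm α t Z) ⊤ with htop | htop
  · have : ENNReal.ofReal (C * A ^ γ) * Chemo.pathNorm α t Z ^ (1 / α) = ⊤ := by
      rw [htop, ENNReal.top_rpow_of_pos (by positivity),
        ENNReal.mul_top (ENNReal.ofReal_pos.2 (by positivity)).ne']
    rw [this]
    simp
  set z : ℝ := (Chemo.pathNorm α t Z).toReal with hz
  have hz0 : 0 ≤ z := ENNReal.toReal_nonneg
  have hzp : Chemo.pathNorm α t Z = ENNReal.ofReal z := (ENNReal.ofReal_toReal htop).symm
  set L : ℝ := max ((χ * t / 4) ^ (-(1 / 2) : ℝ)) (max (C * A ^ γ * z ^ (1 / α)) (C * A ^ κ * 𝔪))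
    with hL
  have hL1 : (χ * t / 4) ^ (-(1 / 2) : ℝ) ≤ L := le_max_left _ _
  have hL2 : C * A ^ γ * z ^ (1 / α) ≤ L := (le_max_left _ _).trans (le_max_right _ _)
  have hL3 : C * A ^ κ * 𝔪 ≤ L := (le_max_right _ _).trans (le_max_right _ _)
  have ht0 : 0 < t := ht.1
  have hL0 : 0 < L := lt_of_lt_of_le (by positivity) hL1
  have h𝔪L : |𝔪| ≤ 1 / 500 * L := by
    rw [abs_of_nonneg h𝔪0]
    have h1 : 1 ≤ A ^ κ := Real.one_le_rpow hA1 hκ0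
    have : 500 * 1 * 𝔪 ≤ C * A ^ κ * 𝔪 := by gcongr
    linarith
  obtain ⟨ρ, R, G, hRc, hGc, hρ, hRρ, hGR, hode, hmean⟩ :=
    hw.exists_flux hα0 hα1 hη0 hη.2 hT hχ hZ
  have hwc := hw.mem.1.continuousOn hα0 hα1
  have hZc := (hZ.continuousOn hα0 hα1).mono Ioc_subset_Icc_self
  have key : Chemo.lpn (q + 2) (w t) ≤ L := by
    refine Chemo.le_threshold_of_decay hχ hL0 ht0 hL1 (Y := fun s => Chemo.lpn (q + 2) (w s))
      ((Chemo.continuous_lpn (by omega)).comp_continuousOn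
        (hwc.mono (Ioc_subset_Ioc_right ht.2))) fun s hs hY => ?_
    refine Chemo.lpn_decay hq hχ (δ := 1 / 500) (by norm_num) le_rfl hwc hZc hRc hGc hρ hRρ hGR hode
      (𝔪 := 𝔪) (fun r hr => ?_) hL0 h𝔪L hs.1 hs.2 ht.2 (fun r hr N hN => ?_) hY
    · simp only [ContinuousMap.add_apply]
      rw [integral_add, hmean r hr, hZ0 r (Ioc_subset_Icc_self hr), hζ, add_zero]
      · rw [Chemo.volume_eq_haar]; exact Chemo.integrable_torus (w r).continuous
      · rw [Chemo.volume_eq_haar]; exact Chemo.integrable_torus (Z r).continuous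
    · obtain ⟨h1, h2⟩ := Chemo.threshold_le hα0 hα1 hT hC₁ hA1 hχ hχA hz0 ht0 ht.2 hαγ
        (hL1.trans hN) hC0 hCα (hL2.trans hN)
      refine hsplits q χ A z N (Z r) hχ hχA (by linarith) (hL0.trans_le hN) hz0 ?_ h1 h2
      rw [← hzp]
      exact le_iSup₂ (f := fun s (_ : s ∈ Icc 0 t) => Chemo.besovNorm α (Chemo.funCoeff (Z s))) r
        ⟨hs.1.le.trans hr.1, hr.2⟩
  have he : eLpNorm (w t) ((q + 2 : ℕ) : ℝ≥0∞) volume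
      = ENNReal.ofReal (Chemo.lpn (q + 2) (w t)) :=
    (ENNReal.ofReal_toReal (Chemo.memLp_torus (q + 2) (w t)).eLpNorm_ne_top).symm
  rw [he, hzp, ENNReal.ofReal_rpow_of_nonneg hz0 (by positivity),
    ← ENNReal.ofReal_mul (by positivity)]
  refine (ENNReal.ofReal_le_ofReal key).trans ?_
  rw [hL, ENNReal.ofReal_max, ENNReal.ofReal_max]
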